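/- Let $X$ be a vector field of class $\mathcal C^k$ on an open set $U\subseteq\mathbb R^2$, where $1\le k\in\mathbb N\cup\{\infty,\omega\}$ ($\mathcal C^\omega$ meaning real analytic), and let $p\in U$ be a non-degenerate center of $X$: $X(p)=0$, the eigenvalues of $DX(p)$ are $\pm i\omega_0$ with $\omega_0>0$, and $p$ has an open connected neighborhood $W\subseteq U$ such that $W\setminus\{p\}$ is a union of (non-constant) periodic orbits of $X$. Let $\mathcal V$ be the largest such neighborhood (the period annulus of $p$, with $p$ included), and let $T:\mathcal V\to\mathbb R$ be the period function: $T(q)$ is the minimal period of the orbit through $q$ for $q\in\mathcal V\setminus\{p\}$, and $T(p)=2\pi/\omega_0$. Put $\infty-1=\infty$ and $\omega-1=\omega$. (1) $T$ is of class $\mathcal C^k$ on $\mathcal V\setminus\{p\}$ and of class $\mathcal C^{k-1}$ at $p$. (2) In general the regularity of $T$ at $p$ can not be improved: for each $k\in\{1,2,3,\dots\}\cup\{\infty,\omega\}$ there is a planar vector field of class $\mathcal C^k$ with a non-degenerate center $p$ whose period function is not of class $\mathcal C^m$ at $p$ for any $m\in\mathbb N\cup\{\infty,\omega\}$ with $m>k-1$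 (where $n<\infty<\omega$ for all $n\in\mathbb N$). (3) Explicit examples for finite $k\ge1$: let $a\in\mathbb R\setminus\mathbb N$ satisfy $k-1<2a\le k$ (for instance $a=k/2$ for $k$ odd and $a=k/2-1/4$ for $k$ even). Then the vector field on $\mathbb R^2$ of the system $$\dot x=-y\left(1+(x^2+y^2)^a\right),\qquad \dot y=x\left(1+(x^2+y^2)^a\right)$$ is of class $\mathcal C^k$, it has a non-degenerate center at the origin with $\omega_0=1$ and $\mathcal V=\mathbb R^2$, its period function is $T(x,y)=2\pi/(1+(x^2+y^2)^a)$, and $T$ is not of class $\mathcal C^k$ at the origin. -/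

import Mathlib

namespace PlanarCenter

/-- The Euclidean plane. -/
abbrev Plane := EuclideanSpace ℝ (Fin 2)

/-- `γ` is a (non-constant) periodic orbit, lying in `U`, of the autonomous system `q' = X q`, with
minimal period `T`. A constant curve is excluded, since its positive periods have no least one. -/
def IsPeriodicOrbit (U : Set Plane) (X : Plane → Plane) (γ : ℝ → Plane) (T : ℝ) : Prop :=
  (∀ t, γ t ∈ U) ∧ IsIntegralCurve γ (fun _ => X) ∧
    IsLeast {τ : ℝ | 0 < τ ∧ Function.Periodic γ τ} T

/-- `W` is an open connected neighborhood of `p` in `U` such that `W \ {p}` is filled with periodic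
orbits of `X`: through each of its points passes a periodic orbit that stays in `W \ {p}`. -/
def IsFoliatedNhd (U : Set Plane) (X : Plane → Plane) (p : Plane) (W : Set Plane) : Prop :=
  IsOpen W ∧ IsConnected W ∧ p ∈ W ∧ W ⊆ U ∧
    ∀ q ∈ W \ {p}, ∃ γ T, γ 0 = q ∧ IsPeriodicOrbit U X γ T ∧ ∀ t, γ t ∈ W \ {p}

/-- `p` is a center of `X`: a singular point with a punctured neighborhood filled with
periodic orbits. -/
def IsCenter (U : Set Plane) (X : Plane → Plane) (p : Plane) : Prop :=
  X p = 0 ∧ ∃ W, IsFoliatedNhd U X p W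

/-- `p` is a non-degenerate center of `X`: a center such that the eigenvalues of `DX(p)` (the
complex roots of its characteristic polynomial) are `± i ω₀`, where `ω₀ > 0`. -/
def IsNondegenerateCenter (U : Set Plane) (X : Plane → Plane) (p : Plane) (ω₀ : ℝ) : Prop :=
  IsCenter U X p ∧ 0 < ω₀ ∧
    (LinearMap.charpoly (fderiv ℝ X p : Plane →ₗ[ℝ] Plane)).aroots ℂ =
      {(ω₀ : ℂ) * Complex.I, -((ω₀ : ℂ) * Complex.I)}

/-- The period annulus `V` of the center `p` (with `p` included): the largest open connected
neighborhood of `p` such that `V \ {p}` is filled with periodic orbits. -/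
def periodAnnulus (U : Set Plane) (X : Plane → Plane) (p : Plane) : Set Plane :=
  ⋃₀ {W | IsFoliatedNhd U X p W}

/-- The period annulus of a center is indeed the largest such neighborhood. -/
theorem isGreatest_periodAnnulus {U : Set Plane} {X : Plane → Plane} {p : Plane}
    (h : IsCenter U X p) :
    IsGreatest {W | IsFoliatedNhd U X p W} (periodAnnulus U X p) := by
  obtain ⟨-, W₀, h₀⟩ := h
  have hp : p ∈ periodAnnulus U X p := ⟨W₀, h₀, h₀.2.2.1⟩
  refine ⟨⟨isOpen_sUnion fun W hW => hW.1, ⟨⟨p, hp⟩, ?_⟩, hp,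
    Set.sUnion_subset fun W hW => hW.2.2.2.1, ?_⟩, fun W hW => Set.subset_sUnion_of_mem hW⟩
  · exact isPreconnected_sUnion p _ (fun W hW => hW.2.2.1) fun W hW => hW.2.1.isPreconnected
  · rintro q ⟨⟨W, hW, hqW⟩, hqp⟩
    obtain ⟨γ, T, h1, h2, h3⟩ := hW.2.2.2.2 q ⟨hqW, hqp⟩
    exact ⟨γ, T, h1, h2, fun t => ⟨⟨W, hW, (h3 t).1⟩, (h3 t).2⟩⟩

open Classical in
/-- The period function of a center `p` of `X` with eigenvalues `± i ω₀`: at `q ≠ p` in the period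
annulus it is the minimal period of the periodic orbit through `q` (the set below then has this
number as its only element), and at `p` it is `2 π / ω₀`. -/
noncomputable def periodFunction (U : Set Plane) (X : Plane → Plane) (p : Plane) (ω₀ : ℝ)
    (q : Plane) : ℝ :=
  if q = p then 2 * Real.pi / ω₀
  else sInf {T : ℝ | ∃ γ, γ 0 = q ∧ IsPeriodicOrbit U X γ T}

/-- The vector field of the system `x' = -y (1 + (x² + y²)^a)`, `y' = x (1 + (x² + y²)^a)`. -/
noncomputable def exampleField (a : ℝ) (q : Plane) : Plane :=
  !₂[-(q 1) * (1 + ((q 0) ^ 2 + (q 1) ^ 2) ^ a), (q 0) * (1 + ((q 0) ^ 2 + (q 1) ^ 2) ^ a)]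

end PlanarCenter

/-! Regularity. An orbit arc, rescaled to the unit interval, solves an integral equation in a Banach
space of continuous curves. Superposition operators inherit the class of the field (finite, smooth
or analytic), and the linearized equation is the identity minus a Volterra operator, hence
invertible; so the implicit function theorem makes the flow of class `C^k` (`contDiffAt_orbitPath`).

Away from `p`, the period solves the scalar equation `⟨X q, φ_t x - x⟩ = 0`, whose time derivative
at `(q, T q)` is `|X q|² > 0`. Thus `T` is `C^k` once it is continuous. It cannot drop, by
compactness. It cannot jump up, because a nearby periodic orbit not passing through `q` has a lowest
point on a half-section at `q`, and an intermediate value argument shows that the return map fixes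
that point, with return time close to `T q` (`exists_fixed_return`). The same argument on a ray from
`p`, with the flow compared to a rotation, gives `T → 2π/ω₀` at `p`.

At `p` the displacement vanishes identically, so a factor must be divided out at the price of one
derivative. Let `W(τ, x)` be the first Fourier coefficient of the arc of duration `τ` from `x`, in a
complex coordinate where `DX(p)` is multiplication by `iω₀`. Near `(2π/ω₀, p)` the map `(τ, x) ↦ (τ,
W)` is a local diffeomorphism, and for `τ = T x` a time shift along the orbit rotates `W`. Hence the
displacement, written as `K(τ, w)`, vanishes on a whole circle `|w| = const` when `τ = T x`. By the
divergence theorem the mean `g(τ, w)` of `∂K/∂w` over the disc of radius `|w|` is then zero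
(`exists_circle_quotient`). The function `g` is `C^(k-1)` and `g(τ, 0) = i(ω₀ τ - 2π)` has nonzero
`τ`-derivative, so the implicit function theorem solves `Im g = 0` for `τ = T x`.

Sharpness. A field rotating each circle with angular velocity `1 + h(r²)` has `T = 2π / (1 +
h(r²))`. For `h(s) = s^a` the field gains one order of smoothness over `T`, from the homogeneous
factor `rot q`; for `k = ∞` a flat nonzero `h` is not analytic, and for `k = ω` there is nothing to
exclude. -/

open scoped Topology ContDiff
open Filter

/-! ### Smoothness of superposition operators -/

namespace ContinuousMap

universe u
variable {K : Type*} [TopologicalSpace K] [CompactSpace K]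
  {E : Type u} [NormedAddCommGroup E] [NormedSpace ℝ E]
  {F : Type u} [NormedAddCommGroup F] [NormedSpace ℝ F]

/-- The superposition operator `v ↦ f ∘ v` on continuous maps. -/
noncomputable def superposition (K : Type*) [TopologicalSpace K] {E F : Type*} [TopologicalSpace E]
    [TopologicalSpace F] [Zero F] (f : E → F) (v : C(K, E)) : C(K, F) :=
  ContinuousMap.mkD (f ∘ v) 0

omit [CompactSpace K] [NormedSpace ℝ E] [NormedSpace ℝ F] in
theorem superposition_apply {f : E → F} {v : C(K, E)} (h : ∀ t, ContinuousAt f (v t)) (t : K) :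
    superposition K f v t = f (v t) := by
  have : Continuous (f ∘ v) :=
    continuous_iff_continuousAt.2 fun t => (h t).comp v.continuous.continuousAt
  simp [superposition, ContinuousMap.mkD_of_continuous this]

-- A tube lemma along the compact space `K`: conditions near the points `(v t, v t)` become uniform
-- in `t`. The uniform remainder estimates for superposition operators rest on it.
omit [NormedSpace ℝ E] in
theorem eventually_forall_pair {Q : E → E → Prop} (v : C(K, E))
    (h : ∀ t, ∀ᶠ z in 𝓝 (v t, v t), Q z.1 z.2) : ∀ᶠ w in 𝓝 v, ∀ t, Q (w t) (v t) := by
  have := isCompact_univ.eventually_forall_of_forall_eventually (x₀ := v) (K := (Set.univ : Set K))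
    (P := fun w t => Q (w t) (v t)) (fun t _ => ?_)
  · simpa using this
  · have hc : ContinuousAt (fun z : C(K, E) × K => (z.1 z.2, v z.2)) (v, t) := by
      refine ContinuousAt.prodMk ?_ (v.continuous.continuousAt.comp continuousAt_snd)
      refine Metric.tendsto_nhds.2 fun ε hε => ?_
      filter_upwards [continuousAt_fst.eventually (Metric.ball_mem_nhds v (half_pos hε)),
        continuousAt_snd.eventually
          (v.continuous.continuousAt (Metric.ball_mem_nhds (v t) (half_pos hε)))] with z hz hz'
      calc dist (z.1 z.2) (v t) ≤ dist (z.1 z.2) (v z.2) + dist (v z.2) (v t) := dist_triangle _ _ _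
        _ < ε / 2 + ε / 2 := add_lt_add ((ContinuousMap.dist_apply_le_dist _).trans_lt hz) hz'
        _ = ε := add_halves ε
    exact hc.eventually (h t)

omit [NormedSpace ℝ E] in
theorem eventually_forall_apply {Q : E → Prop} (v : C(K, E))
    (h : ∀ t, ∀ᶠ z in 𝓝 (v t), Q z) : ∀ᶠ w in 𝓝 v, ∀ t, Q (w t) :=
  eventually_forall_pair (Q := fun x _ => Q x) v fun t => continuousAt_fst.eventually (h t)

/-- Pointwise application of a continuous family of linear maps. -/
noncomputable def pointwiseApply (K : Type*) [TopologicalSpace K] [CompactSpace K]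
    (E F : Type u) [NormedAddCommGroup E] [NormedSpace ℝ E] [NormedAddCommGroup F]
    [NormedSpace ℝ F] : C(K, E →L[ℝ] F) →L[ℝ] C(K, E) →L[ℝ] C(K, F) :=
  LinearMap.mkContinuous₂
    (LinearMap.mk₂ ℝ
      (fun (A : C(K, E →L[ℝ] F)) (h : C(K, E)) =>
        (⟨fun t => A t (h t), A.continuous.clm_apply h.continuous⟩ : C(K, F)))
      (fun _ _ _ => by ext; simp) (fun _ _ _ => by ext; simp) (fun _ _ _ => by ext; simp)
      (fun _ _ _ => by ext; simp)) 1 (fun A h => by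
        rw [one_mul, ContinuousMap.norm_le _ (by positivity)]
        intro t
        exact ((A t).le_opNorm _).trans (mul_le_mul (A.norm_coe_le_norm t) (h.norm_coe_le_norm t)
          (norm_nonneg (h t)) (norm_nonneg A)))

@[simp]
theorem pointwiseApply_apply (A : C(K, E →L[ℝ] F)) (h : C(K, E)) (t : K) :
    pointwiseApply K E F A h t = A t (h t) := rfl

theorem eventually_continuousAt_superposition {f : E → F} {v : C(K, E)}
    (h : ∀ t, ContDiffAt ℝ 1 f (v t)) : ∀ᶠ w in 𝓝 v, ∀ t, ContDiffAt ℝ 1 f (w t) :=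
  eventually_forall_apply v fun t => (h t).eventually (by simp)

/-- Strict differentiability of `f` at `v t`, together with continuity of `fderiv ℝ f` there,
controls the remainder with a moving base point; compactness makes the control uniform in `t`. -/
theorem hasFDerivAt_superposition {f : E → F} {v : C(K, E)}
    (h : ∀ t, ContDiffAt ℝ 1 f (v t)) :
    HasFDerivAt (superposition K f)
      (pointwiseApply K E F (superposition K (fderiv ℝ f) v)) v := by
  refine HasFDerivAt.of_isLittleO (Asymptotics.isLittleO_iff.2 fun c hc => ?_)
  have h1 : ∀ᶠ w in 𝓝 v, ∀ t,
      ‖f (w t) - f (v t) - fderiv ℝ f (v t) (w t - v t)‖ ≤ c * ‖w t - v t‖ := by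
    refine eventually_forall_pair (Q := fun x y =>
      ‖f x - f y - fderiv ℝ f y (x - y)‖ ≤ c * ‖x - y‖) v fun t => ?_
    have h2 := ((h t).hasStrictFDerivAt (by simp)).isLittleO.def (half_pos hc)
    have h3 : ContinuousAt (fderiv ℝ f) (v t) := ((h t).fderiv_right (m := 0) (by simp)).continuousAt
    have h4 : ∀ᶠ z : E × E in 𝓝 (v t, v t), ‖fderiv ℝ f z.2 - fderiv ℝ f (v t)‖ ≤ c / 2 := by
      have := (continuousAt_snd (p := (v t, v t))).eventually
        (h3.eventually (Metric.closedBall_mem_nhds _ (half_pos hc)))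
      filter_upwards [this] with z hz
      simpa [dist_eq_norm] using hz
    filter_upwards [h2, h4] with z hz hz'
    calc ‖f z.1 - f z.2 - fderiv ℝ f z.2 (z.1 - z.2)‖
        = ‖(f z.1 - f z.2 - fderiv ℝ f (v t) (z.1 - z.2)) -
          (fderiv ℝ f z.2 - fderiv ℝ f (v t)) (z.1 - z.2)‖ := by
          congr 1; simp
      _ ≤ c / 2 * ‖z.1 - z.2‖ + c / 2 * ‖z.1 - z.2‖ := by
          refine (norm_sub_le _ _).trans (add_le_add hz ?_)
          exact ((fderiv ℝ f z.2 - fderiv ℝ f (v t)).le_opNorm _).trans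
            (mul_le_mul_of_nonneg_right hz' (norm_nonneg _))
      _ = c * ‖z.1 - z.2‖ := by ring
  filter_upwards [h1, eventually_continuousAt_superposition h] with w hw hw'
  rw [ContinuousMap.norm_le _ (by positivity)]
  intro t
  simp only [ContinuousMap.sub_apply, pointwiseApply_apply]
  rw [superposition_apply (fun t => (hw' t).continuousAt),
    superposition_apply (fun t => (h t).continuousAt),
    superposition_apply (fun t => ((h t).fderiv_right (m := 0) (by simp)).continuousAt)]
  exact (hw t).trans (mul_le_mul_of_nonneg_left ((w - v).norm_coe_le_norm t) hc.le)

/-- Induction on `n`: the derivative is the superposition operator of `fderiv ℝ f` followed by a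
fixed continuous linear map. The target space changes to `E →L[ℝ] F` at each step, hence the
quantification over `F` after `n` and the common universe. -/
theorem contDiffAt_superposition_nat {E : Type u} [NormedAddCommGroup E] [NormedSpace ℝ E] (n : ℕ) :
    ∀ {F : Type u} [NormedAddCommGroup F] [NormedSpace ℝ F] {f : E → F} {v : C(K, E)},
    (∀ t, ContDiffAt ℝ n f (v t)) → ContDiffAt ℝ n (superposition K f) v := by
  induction n with
  | zero =>
    intro F _ _ f v h
    refine contDiffAt_zero.2 ⟨{w | ∀ t, ContDiffAt ℝ 0 f (w t)},
      eventually_forall_apply v fun t => (h t).eventually (by simp), fun w hw => ?_⟩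
    suffices hc : ContinuousAt (superposition K f) w from hc.continuousWithinAt
    refine Metric.tendsto_nhds.2 fun ε hε => ?_
    have h1 : ∀ᶠ w' in 𝓝 w, ∀ t, dist (f (w' t)) (f (w t)) ≤ ε / 2 :=
      eventually_forall_pair (Q := fun x y => dist (f x) (f y) ≤ ε / 2) w fun t => by
        have h2 : ContinuousAt (fun z : E × E => dist (f z.1) (f z.2)) (w t, w t) :=
          ((hw t).continuousAt.comp_of_eq continuousAt_fst rfl).dist
            ((hw t).continuousAt.comp_of_eq continuousAt_snd rfl)
        exact h2.eventually_le_const (by simpa using half_pos hε)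
    have h4 : ∀ᶠ w' in 𝓝 w, ∀ t, ContDiffAt ℝ 0 f (w' t) :=
      eventually_forall_apply w fun t => (hw t).eventually (by simp)
    filter_upwards [h1, h4] with w' h1 h4
    refine lt_of_le_of_lt ((ContinuousMap.dist_le (half_pos hε).le).2 fun t => ?_) (half_lt_self hε)
    rw [superposition_apply fun t => (h4 t).continuousAt,
      superposition_apply fun t => (hw t).continuousAt]
    exact h1 t
  | succ n ih =>
    intro F _ _ f v h
    refine contDiffAt_succ_iff_hasFDerivAt.2
      ⟨fun w => pointwiseApply K E F (superposition K (fderiv ℝ f) w), ⟨_,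
        eventually_continuousAt_superposition
          fun t => (h t).of_le (by simp), fun w hw => hasFDerivAt_superposition hw⟩, ?_⟩
    exact (pointwiseApply K E F).contDiff.contDiffAt.comp v
      (ih fun t => (h t).fderiv_right (by norm_cast))

theorem tsum_fiber_le_tsum {α : Type*} {β : α → Type*} {g : (Σ a, β a) → NNReal}
    (hg : Summable g) (a : α) : ∑' b, g ⟨a, b⟩ ≤ ∑' s, g s :=
  NNReal.tsum_comp_le_tsum_of_inj hg sigma_mk_injective

/-- Cauchy estimates uniform in the centre: the Taylor coefficients at a nearby `y` come from
re-expanding the series at `x`, and one convergent multiple series bounds them all. -/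
theorem exists_norm_iteratedFDeriv_le [CompleteSpace F] {f : E → F} {x : E} (h : AnalyticAt ℝ f x) :
    ∃ C > 0, ∃ r > 0, ∀ᶠ y in 𝓝 x,
      (∀ n, ‖(n.factorial : ℝ)⁻¹ • iteratedFDeriv ℝ n f y‖ * r ^ n ≤ C) ∧
      ∀ z, ‖z‖ < r → HasSum (fun n => (n.factorial : ℝ)⁻¹ • iteratedFDeriv ℝ n f y fun _ => z)
        (f (y + z)) := by
  obtain ⟨p, R, hp⟩ := h
  -- With `2 r < R` the centre may move by `r` and the re-expanded series still converges on a ball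
  -- of radius `r`.
  obtain ⟨r, hr0, hr⟩ : ∃ r : NNReal, 0 < r ∧ (r + r : ENNReal) < R := by
    obtain ⟨s, hs0, hs⟩ := ENNReal.lt_iff_exists_nnreal_btwn.1 hp.r_pos
    refine ⟨s / 2, by simpa using hs0, ?_⟩
    rw [← ENNReal.coe_add, add_halves]
    exact hs
  have hsum := p.changeOriginSeries_summable_aux₁ (r := r) (r' := r) (lt_of_lt_of_le hr hp.r_le)
  set S := ∑' s : Σ k l : ℕ, { s : Finset (Fin (k + l)) // s.card = l },
    ‖p (s.1 + s.2.1)‖₊ * r ^ s.2.1 * r ^ s.1 with hS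
  refine ⟨S + 1, by positivity, r, hr0, ?_⟩
  filter_upwards [Metric.ball_mem_nhds x hr0] with y hy
  have hy' : ‖y - x‖₊ < r := by simpa [← NNReal.coe_lt_coe, dist_eq_norm] using hy
  have hyR : ((‖y - x‖₊ : NNReal) : ENNReal) < R :=
    (ENNReal.coe_lt_coe.2 hy').trans (lt_of_le_of_lt (le_add_of_nonneg_left zero_le) hr)
  have hq := hp.changeOrigin hyR
  rw [add_sub_cancel] at hq
  refine ⟨fun n => ?_, fun z hz => hq.hasSum_iteratedFDeriv ?_⟩
  · have h1 : ‖p.changeOrigin (y - x) n‖₊ * r ^ n ≤ S := by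
      have h2 := p.nnnorm_changeOrigin_le n (x := y - x) (hyR.trans_le hp.r_le)
      have h3 : Summable fun s : Σ l : ℕ, { s : Finset (Fin (n + l)) // s.card = l } =>
          ‖p (n + s.1)‖₊ * r ^ s.1 * r ^ n := (NNReal.summable_sigma.1 hsum).1 n
      have h3' : Summable fun s : Σ l : ℕ, { s : Finset (Fin (n + l)) // s.card = l } =>
          ‖p (n + s.1)‖₊ * r ^ s.1 := by
        simpa only [mul_inv_cancel_right₀ (pow_pos hr0 _).ne'] using h3.mul_right (r ^ n)⁻¹
      calc ‖p.changeOrigin (y - x) n‖₊ * r ^ n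
          ≤ (∑' s : Σ l : ℕ, { s : Finset (Fin (n + l)) // s.card = l },
              ‖p (n + s.1)‖₊ * r ^ s.1) * r ^ n := by
            gcongr
            refine h2.trans (Summable.tsum_le_tsum (fun s => by gcongr) ?_ h3')
            exact NNReal.summable_of_le (fun s => by gcongr) h3'
        _ = ∑' s : Σ l : ℕ, { s : Finset (Fin (n + l)) // s.card = l },
              ‖p (n + s.1)‖₊ * r ^ s.1 * r ^ n := by rw [NNReal.tsum_mul_right]
        _ ≤ S := tsum_fiber_le_tsum (β := fun k => Σ l : ℕ, { s : Finset (Fin (k + l)) // s.card = l })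
            hsum n
    have h4 : ‖iteratedFDeriv ℝ n f y‖ ≤ n.factorial * ‖p.changeOrigin (y - x) n‖ := by
      refine ContinuousMultilinearMap.opNorm_le_bound (by positivity) fun m => ?_
      rw [hq.iteratedFDeriv_eq_sum_of_completeSpace]
      refine (norm_sum_le _ _).trans ?_
      calc ∑ σ : Equiv.Perm (Fin n), ‖p.changeOrigin (y - x) n fun i => m (σ i)‖
          ≤ ∑ σ : Equiv.Perm (Fin n), ‖p.changeOrigin (y - x) n‖ * ∏ i, ‖m i‖ := by
            refine Finset.sum_le_sum fun σ _ => ?_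
            refine (ContinuousMultilinearMap.le_opNorm _ _).trans (le_of_eq ?_)
            rw [Equiv.prod_comp σ fun i => ‖m i‖]
        _ = n.factorial * ‖p.changeOrigin (y - x) n‖ * ∏ i, ‖m i‖ := by
            simp [Fintype.card_perm, mul_assoc]
    have h1' : ‖p.changeOrigin (y - x) n‖ * (r : ℝ) ^ n ≤ S := by exact_mod_cast h1
    rw [norm_smul, norm_inv, Real.norm_natCast]
    calc (n.factorial : ℝ)⁻¹ * ‖iteratedFDeriv ℝ n f y‖ * (r : ℝ) ^ n
        ≤ (n.factorial : ℝ)⁻¹ * (n.factorial * ‖p.changeOrigin (y - x) n‖) * (r : ℝ) ^ n := by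
          gcongr
      _ = ‖p.changeOrigin (y - x) n‖ * (r : ℝ) ^ n := by field_simp
      _ ≤ S + 1 := by linarith
  · rw [Metric.mem_eball, edist_zero_right, enorm_eq_nnnorm, lt_tsub_iff_right]
    refine lt_of_le_of_lt (add_le_add ?_ (ENNReal.coe_le_coe.2 hy'.le)) hr
    exact ENNReal.coe_le_coe.2 (by exact_mod_cast hz.le)

theorem exists_forall_norm_iteratedFDeriv_le [CompleteSpace F] {f : E → F} {v : C(K, E)}
    (h : ∀ t, AnalyticAt ℝ f (v t)) :
    ∃ C > 0, ∃ r > 0, ∀ t,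
      (∀ n, ‖(n.factorial : ℝ)⁻¹ • iteratedFDeriv ℝ n f (v t)‖ * r ^ n ≤ C) ∧
      ∀ z, ‖z‖ < r → HasSum (fun n => (n.factorial : ℝ)⁻¹ • iteratedFDeriv ℝ n f (v t) fun _ => z)
        (f (v t + z)) := by
  have := isCompact_univ.induction_on (X := K) (p := fun s => ∃ C > 0, ∃ r > 0, ∀ t ∈ s,
      (∀ n, ‖(n.factorial : ℝ)⁻¹ • iteratedFDeriv ℝ n f (v t)‖ * r ^ n ≤ C) ∧
      ∀ z, ‖z‖ < r → HasSum (fun n => (n.factorial : ℝ)⁻¹ • iteratedFDeriv ℝ n f (v t) fun _ => z)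
        (f (v t + z))) ⟨1, one_pos, 1, one_pos, by simp⟩ ?_ ?_ ?_
  · simpa using this
  · rintro s t hst ⟨C, hC, r, hr, H⟩
    exact ⟨C, hC, r, hr, fun x hx => H x (hst hx)⟩
  · rintro s t ⟨C, hC, r, hr, H⟩ ⟨C', hC', r', hr', H'⟩
    refine ⟨max C C', lt_max_of_lt_left hC, min r r', lt_min hr hr', ?_⟩
    rintro x (hx | hx)
    · refine ⟨fun n => le_trans ?_ (((H x hx).1 n).trans (le_max_left _ _)),
        fun z hz => (H x hx).2 z (hz.trans_le (min_le_left _ _))⟩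
      gcongr
      exact min_le_left _ _
    · refine ⟨fun n => le_trans ?_ (((H' x hx).1 n).trans (le_max_right _ _)),
        fun z hz => (H' x hx).2 z (hz.trans_le (min_le_right _ _))⟩
      gcongr
      exact min_le_right _ _
  · intro t _
    obtain ⟨C, hC, r, hr, H⟩ := exists_norm_iteratedFDeriv_le (h t)
    exact ⟨_, mem_nhdsWithin_of_mem_nhds (v.continuous.continuousAt.eventually H),
      C, hC, r, hr, fun x hx => hx⟩

/-- Pointwise application of a continuous family of multilinear maps. -/
noncomputable def pointwiseMultilinear {n : ℕ} (A : C(K, E [×n]→L[ℝ] F)) :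
    C(K, E) [×n]→L[ℝ] C(K, F) :=
  MultilinearMap.mkContinuous
    { toFun := fun h => ⟨fun t => A t fun i => h i t, by fun_prop⟩
      map_update_add' := fun m i x y => by
        ext t
        have key : ∀ w : C(K, E), (fun j => (Function.update m i w) j t) =
            Function.update (fun j => m j t) i (w t) := fun w => by
          ext j; rcases eq_or_ne j i with rfl | hj <;> simp [*]
        simp [key]
      map_update_smul' := fun m i c x => by
        ext t
        have key : ∀ w : C(K, E), (fun j => (Function.update m i w) j t) =
            Function.update (fun j => m j t) i (w t) := fun w => by
          ext j; rcases eq_or_ne j i with rfl | hj <;> simp [*]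
        simp [key] }
    ‖A‖ fun m => by
      rw [ContinuousMap.norm_le _ (by positivity)]
      intro t
      refine ((A t).le_opNorm _).trans (mul_le_mul (A.norm_coe_le_norm t) ?_
        (by positivity) (norm_nonneg A))
      exact Finset.prod_le_prod (fun _ _ => norm_nonneg _) fun i _ => (m i).norm_coe_le_norm t

theorem norm_pointwiseMultilinear_le {n : ℕ} (A : C(K, E [×n]→L[ℝ] F)) :
    ‖pointwiseMultilinear A‖ ≤ ‖A‖ :=
  MultilinearMap.mkContinuous_norm_le _ (norm_nonneg A) _

/-- The Taylor series of `f` at the points `v t`, taken pointwise in `t`, form one power series on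
`C(K, E)`; the uniform Cauchy bounds give its radius and evaluation at each `t` identifies its sum.
-/
theorem analyticAt_superposition [CompleteSpace F] {f : E → F} {v : C(K, E)}
    (h : ∀ t, AnalyticAt ℝ f (v t)) : AnalyticAt ℝ (superposition K f) v := by
  obtain ⟨C, hC, r, hr, H⟩ := exists_forall_norm_iteratedFDeriv_le h
  have hcont : ∀ n, Continuous fun t => (n.factorial : ℝ)⁻¹ • iteratedFDeriv ℝ n f (v t) := by
    intro n
    have : Continuous fun t => iteratedFDeriv ℝ n f (v t) :=
      continuous_iff_continuousAt.2 fun t =>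
        (((h t).contDiffAt (n := n)).iteratedFDeriv_right (m := 0) (i := n)
          (by simp)).continuousAt.comp v.continuous.continuousAt
    exact Continuous.const_smul this ((n.factorial : ℝ)⁻¹)
  let P : FormalMultilinearSeries ℝ C(K, E) C(K, F) := fun n => pointwiseMultilinear ⟨_, hcont n⟩
  have hP : ∀ n, ‖P n‖ * r ^ n ≤ C := fun n => by
    have h1 : ‖(⟨_, hcont n⟩ : C(K, E [×n]→L[ℝ] F))‖ ≤ C / r ^ n := by
      rw [ContinuousMap.norm_le _ (by positivity)]
      exact fun t => (le_div_iff₀ (pow_pos hr n)).2 ((H t).1 n)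
    refine (le_div_iff₀ (pow_pos hr n)).1 (le_trans ?_ h1)
    exact norm_pointwiseMultilinear_le _
  -- Within `ε` of `v` the composite with `f` is continuous, so `superposition` does not take its
  -- default value `0`.
  obtain ⟨ε, hε, hε'⟩ := Metric.eventually_nhds_iff.1
    (eventually_forall_apply v fun t => (h t).eventually_analyticAt)
  refine ⟨P, ENNReal.ofReal (min r ε), ?_, by simp [hr, hε], fun {y} hy => ?_⟩
  · refine le_trans (ENNReal.ofReal_le_ofReal (min_le_left _ _)) ?_
    exact P.le_radius_of_bound (r := r.toNNReal) C fun n => by simpa [hr.le] using hP n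
  · have hy1 : ‖y‖ < min r ε := by
      rw [Metric.mem_eball, edist_zero_right, ← ofReal_norm] at hy
      exact (ENNReal.ofReal_lt_ofReal_iff (lt_min hr hε)).1 hy
    have hyr : ‖y‖ < r := hy1.trans_le (min_le_left _ _)
    have hsum : Summable fun n => P n fun _ => y := by
      refine Summable.of_norm_bounded (g := fun n => C * (‖y‖ / r) ^ n)
        ((summable_geometric_of_lt_one (by positivity) ((div_lt_one hr).2 hyr)).mul_left C)
        fun n => ?_
      refine ((P n).le_opNorm _).trans ?_
      rw [Finset.prod_const, Finset.card_univ, Fintype.card_fin, div_pow, ← mul_div_assoc,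
        le_div_iff₀ (pow_pos hr n), mul_right_comm]
      exact mul_le_mul_of_nonneg_right (hP n) (by positivity)
    suffices hs : superposition K f (v + y) = ∑' n, P n fun _ => y from hs ▸ hsum.hasSum
    ext t
    rw [superposition_apply fun t => (hε' (y := v + y)
      (by simpa using hy1.trans_le (min_le_right _ _)) t).continuousAt]
    have h1 := (ContinuousMap.evalCLM ℝ t : C(K, F) →L[ℝ] F).hasSum hsum.hasSum
    exact ((H t).2 (y t) ((y.norm_coe_le_norm t).trans_lt hyr)).unique h1

/-- The superposition operator of a `C^n` map is of class `C^n`. -/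
theorem contDiffAt_superposition [CompleteSpace F] {f : E → F} {v : C(K, E)} {n : WithTop ℕ∞}
    (h : ∀ t, ContDiffAt ℝ n f (v t)) : ContDiffAt ℝ n (superposition K f) v := by
  match n with
  | ω => exact (analyticAt_superposition fun t => (h t).analyticAt).contDiffAt
  | ∞ => exact contDiffAt_infty.2 fun n =>
      contDiffAt_superposition_nat n fun t => contDiffAt_infty.1 (h t) n
  | ((n : ℕ) : ℕ∞) => exact contDiffAt_superposition_nat n h

end ContinuousMap

/-! ### Uniqueness of integral curves -/

section ODEUniqueness

variable {E : Type*} [NormedAddCommGroup E] [NormedSpace ℝ E]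

theorem exists_lipschitzOnWith_of_contDiffAt {X : E → E} {C : Set E} (hC : IsCompact C)
    (h : ∀ x ∈ C, ContDiffAt ℝ 1 X x) : ∃ K, LipschitzOnWith K X C := by
  refine LocallyLipschitzOn.exists_lipschitzOnWith_of_compact hC fun x hx => ?_
  obtain ⟨K, t, ht, hK⟩ := (h x hx).exists_lipschitzOnWith
  exact ⟨K, t, mem_nhdsWithin_of_mem_nhds ht, hK⟩

/-- Version for curves known to solve the equation only on `[0, b)`, such as those built from a
primitive over the unit interval. -/
theorem eqOn_Icc_of_integralCurves {X : E → E} {f g : ℝ → E} {b : ℝ}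
    (hf : ContinuousOn f (Set.Icc 0 b)) (hg : ContinuousOn g (Set.Icc 0 b))
    (hf' : ∀ t ∈ Set.Ico 0 b, HasDerivAt f (X (f t)) t)
    (hg' : ∀ t ∈ Set.Ico 0 b, HasDerivAt g (X (g t)) t)
    (hfX : ∀ t ∈ Set.Icc 0 b, ContDiffAt ℝ 1 X (f t))
    (hgX : ∀ t ∈ Set.Icc 0 b, ContDiffAt ℝ 1 X (g t)) (h0 : f 0 = g 0) :
    Set.EqOn f g (Set.Icc 0 b) := by
  obtain ⟨K, hK⟩ := exists_lipschitzOnWith_of_contDiffAt (X := X)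
    ((isCompact_Icc.image_of_continuousOn hf).union (isCompact_Icc.image_of_continuousOn hg))
    (by rintro _ (⟨t, ht, rfl⟩ | ⟨t, ht, rfl⟩); exacts [hfX t ht, hgX t ht])
  exact ODE_solution_unique_of_mem_Icc_right (v := fun _ => X) (fun _ _ => hK) hf
    (fun t ht => (hf' t ht).hasDerivWithinAt)
    (fun t ht => Or.inl ⟨t, Set.Ico_subset_Icc_self ht, rfl⟩) hg
    (fun t ht => (hg' t ht).hasDerivWithinAt)
    (fun t ht => Or.inr ⟨t, Set.Ico_subset_Icc_self ht, rfl⟩) h0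

theorem eq_of_integralCurves {X : E → E} {f g : ℝ → E}
    (hf : ∀ t, HasDerivAt f (X (f t)) t) (hg : ∀ t, HasDerivAt g (X (g t)) t)
    (hfX : ∀ t, ContDiffAt ℝ 1 X (f t)) (hgX : ∀ t, ContDiffAt ℝ 1 X (g t)) {t₀ : ℝ}
    (h0 : f t₀ = g t₀) : f = g := by
  have hfc : Continuous f := continuous_iff_continuousAt.2 fun t => (hf t).continuousAt
  have hgc : Continuous g := continuous_iff_continuousAt.2 fun t => (hg t).continuousAt
  ext t
  set b := |t| + |t₀| + 1
  obtain ⟨K, hK⟩ := exists_lipschitzOnWith_of_contDiffAt (X := X)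
    (((isCompact_Icc (a := -b) (b := b)).image hfc).union ((isCompact_Icc (a := -b) (b := b)).image hgc))
    (by rintro _ (⟨t, ht, rfl⟩ | ⟨t, ht, rfl⟩); exacts [hfX t, hgX t])
  have hb : ∀ s, |s| < b → s ∈ Set.Ioo (-b) b := fun s hs => abs_lt.1 hs
  exact ODE_solution_unique_of_mem_Ioo (v := fun _ => X) (fun _ _ => hK)
    (hb t₀ (by have := abs_nonneg t; simp only [b]; linarith))
    (fun t ht => ⟨hf t, Or.inl ⟨t, Set.Ioo_subset_Icc_self ht, rfl⟩⟩)
    (fun t ht => ⟨hg t, Or.inr ⟨t, Set.Ioo_subset_Icc_self ht, rfl⟩⟩) h0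
    (hb t (by have := abs_nonneg t₀; simp only [b]; linarith))

end ODEUniqueness

/-! ### The Volterra operator -/

namespace ContinuousMap

open unitInterval

universe u
variable {E : Type u} [NormedAddCommGroup E] [NormedSpace ℝ E]

/-- The primitive of a continuous curve on the unit interval, as a function on the line. -/
noncomputable def primitive (h : C(I, E)) (s : ℝ) : E :=
  ∫ r in (0 : ℝ)..s, h (Set.projIcc 0 1 zero_le_one r)

omit [NormedSpace ℝ E] in
theorem continuous_comp_projIcc (h : C(I, E)) :
    Continuous fun r : ℝ => h (Set.projIcc 0 1 zero_le_one r) :=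
  h.continuous.comp continuous_projIcc

theorem hasDerivAt_primitive [CompleteSpace E] (h : C(I, E)) (s : ℝ) :
    HasDerivAt h.primitive (h (Set.projIcc 0 1 zero_le_one s)) s :=
  intervalIntegral.integral_hasDerivAt_right (h.continuous_comp_projIcc.intervalIntegrable _ _)
    (h.continuous_comp_projIcc.stronglyMeasurableAtFilter _ _) h.continuous_comp_projIcc.continuousAt

theorem continuous_primitive (h : C(I, E)) : Continuous h.primitive :=
  intervalIntegral.continuous_primitive
    (fun a b => h.continuous_comp_projIcc.intervalIntegrable a b) 0

@[simp] theorem primitive_zero (h : C(I, E)) : h.primitive 0 = 0 := by simp [primitive]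

/-- The Volterra operator `h ↦ ∫₀ˢ h` on continuous curves on the unit interval. -/
noncomputable def volterra (E : Type u) [NormedAddCommGroup E] [NormedSpace ℝ E] :
    C(I, E) →L[ℝ] C(I, E) :=
  LinearMap.mkContinuous
    { toFun := fun h => ⟨fun s => h.primitive s, h.continuous_primitive.comp continuous_subtype_val⟩
      map_add' := fun h k => by
        ext s
        simp only [primitive, ContinuousMap.add_apply, ContinuousMap.coe_mk]
        exact intervalIntegral.integral_add (h.continuous_comp_projIcc.intervalIntegrable _ _)
          (k.continuous_comp_projIcc.intervalIntegrable _ _)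
      map_smul' := fun c h => by
        ext s
        simp [primitive] } 1 fun h => by
    rw [one_mul, ContinuousMap.norm_le _ (norm_nonneg h)]
    intro s
    refine (intervalIntegral.norm_integral_le_of_norm_le_const
      fun r _ => h.norm_coe_le_norm (Set.projIcc 0 1 zero_le_one r)).trans ?_
    rw [sub_zero, abs_of_nonneg s.2.1]
    exact mul_le_of_le_one_right (norm_nonneg h) s.2.2

theorem volterra_apply (h : C(I, E)) (s : I) : volterra E h s = h.primitive s := rfl

theorem norm_volterra_pointwise_pow_le (A : C(I, E →L[ℝ] E)) (n : ℕ) (h : C(I, E)) (s : I) :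
    ‖((volterra E ∘L pointwiseApply I E E A) ^ n) h s‖ ≤
      ‖A‖ ^ n * (s : ℝ) ^ n / n.factorial * ‖h‖ := by
  induction n generalizing s with
  | zero => simpa using h.norm_coe_le_norm s
  | succ n ih =>
    rw [pow_succ']
    set g := ((volterra E ∘L pointwiseApply I E E A) ^ n) h
    change ‖(pointwiseApply I E E A g).primitive s‖ ≤ _
    have hs := s.2.1
    have h1 : ‖(pointwiseApply I E E A g).primitive s‖ ≤
        ∫ r in (0 : ℝ)..s, ‖A‖ ^ (n + 1) * r ^ n / n.factorial * ‖h‖ := by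
      refine intervalIntegral.norm_integral_le_of_norm_le hs
        (MeasureTheory.ae_of_all _ fun r hr => ?_) (Continuous.intervalIntegrable (by fun_prop) _ _)
      have hr1 : r ∈ Set.Icc (0 : ℝ) 1 := ⟨hr.1.le, hr.2.trans s.2.2⟩
      rw [Set.projIcc_of_mem _ hr1, pointwiseApply_apply]
      refine ((A _).le_opNorm _).trans ?_
      calc _ ≤ ‖A‖ * (‖A‖ ^ n * r ^ n / n.factorial * ‖h‖) :=
            mul_le_mul (A.norm_coe_le_norm _) (ih _) (norm_nonneg _) (norm_nonneg A)
        _ = _ := by ring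
    refine h1.trans (le_of_eq ?_)
    rw [intervalIntegral.integral_mul_const, intervalIntegral.integral_div,
      intervalIntegral.integral_const_mul, integral_pow, Nat.factorial_succ]
    push_cast
    field_simp
    simp

/-- Iterated integration gives `‖T ^ n‖ ≤ ‖A‖ ^ n / n!`, so some `1 - T ^ n` is invertible, and `1 -
T` is a commuting factor of it. No smallness of `A` is needed, so arcs of any duration are covered.
-/
theorem isInvertible_id_sub_volterra [CompleteSpace E] (A : C(I, E →L[ℝ] E)) :
    (ContinuousLinearMap.id ℝ C(I, E) - volterra E ∘L pointwiseApply I E E A).IsInvertible := by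
  set T := volterra E ∘L pointwiseApply I E E A
  have h1 : ∀ n, ‖T ^ n‖ ≤ ‖A‖ ^ n / n.factorial := fun n => by
    refine ContinuousLinearMap.opNorm_le_bound _ (by positivity) fun h => ?_
    rw [ContinuousMap.norm_le _ (by positivity)]
    intro s
    refine (norm_volterra_pointwise_pow_le A n h s).trans ?_
    gcongr
    exact mul_le_of_le_one_right (by positivity) (pow_le_one₀ s.2.1 s.2.2)
  obtain ⟨n, hn⟩ := ((FloorSemiring.tendsto_pow_div_factorial_atTop ‖A‖).eventually
    (Iio_mem_nhds one_pos)).exists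
  have h2 : IsUnit (1 - T ^ n) := (Units.oneSub (T ^ n) ((h1 n).trans_lt hn)).isUnit
  have h3 : IsUnit (1 - T) := by
    rw [← mul_neg_geom_sum] at h2
    refine ((Commute.isUnit_mul_iff ?_).1 h2).1
    exact (Commute.one_left _).sub_left (Commute.sum_right _ _ _ fun i _ => Commute.pow_right rfl i)
  obtain ⟨e, he⟩ := h3
  exact ⟨ContinuousLinearEquiv.unitsEquiv ℝ _ e, by rw [← ContinuousLinearMap.one_def, ← he]; rfl⟩

end ContinuousMap

/-! ### Smooth dependence of orbit arcs on duration and initial point -/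

section Flow

open unitInterval ContinuousMap

universe u
variable {E : Type u} [NormedAddCommGroup E] [NormedSpace ℝ E]

/-- `φ` is a complete flow of the vector field `X` on the open set `V`. -/
structure IsFlowOn (φ : ℝ → E → E) (X : E → E) (V : Set E) : Prop where
  isOpen : IsOpen V
  mem : ∀ x ∈ V, ∀ t, φ t x ∈ V
  zero : ∀ x ∈ V, φ 0 x = x
  hasDerivAt : ∀ x ∈ V, ∀ t, HasDerivAt (fun t => φ t x) (X (φ t x)) t

/-- The orbit arc of `φ` from `z.2` during the time `z.1`, parametrized by the unit interval. -/
noncomputable def orbitPath (φ : ℝ → E → E) (z : ℝ × E) : C(I, E) :=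
  ContinuousMap.mkD (fun s : I => φ (s * z.1) z.2) 0

namespace IsFlowOn

variable {φ : ℝ → E → E} {X : E → E} {V : Set E}

theorem continuous_orbit (hφ : IsFlowOn φ X V) {x : E} (hx : x ∈ V) : Continuous fun t => φ t x :=
  continuous_iff_continuousAt.2 fun t => (hφ.hasDerivAt x hx t).continuousAt

theorem orbitPath_apply (hφ : IsFlowOn φ X V) {z : ℝ × E} (hz : z.2 ∈ V) (s : I) :
    orbitPath φ z s = φ (s * z.1) z.2 := by
  have : Continuous fun s : I => φ (s * z.1) z.2 := (hφ.continuous_orbit hz).comp (by fun_prop)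
  simp [orbitPath, ContinuousMap.mkD_of_continuous this]

theorem orbitPath_mem (hφ : IsFlowOn φ X V) {z : ℝ × E} (hz : z.2 ∈ V) (s : I) :
    orbitPath φ z s ∈ V := by
  rw [hφ.orbitPath_apply hz]
  exact hφ.mem _ hz _

theorem hasDerivAt_mul (hφ : IsFlowOn φ X V) {x : E} (hx : x ∈ V) (τ s : ℝ) :
    HasDerivAt (fun s => φ (s * τ) x) (τ • X (φ (s * τ) x)) s :=
  HasDerivAt.scomp (g₁ := fun t => φ t x) (h := fun s => s * τ) s (hφ.hasDerivAt x hx (s * τ)) (by simpa using (hasDerivAt_id s).mul_const τ)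

theorem flow_add (hφ : IsFlowOn φ X V) (hX : ∀ x ∈ V, ContDiffAt ℝ 1 X x) {x : E} (hx : x ∈ V)
    (s t : ℝ) : φ (s + t) x = φ s (φ t x) := by
  have h1 : ∀ s, HasDerivAt (fun s => φ (s + t) x) (X (φ (s + t) x)) s := fun s =>
    (hφ.hasDerivAt x hx (s + t)).comp_add_const s t
  refine congrFun (eq_of_integralCurves h1 (hφ.hasDerivAt _ (hφ.mem x hx t))
    (fun s => hX _ (hφ.mem _ hx _)) (fun s => hX _ (hφ.mem _ (hφ.mem _ hx _) _)) (t₀ := 0) ?_) s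
  simp [hφ.zero _ (hφ.mem _ hx _)]

theorem superposition_orbitPath_apply (hφ : IsFlowOn φ X V) (hX : ∀ x ∈ V, ContDiffAt ℝ 1 X x)
    {z : ℝ × E} (hz : z.2 ∈ V) (s : I) :
    superposition I X (orbitPath φ z) s = X (φ (s * z.1) z.2) := by
  rw [superposition_apply fun t => (hX _ (hφ.orbitPath_mem hz t)).continuousAt,
    hφ.orbitPath_apply hz]

/-- After rescaling, the duration is a mere parameter of the integral equation, and all arcs live in
the one Banach space `C(I, E)`. -/
theorem orbitPath_eq [CompleteSpace E] (hφ : IsFlowOn φ X V) (hX : ∀ x ∈ V, ContDiffAt ℝ 1 X x)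
    {z : ℝ × E} (hz : z.2 ∈ V) :
    orbitPath φ z = ContinuousMap.const I z.2 +
      z.1 • volterra E (superposition I X (orbitPath φ z)) := by
  ext s
  rw [hφ.orbitPath_apply hz]
  simp only [ContinuousMap.add_apply, ContinuousMap.const_apply, ContinuousMap.smul_apply,
    volterra_apply, primitive]
  have hXc : Continuous fun r : ℝ => X (φ (r * z.1) z.2) :=
    continuous_iff_continuousAt.2 fun r => ContinuousAt.comp (hX _ (hφ.mem _ hz _)).continuousAt
      ((hφ.continuous_orbit hz).comp (by fun_prop)).continuousAt
  have h1 : ∫ r in (0 : ℝ)..s, superposition I X (orbitPath φ z) (Set.projIcc 0 1 zero_le_one r) =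
      ∫ r in (0 : ℝ)..s, X (φ (r * z.1) z.2) := by
    refine intervalIntegral.integral_congr fun r hr => ?_
    rw [Set.uIcc_of_le s.2.1] at hr
    have hr1 : r ∈ Set.Icc (0 : ℝ) 1 := ⟨hr.1, hr.2.trans s.2.2⟩
    simp only [Set.projIcc_of_mem _ hr1]
    rw [hφ.superposition_orbitPath_apply hX hz]
  rw [h1, ← intervalIntegral.integral_smul, intervalIntegral.integral_eq_sub_of_hasDerivAt
    (fun r _ => hφ.hasDerivAt_mul hz z.1 r) ((hXc.const_smul _).intervalIntegrable _ _)]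
  simp [hφ.zero _ hz]

theorem eq_orbitPath [CompleteSpace E] (hφ : IsFlowOn φ X V) (hX : ∀ x ∈ V, ContDiffAt ℝ 1 X x)
    {z : ℝ × E} (hz : z.2 ∈ V) {v : C(I, E)} (hv : ∀ s, v s ∈ V)
    (h : v = ContinuousMap.const I z.2 + z.1 • volterra E (superposition I X v)) :
    v = orbitPath φ z := by
  let α : ℝ → E := fun s => z.2 + z.1 • (superposition I X v).primitive s
  have hα : ∀ s : I, α s = v s := fun s => by
    conv_rhs => rw [h]
    rfl
  have hα' : ∀ s ∈ Set.Ico (0 : ℝ) 1, HasDerivAt α (z.1 • X (α s)) s := by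
    intro s hs
    have h1 := (((superposition I X v).hasDerivAt_primitive s).const_smul z.1).const_add z.2
    rwa [Set.projIcc_of_mem _ (Set.Ico_subset_Icc_self hs),
      superposition_apply (fun t => (hX _ (hv t)).continuousAt), ← hα] at h1
  have key := eqOn_Icc_of_integralCurves (X := fun x => z.1 • X x) (f := α)
    (g := fun s => φ (s * z.1) z.2) (b := 1)
    (((superposition I X v).continuous_primitive.const_smul z.1).const_add z.2).continuousOn
    ((hφ.continuous_orbit hz).comp (by fun_prop)).continuousOn hα'
    (fun s _ => hφ.hasDerivAt_mul hz z.1 s)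
    (fun s hs => by rw [hα ⟨s, hs⟩]; exact (hX _ (hv _)).const_smul _)
    (fun s _ => (hX _ (hφ.mem _ hz _)).const_smul _) (by simp [α, hφ.zero _ hz])
  ext s
  rw [hφ.orbitPath_apply hz, ← hα]
  exact key s.2

/-- The arc of an orbit depends on time and on the initial point as smoothly as the field. -/
theorem contDiffAt_orbitPath [CompleteSpace E] (hφ : IsFlowOn φ X V) {n : WithTop ℕ∞}
    (hX : ∀ x ∈ V, ContDiffAt ℝ n X x) (hn : 1 ≤ n) {z : ℝ × E} (hz : z.2 ∈ V) :
    ContDiffAt ℝ n (orbitPath φ) z := by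
  have hX1 : ∀ x ∈ V, ContDiffAt ℝ 1 X x := fun x hx => (hX x hx).of_le hn
  have hn0 : n ≠ 0 := by rintro rfl; simp at hn
  obtain ⟨v, hv⟩ : ∃ v, v = orbitPath φ z := ⟨_, rfl⟩
  have hvV : ∀ s, v s ∈ V := hv ▸ hφ.orbitPath_mem hz
  -- The orbit arc is the zero of `f` over the parameter `z`. Its partial derivative in the curve is
  -- the identity minus a Volterra operator.
  let f : (ℝ × E) × C(I, E) → C(I, E) := fun q =>
    q.2 - ContinuousLinearMap.const ℝ I q.1.2 - q.1.1 • volterra E (superposition I X q.2)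
  have hf : ContDiffAt ℝ n f (z, v) := by
    refine (contDiffAt_snd.sub ?_).sub (ContDiffAt.fun_smul ?_ ?_)
    · exact (ContinuousLinearMap.contDiff _).contDiffAt.comp _ (contDiffAt_snd.comp _ contDiffAt_fst)
    · exact contDiffAt_fst.comp _ contDiffAt_fst
    · exact (volterra E).contDiff.contDiffAt.comp (z, v) ((contDiffAt_superposition
        fun t => hX _ (hvV t)).comp (z, v) contDiffAt_snd)
  have hinv : (fderiv ℝ f (z, v) ∘L .inr ℝ (ℝ × E) C(I, E)).IsInvertible := by
    have h1 : HasFDerivAt (fun w => f (z, w)) (fderiv ℝ f (z, v) ∘L .inr ℝ (ℝ × E) C(I, E)) v :=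
      (hf.differentiableAt hn0).hasFDerivAt.comp v (hasFDerivAt_prodMk_right z v)
    have h2 : HasFDerivAt (fun w => f (z, w)) (ContinuousLinearMap.id ℝ C(I, E) -
        z.1 • (volterra E ∘L pointwiseApply I E E (superposition I (fderiv ℝ X) v))) v :=
      ((hasFDerivAt_id v).sub_const (ContinuousLinearMap.const ℝ I z.2)).sub (((volterra E).hasFDerivAt.comp v
        (hasFDerivAt_superposition fun t => hX1 _ (hvV t))).const_smul z.1)
    rw [h1.unique h2]
    have h4 := isInvertible_id_sub_volterra (z.1 • superposition I (fderiv ℝ X) v)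
    rw [map_smul, ContinuousLinearMap.comp_smul] at h4
    exact h4
  have hψ := hf.contDiffAt_implicitFunction hn0 hinv
  refine hψ.congr_of_eventuallyEq ?_
  have h0 : f (z, v) = 0 := by
    have := hφ.orbitPath_eq hX1 hz
    rw [← hv] at this
    simp only [f]
    rw [sub_sub, sub_eq_zero]
    exact this
  have hψz := hf.implicitFunction_apply_self hn0 hinv
  -- Once the implicit function takes values in `V`, uniqueness for the integral equation identifies
  -- it with `orbitPath φ`; no continuity of `φ` in the initial point is presupposed.
  have h3 : ∀ᶠ y in 𝓝 z, ∀ s, hf.implicitFunction hn0 hinv y s ∈ V :=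
    hψ.continuousAt.eventually (by
      rw [hψz]
      exact eventually_forall_apply v fun t => hφ.isOpen.mem_nhds (hvV t))
  filter_upwards [hf.eventually_apply_implicitFunction hn0 hinv, h3,
    continuousAt_snd.eventually (hφ.isOpen.mem_nhds hz)] with y hy hyV hyz
  refine (hφ.eq_orbitPath hX1 hyz hyV ?_).symm
  rw [h0] at hy
  simp only [f] at hy
  rw [sub_sub, sub_eq_zero] at hy
  exact hy

theorem contDiffAt_flow [CompleteSpace E] (hφ : IsFlowOn φ X V) {n : WithTop ℕ∞}
    (hX : ∀ x ∈ V, ContDiffAt ℝ n X x) (hn : 1 ≤ n) {z : ℝ × E} (hz : z.2 ∈ V) :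
    ContDiffAt ℝ n (fun z : ℝ × E => φ z.1 z.2) z := by
  refine ((ContinuousMap.evalCLM ℝ (1 : I)).contDiff.contDiffAt.comp z
    (hφ.contDiffAt_orbitPath hX hn hz)).congr_of_eventuallyEq ?_
  filter_upwards [continuousAt_snd.eventually (hφ.isOpen.mem_nhds hz)] with y hy
  have := hφ.orbitPath_apply hy 1
  simp only [Set.Icc.coe_one, one_mul] at this
  exact this.symm

/-- The variational equation along the orbit arcs. -/
theorem fderiv_orbitPath_eq [CompleteSpace E] (hφ : IsFlowOn φ X V)
    (hX : ∀ x ∈ V, ContDiffAt ℝ 1 X x) {z : ℝ × E} (hz : z.2 ∈ V) (v : E) :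
    fderiv ℝ (orbitPath φ) z (0, v) = ContinuousMap.const I v + z.1 • volterra E
      (pointwiseApply I E E (superposition I (fderiv ℝ X) (orbitPath φ z))
        (fderiv ℝ (orbitPath φ) z (0, v))) := by
  have h1 := ((hφ.contDiffAt_orbitPath hX le_rfl hz).differentiableAt one_ne_zero).hasFDerivAt
  have h2 := (volterra E).hasFDerivAt.comp z
    ((hasFDerivAt_superposition fun t => hX _ (hφ.orbitPath_mem hz t)).comp z h1)
  have h3 := ((ContinuousLinearMap.const ℝ I).hasFDerivAt.comp z
    (hasFDerivAt_snd (𝕜 := ℝ) (p := z))).add ((hasFDerivAt_fst (𝕜 := ℝ) (p := z)).smul h2)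
  have h4 : orbitPath φ =ᶠ[𝓝 z] fun y => ContinuousLinearMap.const ℝ I y.2 +
      y.1 • volterra E (superposition I X (orbitPath φ y)) := by
    filter_upwards [continuousAt_snd.eventually (hφ.isOpen.mem_nhds hz)] with y hy
    exact hφ.orbitPath_eq hX hy
  have h5 := congrArg (fun L => L (0, v)) (h1.unique (h3.congr_of_eventuallyEq h4))
  simp at h5
  exact h5

end IsFlowOn

end Flow

/-! ### Flows with periodic orbits around a fixed point -/

/-- `φ` is a complete flow of the `C^1` vector field `X` on `V` which fixes `p` and all of whose
other orbits are periodic, with minimal period `T`. -/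
structure IsPeriodicFlow {E : Type*} [NormedAddCommGroup E] [NormedSpace ℝ E] (φ : ℝ → E → E)
    (X : E → E) (V : Set E) (p : E) (T : E → ℝ) : Prop where
  flow : IsFlowOn φ X V
  contDiffAt : ∀ x ∈ V, ContDiffAt ℝ 1 X x
  mem_center : p ∈ V
  fixed : ∀ t, φ t p = p
  ne_center : ∀ x ∈ V, x ≠ p → ∀ t, φ t x ≠ p
  isLeast : ∀ x ∈ V, x ≠ p → IsLeast {τ : ℝ | 0 < τ ∧ φ τ x = x} (T x)

namespace IsPeriodicFlow

universe u
variable {E : Type u} [NormedAddCommGroup E] [NormedSpace ℝ E] {φ : ℝ → E → E} {X : E → E}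
  {V : Set E} {p : E} {T : E → ℝ}

theorem add (h : IsPeriodicFlow φ X V p T) {x : E} (hx : x ∈ V) (s t : ℝ) :
    φ (s + t) x = φ s (φ t x) := h.flow.flow_add h.contDiffAt hx s t

theorem period_pos (h : IsPeriodicFlow φ X V p T) {x : E} (hx : x ∈ V) (hxp : x ≠ p) : 0 < T x :=
  (h.isLeast x hx hxp).1.1

theorem flow_period (h : IsPeriodicFlow φ X V p T) {x : E} (hx : x ∈ V) (hxp : x ≠ p) :
    φ (T x) x = x := (h.isLeast x hx hxp).1.2

theorem period_le (h : IsPeriodicFlow φ X V p T) {x : E} (hx : x ∈ V) (hxp : x ≠ p) {τ : ℝ}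
    (hτ : 0 < τ) (hτx : φ τ x = x) : T x ≤ τ := (h.isLeast x hx hxp).2 ⟨hτ, hτx⟩

theorem neg_flow (h : IsPeriodicFlow φ X V p T) {x : E} (hx : x ∈ V) (t : ℝ) :
    φ (-t) (φ t x) = x := by
  rw [← h.add hx, neg_add_cancel, h.flow.zero x hx]

theorem flow_nat_mul (h : IsPeriodicFlow φ X V p T) {x : E} (hx : x ∈ V) {τ : ℝ}
    (hτx : φ τ x = x) (n : ℕ) : φ (n * τ) x = x := by
  induction n with
  | zero => simp [h.flow.zero x hx]
  | succ n ih =>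
    rw [Nat.cast_succ, add_mul, one_mul, h.add hx, hτx, ih]

theorem flow_eq_iff (h : IsPeriodicFlow φ X V p T) {x : E} (hx : x ∈ V) (t τ : ℝ) :
    φ τ (φ t x) = φ t x ↔ φ τ x = x := by
  rw [← h.add hx, add_comm, h.add hx]
  refine ⟨fun hh => ?_, fun hh => by rw [hh]⟩
  have := congrArg (φ (-t)) hh
  rwa [h.neg_flow (h.flow.mem x hx τ), h.neg_flow hx] at this

theorem period_flow (h : IsPeriodicFlow φ X V p T) {x : E} (hx : x ∈ V) (hxp : x ≠ p) (t : ℝ) :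
    T (φ t x) = T x := by
  have h1 := h.isLeast _ (h.flow.mem x hx t) (h.ne_center x hx hxp t)
  simp only [h.flow_eq_iff hx t] at h1
  exact h1.unique (h.isLeast x hx hxp)

theorem field_ne_zero (h : IsPeriodicFlow φ X V p T) {x : E} (hx : x ∈ V) (hxp : x ≠ p) :
    X x ≠ 0 := by
  intro h0
  have h1 : (fun t => φ t x) = fun _ => x :=
    eq_of_integralCurves (X := X) (h.flow.hasDerivAt x hx)
      (fun t => by simpa [h0] using hasDerivAt_const t x)
      (fun t => h.contDiffAt _ (h.flow.mem x hx t)) (fun _ => h.contDiffAt x hx) (t₀ := 0)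
      (h.flow.zero x hx)
  have h2 := h.period_le hx hxp (half_pos (h.period_pos hx hxp)) (congrFun h1 _)
  linarith [h.period_pos hx hxp]

theorem field_center (h : IsPeriodicFlow φ X V p T) : X p = 0 := by
  have h1 := h.flow.hasDerivAt p h.mem_center 0
  simp only [h.fixed] at h1
  exact h1.unique (hasDerivAt_const 0 p)

theorem range_eq_image (h : IsPeriodicFlow φ X V p T) {x : E} (hx : x ∈ V) (hxp : x ≠ p) :
    Set.range (fun t => φ t x) = (fun t => φ t x) '' Set.Icc 0 (T x) := by
  have hper : Function.Periodic (fun t => φ t x) (T x) := fun t => by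
    change φ (t + T x) x = φ t x
    rw [h.add hx, h.flow_period hx hxp]
  simpa using (hper.image_Icc (h.period_pos hx hxp) 0).symm

theorem isCompact_range (h : IsPeriodicFlow φ X V p T) {x : E} (hx : x ∈ V) (hxp : x ≠ p) :
    IsCompact (Set.range fun t => φ t x) := by
  rw [h.range_eq_image hx hxp]
  exact isCompact_Icc.image (h.flow.continuous_orbit hx)

theorem continuousAt [CompleteSpace E] (h : IsPeriodicFlow φ X V p T) {z : ℝ × E} (hz : z.2 ∈ V) :
    ContinuousAt (fun z : ℝ × E => φ z.1 z.2) z :=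
  (h.flow.contDiffAt_flow h.contDiffAt le_rfl hz).continuousAt

/-- A period which is too short has a multiple in a given window. -/
theorem exists_flow_eq_of_period_lt (h : IsPeriodicFlow φ X V p T) {x : E} (hx : x ∈ V) {τ a : ℝ}
    (hτ : 0 < τ) (hτx : φ τ x = x) (hτa : τ < a) : ∃ t ∈ Set.Icc a (2 * a), φ t x = x := by
  refine ⟨⌈a / τ⌉₊ * τ, ⟨?_, ?_⟩, h.flow_nat_mul hx hτx _⟩
  · exact (div_le_iff₀ hτ).1 (Nat.le_ceil _)
  · have := Nat.ceil_lt_add_one (div_pos (hτ.trans hτa) hτ).le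
    have h2 : (⌈a / τ⌉₊ : ℝ) * τ < (a / τ + 1) * τ := by gcongr
    rw [add_mul, div_mul_cancel₀ _ hτ.ne'] at h2
    linarith

end IsPeriodicFlow

namespace PlanarCenter

/-- The orbits are chosen point by point, without regularity in the starting point. Uniqueness of
integral curves supplies the group law, and also makes the set in `periodFunction` a singleton. -/
theorem exists_isPeriodicFlow {U : Set Plane} {X : Plane → Plane} {p : Plane} (ω₀ : ℝ)
    (hU : IsOpen U) (hX : ContDiffOn ℝ 1 X U) (h : IsCenter U X p) :
    ∃ φ, IsPeriodicFlow φ X (periodAnnulus U X p) p (periodFunction U X p ω₀) := by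
  classical
  obtain ⟨⟨hVo, -, hpV, hVU, hV⟩, -⟩ := isGreatest_periodAnnulus h
  set V := periodAnnulus U X p
  have hXU : ∀ x ∈ U, ContDiffAt ℝ 1 X x := fun x hx => hX.contDiffAt (hU.mem_nhds hx)
  choose! γ T hγ0 hγT hγV using hV
  have hflow : IsFlowOn (fun t q => if q = p then p else γ q t) X V := by
    refine ⟨hVo, fun x hx t => ?_, fun x hx => ?_, fun x hx t => ?_⟩
    · by_cases hxp : x = p
      · simp [hxp, hpV]
      · simpa [hxp] using (hγV x ⟨hx, hxp⟩ t).1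
    · by_cases hxp : x = p
      · simp [hxp]
      · simpa [hxp] using hγ0 x ⟨hx, hxp⟩
    · by_cases hxp : x = p
      · simpa [hxp, h.1] using hasDerivAt_const t p
      · simpa [hxp] using (hγT x ⟨hx, hxp⟩).2.1 t
  have hXV : ∀ x ∈ V, ContDiffAt ℝ 1 X x := fun x hx => hXU x (hVU hx)
  refine ⟨_, hflow, hXV, hpV, by simp, fun x hx hxp t => ?_, fun x hx hxp => ?_⟩
  · simpa [hxp] using (hγV x ⟨hx, hxp⟩ t).2
  · have key : ∀ τ, γ x τ = x ↔ Function.Periodic (γ x) τ := by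
      intro τ
      refine ⟨fun hτ s => ?_, fun hτ => by simpa [hγ0 x ⟨hx, hxp⟩] using hτ 0⟩
      have := hflow.flow_add hXV hx s τ
      simpa [hxp, hτ] using this
    have huniq : ∀ γ', γ' 0 = x → ∀ T', IsPeriodicOrbit U X γ' T' → γ' = γ x := fun γ' h0 T' h' =>
      eq_of_integralCurves (X := X) h'.2.1 (hγT x ⟨hx, hxp⟩).2.1 (fun t => hXU _ (h'.1 t))
        (fun t => hXU _ ((hγT x ⟨hx, hxp⟩).1 t)) (t₀ := 0) (by rw [h0, hγ0 x ⟨hx, hxp⟩])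
    have hset : {T' : ℝ | ∃ γ', γ' 0 = x ∧ IsPeriodicOrbit U X γ' T'} = {T x} := by
      ext T'
      simp only [Set.mem_ofPred_eq, Set.mem_singleton_iff]
      constructor
      · rintro ⟨γ', h0, h'⟩
        have := huniq γ' h0 T' h'
        subst this
        exact h'.2.2.unique (hγT x ⟨hx, hxp⟩).2.2
      · rintro rfl
        exact ⟨γ x, hγ0 x ⟨hx, hxp⟩, hγT x ⟨hx, hxp⟩⟩
    simp only [hxp, if_false, key, periodFunction, hset, csInf_singleton]
    exact (hγT x ⟨hx, hxp⟩).2.2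

end PlanarCenter

/-! ### Return maps, lower semicontinuity of the period, implicit equations -/

/-- A strictly increasing function with a sign change has a zero which depends continuously on the
parameters. -/
theorem exists_continuousOn_zero_of_strictMonoOn {Y : Type*} [TopologicalSpace Y] {S : Set Y}
    {f : ℝ → Y → ℝ} {a b : ℝ} (hab : a ≤ b)
    (hmono : ∀ y ∈ S, StrictMonoOn (fun t => f t y) (Set.Icc a b))
    (hcont : ∀ y ∈ S, ContinuousOn (fun t => f t y) (Set.Icc a b))
    (hS : ∀ t ∈ Set.Icc a b, ContinuousOn (f t) S)
    (ha : ∀ y ∈ S, f a y < 0) (hb : ∀ y ∈ S, 0 < f b y) :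
    ∃ σ : Y → ℝ, ContinuousOn σ S ∧ ∀ y ∈ S, σ y ∈ Set.Ioo a b ∧ f (σ y) y = 0 := by
  have h0 : ∀ y ∈ S, ∃ t ∈ Set.Ioo a b, f t y = 0 := fun y hy =>
    intermediate_value_Ioo hab (hcont y hy) ⟨ha y hy, hb y hy⟩
  choose! σ hσ hσ0 using h0
  refine ⟨σ, fun y hy => ?_, fun y hy => ⟨hσ y hy, hσ0 y hy⟩⟩
  refine (nhds_basis_Ioo (σ y)).tendsto_right_iff.2 fun ⟨l, u⟩ hlu => ?_
  obtain ⟨l', hl', hll'⟩ : ∃ l', l' ∈ Set.Ioo (max l a) (σ y) ∧ l' ∈ Set.Icc a b := by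
    obtain ⟨l', h1, h2⟩ := exists_between (max_lt hlu.1 (hσ y hy).1)
    exact ⟨l', ⟨h1, h2⟩, ((le_max_right _ _).trans_lt h1).le, (h2.trans (hσ y hy).2).le⟩
  obtain ⟨u', hu', huu'⟩ : ∃ u', u' ∈ Set.Ioo (σ y) (min u b) ∧ u' ∈ Set.Icc a b := by
    obtain ⟨u', h1, h2⟩ := exists_between (lt_min hlu.2 (hσ y hy).2)
    exact ⟨u', ⟨h1, h2⟩, ((hσ y hy).1.trans h1).le, (h2.trans_le (min_le_right _ _)).le⟩
  have hσy := Set.Ioo_subset_Icc_self (hσ y hy)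
  have h1 : f l' y < 0 := hσ0 y hy ▸ hmono y hy hll' hσy hl'.2
  have h2 : 0 < f u' y := hσ0 y hy ▸ hmono y hy hσy huu' hu'.1
  filter_upwards [(hS l' hll' y hy).eventually (Iio_mem_nhds h1),
    (hS u' huu' y hy).eventually (Ioi_mem_nhds h2), self_mem_nhdsWithin] with z hz1 hz2 hzS
  have hz := Set.Ioo_subset_Icc_self (hσ z hzS)
  constructor
  · refine ((le_max_left _ _).trans_lt hl'.1).trans (((hmono z hzS).lt_iff_lt hll' hz).1 ?_)
    simpa only [hσ0 z hzS] using hz1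
  · refine (((hmono z hzS).lt_iff_lt hz huu').1 ?_).trans (hu'.2.trans_le (min_le_left _ _))
    simpa only [hσ0 z hzS] using hz2

namespace IsPeriodicFlow

universe u
variable {E : Type u} [NormedAddCommGroup E] [NormedSpace ℝ E] {φ : ℝ → E → E} {X : E → E}
  {V : Set E} {p : E} {T : E → ℝ}

/-- On a half-open section `c` with a well defined positive return map, every orbit has a point
which is fixed by the return map, unless it passes through the end of the section. -/
theorem exists_fixed_return [CompleteSpace E] (h : IsPeriodicFlow φ X V p T) {c : ℝ → E}
    {u v : E → ℝ} {a b δ M : ℝ} (hab : a ≤ b) (hc : Continuous c)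
    (hcV : ∀ s ∈ Set.Ioc 0 δ, c s ∈ V) (hcp : ∀ s ∈ Set.Ioc 0 δ, c s ≠ p)
    (hu : Continuous u) (hv : Continuous v) (hvc : ∀ r, v (c r) = r)
    (hmono : ∀ s ∈ Set.Ioc 0 δ, StrictMonoOn (fun t => u (φ t (c s))) (Set.Icc a b))
    (ha : ∀ s ∈ Set.Ioc 0 δ, u (φ a (c s)) < 0) (hb : ∀ s ∈ Set.Ioc 0 δ, 0 < u (φ b (c s)))
    (hret : ∀ s ∈ Set.Ioc 0 δ, ∀ t ∈ Set.Icc a b, u (φ t (c s)) = 0 →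
      ∃ r, 0 < r ∧ r ≤ M * s ∧ φ t (c s) = c r) {s₀ : ℝ} (hs₀ : s₀ ∈ Set.Ioc 0 δ) :
    c 0 ∈ Set.range (fun t => φ t (c s₀)) ∨ ∃ s ∈ Set.Ioc 0 s₀, ∃ t ∈ Set.Icc a b,
      φ t (c s) = c s ∧ c s ∈ Set.range (fun t => φ t (c s₀)) := by
  set O := Set.range (fun t => φ t (c s₀)) with hO
  have hOc : IsClosed O := (h.isCompact_range (hcV s₀ hs₀) (hcp s₀ hs₀)).isClosed
  have hOflow : ∀ x ∈ V, ∀ t, φ t x ∈ O ↔ x ∈ O := by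
    have h1 : ∀ x ∈ O, ∀ t, φ t x ∈ O := by
      rintro _ ⟨s, rfl⟩ t
      exact ⟨t + s, h.add (hcV s₀ hs₀) t s⟩
    exact fun x hx t => ⟨fun hxt => by simpa only [h.neg_flow hx] using h1 _ hxt (-t),
      fun hx => h1 x hx t⟩
  -- The orbit is compact, so it has a first parameter `m` on the section; `m = 0` means that it
  -- passes through the end point.
  obtain ⟨m, hm⟩ : ∃ m, IsLeast (Set.Icc 0 s₀ ∩ c ⁻¹' O) m :=
    (isCompact_Icc.inter_right (hOc.preimage hc)).exists_isLeast
      ⟨s₀, ⟨hs₀.1.le, le_rfl⟩, 0, h.flow.zero _ (hcV s₀ hs₀)⟩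
  rcases hm.1.1.1.eq_or_lt with hm0 | hm0
  · exact Or.inl (hm0 ▸ hm.1.2)
  have hsub : Set.Ioc 0 m ⊆ Set.Ioc 0 δ := Set.Ioc_subset_Ioc_right (hm.1.1.2.trans hs₀.2)
  have hm1 := hsub ⟨hm0, le_rfl⟩
  have hφc : ∀ t, ContinuousOn (fun s => φ t (c s)) (Set.Ioc 0 δ) := fun t s hs =>
    ((h.continuousAt (z := (t, c s)) (hcV s hs)).comp (f := fun s => (t, c s))
      (by fun_prop)).continuousWithinAt
  obtain ⟨σ, hσc, hσ⟩ := exists_continuousOn_zero_of_strictMonoOn (S := Set.Ioc 0 δ)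
    (f := fun t s => u (φ t (c s))) hab hmono
    (fun s hs => (hu.comp (h.flow.continuous_orbit (hcV s hs))).continuousOn)
    (fun t _ => hu.comp_continuousOn (hφc t)) ha hb
  set P : ℝ → ℝ := fun s => v (φ (σ s) (c s)) with hP
  have hPs : ∀ s ∈ Set.Ioc 0 δ, 0 < P s ∧ P s ≤ M * s ∧ φ (σ s) (c s) = c (P s) := fun s hs => by
    obtain ⟨r, hr0, hrM, hr⟩ := hret s hs (σ s) (Set.Ioo_subset_Icc_self (hσ s hs).1) (hσ s hs).2
    have : P s = r := by simp only [hP, hr, hvc]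
    exact this ▸ ⟨hr0, hrM, hr⟩
  have hPc : ContinuousOn P (Set.Ioc 0 δ) := fun s hs =>
    hv.continuousAt.comp_continuousWithinAt ((h.continuousAt (z := (σ s, c s)) (hcV s hs)).comp_continuousWithinAt
      (f := fun s => (σ s, c s)) ((hσc s hs).prodMk hc.continuousWithinAt))
  -- The point `c (P m)` lies on the same orbit and `P m > 0`, so minimality of `m` applies.
  have hPm : m ≤ P m := by
    by_contra! hlt
    refine hlt.not_ge (hm.2 ⟨⟨(hPs m hm1).1.le, hlt.le.trans hm.1.1.2⟩, ?_⟩)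
    change c (P m) ∈ O
    rw [← (hPs m hm1).2.2, hOflow _ (hcV m hm1)]
    exact hm.1.2
  -- The bound `P s ≤ M * s` produces a parameter in `(0, m]` whose return is at most `m`. Between
  -- it and `m` some `s` has `P s = m`; then `c s` is on the orbit, and minimality forces `s = m`, a
  -- fixed return. Neither monotonicity of `P` nor the Jordan curve theorem enters.
  have hM1 : 0 < max M 1 := lt_max_of_lt_right one_pos
  have hm' : m / max M 1 ∈ Set.Ioc 0 m := ⟨by positivity, div_le_self hm0.le (le_max_right _ _)⟩
  have hPm' : P (m / max M 1) ≤ m := by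
    refine (hPs _ (hsub hm')).2.1.trans ?_
    rw [mul_div_left_comm]
    exact mul_le_of_le_one_right hm0.le ((div_le_one hM1).2 (le_max_left _ _))
  obtain ⟨s, hs, hPsm⟩ := intermediate_value_Icc hm'.2
    (hPc.mono fun s hs => hsub ⟨hm'.1.trans_le hs.1, hs.2⟩) ⟨hPm', hPm⟩
  have hs1 : s ∈ Set.Ioc 0 δ := hsub ⟨hm'.1.trans_le hs.1, hs.2⟩
  have hsO : c s ∈ O := by
    rw [← hOflow _ (hcV s hs1) (σ s), (hPs s hs1).2.2, hPsm]
    exact hm.1.2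
  have hsm : s = m := le_antisymm hs.2 (hm.2 ⟨⟨hs1.1.le, hs.2.trans hm.1.1.2⟩, hsO⟩)
  refine Or.inr ⟨s, ⟨hs1.1, hs.2.trans hm.1.1.2⟩, σ s, Set.Ioo_subset_Icc_self (hσ s hs1).1, ?_, hsO⟩
  rw [(hPs s hs1).2.2, hPsm, hsm]

/-- Away from the center there are no periods much shorter than the minimal one nearby. -/
theorem eventually_lt_period [CompleteSpace E] (h : IsPeriodicFlow φ X V p T) {q : E} (hq : q ∈ V)
    (hqp : q ≠ p) {a : ℝ} (ha : a < T q) : ∀ᶠ x in 𝓝 q, a < T x := by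
  -- Then `[T q / 4, a]` contains `[T q / 4, T q / 2]`, where every period below `T q / 4` has a
  -- multiple. Excluding returns in one compact interval therefore excludes the short periods too.
  wlog ha2 : T q / 2 ≤ a generalizing a
  · have hT := h.period_pos hq hqp
    filter_upwards [this (a := T q / 2) (by linarith) le_rfl] with x hx
    linarith
  have hT := h.period_pos hq hqp
  have h1 : ∀ᶠ x in 𝓝 q, ∀ t ∈ Set.Icc (T q / 4) a, φ t x ≠ x := by
    refine isCompact_Icc.eventually_forall_of_forall_eventually fun t ht => ?_
    have h2 : ContinuousAt (fun z : E × ℝ => φ z.2 z.1) (q, t) :=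
      ContinuousAt.comp (g := fun z : ℝ × E => φ z.1 z.2) (f := fun z : E × ℝ => (z.2, z.1))
        (x := (q, t)) (h.continuousAt hq) (by fun_prop)
    have h3 : φ t q ≠ q := fun h4 => by
      have := h.period_le hq hqp (by linarith [ht.1]) h4
      linarith [ht.2]
    filter_upwards [(ContinuousAt.sub h2 continuousAt_fst).eventually_ne (sub_ne_zero.2 h3)] with z hz
      using sub_ne_zero.1 hz
  filter_upwards [h1, h.flow.isOpen.mem_nhds hq, isOpen_ne.mem_nhds hqp] with x hx hxV hxp
  by_contra! hle
  rcases lt_or_ge (T x) (T q / 4) with hlt | hge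
  · obtain ⟨t, ht, htx⟩ := h.exists_flow_eq_of_period_lt hxV (h.period_pos hxV hxp)
      (h.flow_period hxV hxp) hlt
    exact hx t ⟨ht.1, ht.2.trans (by linarith)⟩ htx
  · exact hx _ ⟨hge, hle⟩ (h.flow_period hxV hxp)

end IsPeriodicFlow

/-- A continuous solution of a nondegenerate implicit equation of class `C^n` is of class `C^n`. -/
theorem contDiffAt_of_implicit {E : Type*} [NormedAddCommGroup E] [NormedSpace ℝ E] [CompleteSpace E]
    {n : WithTop ℕ∞} (hn : n ≠ 0) {f : E × ℝ → ℝ} {T : E → ℝ} {q : E} {c : ℝ}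
    (hf : ContDiffAt ℝ n f (q, T q)) (hf' : HasDerivAt (fun t => f (q, t)) c (T q)) (hc : c ≠ 0)
    (hT : ContinuousAt T q) (h0 : ∀ᶠ x in 𝓝 q, f (x, T x) = f (q, T q)) : ContDiffAt ℝ n T q := by
  have hinv : (fderiv ℝ f (q, T q) ∘L .inr ℝ E ℝ).IsInvertible := by
    refine ⟨ContinuousLinearEquiv.unitsEquivAut ℝ (Units.mk0 c hc), ?_⟩
    have h1 : HasFDerivAt (fun t => f (q, t)) (fderiv ℝ f (q, T q) ∘L .inr ℝ E ℝ) (T q) :=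
      (hf.differentiableAt hn).hasFDerivAt.comp (T q) (hasFDerivAt_prodMk_right q (T q))
    rw [h1.unique hf'.hasFDerivAt]
    ext
    simp
  refine (hf.contDiffAt_implicitFunction hn hinv).congr_of_eventuallyEq ?_
  -- Continuity of `T` keeps `(x, T x)` in the neighborhood where the implicit function is the only
  -- solution.
  have h2 : Tendsto (fun x => (x, T x)) (𝓝 q) (𝓝 (q, T q)) :=
    (continuousAt_id.prodMk hT : ContinuousAt (fun x => (x, T x)) q)
  filter_upwards [h2.eventually (hf.eventually_apply_eq_iff_implicitFunction hn hinv), h0]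
    with x hx hx0
  exact (hx.1 hx0).symm

/-! ### Linear algebra of the plane and the derivative of the flow -/

namespace PlanarCenter

/-- The scalar product with `a` in the plane. -/
noncomputable def dotCLM (a : Plane) : Plane →L[ℝ] ℝ :=
  a 0 • EuclideanSpace.proj 0 + a 1 • EuclideanSpace.proj 1

/-- The oriented area spanned with `a` in the plane. -/
noncomputable def crossCLM (a : Plane) : Plane →L[ℝ] ℝ :=
  a 0 • EuclideanSpace.proj 1 - a 1 • EuclideanSpace.proj 0

/-- Rotation by a right angle. -/
def rot (a : Plane) : Plane := !₂[-a 1, a 0]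

theorem dotCLM_apply (a v : Plane) : dotCLM a v = a 0 * v 0 + a 1 * v 1 := rfl

theorem crossCLM_apply (a v : Plane) : crossCLM a v = a 0 * v 1 - a 1 * v 0 := rfl

@[simp] theorem rot_zero (a : Plane) : rot a 0 = -a 1 := rfl

@[simp] theorem rot_one (a : Plane) : rot a 1 = a 0 := rfl

theorem dotCLM_self_pos {a : Plane} (ha : a ≠ 0) : 0 < dotCLM a a := by
  rw [dotCLM_apply]
  by_contra! h
  refine ha ?_
  have h0 : a 0 = 0 := by nlinarith [mul_self_nonneg (a 0), mul_self_nonneg (a 1)]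
  have h1 : a 1 = 0 := by nlinarith [mul_self_nonneg (a 0), mul_self_nonneg (a 1)]
  ext i
  fin_cases i <;> simp [h0, h1]

theorem dotCLM_rot (a : Plane) : dotCLM a (rot a) = 0 := by
  simp [dotCLM_apply]; ring

theorem crossCLM_rot (a : Plane) : crossCLM a (rot a) = dotCLM a a := by
  simp [dotCLM_apply, crossCLM_apply]

theorem crossCLM_self (a : Plane) : crossCLM a a = 0 := by
  simp [crossCLM_apply]; ring

theorem eq_smul_rot_of_dotCLM_eq_zero {a v : Plane} (ha : a ≠ 0) (h : dotCLM a v = 0) :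
    v = (crossCLM a v / dotCLM a a) • rot a := by
  have hN := dotCLM_self_pos ha
  rw [dotCLM_apply] at h hN
  rw [dotCLM_apply, crossCLM_apply]
  ext i
  fin_cases i
  · change v 0 = (a 0 * v 1 - a 1 * v 0) / (a 0 * a 0 + a 1 * a 1) * (-a 1)
    rw [div_mul_eq_mul_div, eq_div_iff hN.ne']
    linear_combination a 0 * h
  · change v 1 = (a 0 * v 1 - a 1 * v 0) / (a 0 * a 0 + a 1 * a 1) * a 0
    rw [div_mul_eq_mul_div, eq_div_iff hN.ne']
    linear_combination a 1 * h

theorem eq_basis_sum (v : Plane) : v = v 0 • !₂[1, 0] + v 1 • !₂[0, 1] := by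
  ext i
  fin_cases i <;> simp

/-- The determinant of a linear endomorphism of the plane. -/
noncomputable def planeDet (B : Plane →L[ℝ] Plane) : ℝ := crossCLM (B !₂[1, 0]) (B !₂[0, 1])

theorem crossCLM_map (B : Plane →L[ℝ] Plane) (v w : Plane) :
    crossCLM (B v) (B w) = planeDet B * crossCLM v w := by
  rw [planeDet]
  conv_lhs => rw [eq_basis_sum v, eq_basis_sum w]
  simp only [map_add, map_smul, crossCLM_apply, PiLp.add_apply, PiLp.smul_apply, smul_eq_mul]
  ring

theorem continuous_planeDet : Continuous planeDet := by
  unfold planeDet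
  simp only [crossCLM_apply]
  fun_prop

theorem planeDet_id : planeDet (ContinuousLinearMap.id ℝ Plane) = 1 := by
  simp [planeDet, crossCLM_apply]

theorem planeDet_ne_zero {B C : Plane →L[ℝ] Plane} (h : C ∘L B = ContinuousLinearMap.id ℝ Plane) :
    planeDet B ≠ 0 := by
  intro h0
  have h1 : crossCLM (C (B !₂[1, 0])) (C (B !₂[0, 1])) = 0 := by
    rw [crossCLM_map C, crossCLM_map B, h0]; ring
  have h2 : ∀ v, C (B v) = v := fun v => congrArg (fun L => L v) h
  rw [h2, h2] at h1
  simp [crossCLM_apply] at h1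

end PlanarCenter

namespace IsPeriodicFlow

open PlanarCenter

variable {φ : ℝ → Plane → Plane} {X : Plane → Plane} {V : Set Plane} {p : Plane} {T : Plane → ℝ}

theorem hasFDerivAt_flow (h : IsPeriodicFlow φ X V p T) {q : Plane} (hq : q ∈ V) (t : ℝ) :
    HasFDerivAt (φ t) (fderiv ℝ (φ t) q) q := by
  have h1 := (h.flow.contDiffAt_flow h.contDiffAt le_rfl (z := (t, q)) hq).differentiableAt
    one_ne_zero
  have h2 := h1.hasFDerivAt.comp q (hasFDerivAt_prodMk_right t q)
  exact h2.differentiableAt.hasFDerivAt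

theorem hasFDerivAt_uncurry_flow (h : IsPeriodicFlow φ X V p T) {q : Plane} (hq : q ∈ V) (t : ℝ) :
    HasFDerivAt (fun z : ℝ × Plane => φ z.1 z.2) 
      ((ContinuousLinearMap.toSpanSingleton ℝ (X (φ t q))).coprod (fderiv ℝ (φ t) q)) (t, q) := by
  have h1 := ((h.flow.contDiffAt_flow h.contDiffAt le_rfl (z := (t, q)) hq).differentiableAt
    one_ne_zero).hasFDerivAt
  suffices key : (ContinuousLinearMap.toSpanSingleton ℝ (X (φ t q))).coprod (fderiv ℝ (φ t) q) =
      fderiv ℝ (fun z : ℝ × Plane => φ z.1 z.2) (t, q) from key ▸ h1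
  refine ContinuousLinearMap.ext fun z => ?_
  have h2 := HasFDerivAt.comp (f := fun s : ℝ => (s, q)) t h1 (hasFDerivAt_prodMk_left (𝕜 := ℝ) t q)
  have h3 := DFunLike.congr_fun (h2.unique (h.flow.hasDerivAt q hq t).hasFDerivAt) z.1
  have h4 := DFunLike.congr_fun ((h.hasFDerivAt_flow hq t).unique
    (h1.comp q (hasFDerivAt_prodMk_right t q))) z.2
  simp only [ContinuousLinearMap.comp_apply, ContinuousLinearMap.inl_apply,
    ContinuousLinearMap.inr_apply, ContinuousLinearMap.toSpanSingleton_apply] at h3 h4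
  rw [ContinuousLinearMap.coprod_apply, h4, ContinuousLinearMap.toSpanSingleton_apply, ← h3,
    ← map_add]
  simp

/-- The time `T q` map is the identity along the orbit of `q`, hence fixes its tangent vector. -/
theorem fderiv_flow_field (h : IsPeriodicFlow φ X V p T) {q : Plane} (hq : q ∈ V) (hqp : q ≠ p) :
    fderiv ℝ (φ (T q)) q (X q) = X q := by
  have h1 : HasDerivAt (fun s => φ s q) (X q) 0 := by
    simpa [h.flow.zero q hq] using h.flow.hasDerivAt q hq 0
  have h2 := HasFDerivAt.comp_hasDerivAt_of_eq (f := fun s => φ s q) 0 (h.hasFDerivAt_flow hq (T q))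
    h1 (h.flow.zero q hq).symm
  refine h2.unique (h1.congr_of_eventuallyEq (Eventually.of_forall fun s => ?_))
  change φ (T q) (φ s q) = φ s q
  rw [h.flow_eq_iff hq, h.flow_period hq hqp]

/-- The determinant is continuous in `t`, never zero since `φ (-t)` inverts `φ t`, and equal to `1`
at `t = 0`. Preservation of orientation is what keeps returns on the same side of a periodic orbit.
-/
theorem planeDet_fderiv_flow_pos (h : IsPeriodicFlow φ X V p T) {q : Plane} (hq : q ∈ V) (t : ℝ) :
    0 < planeDet (fderiv ℝ (φ t) q) := by
  have hcont : Continuous fun t => fderiv ℝ (φ t) q := by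
    refine continuous_iff_continuousAt.2 fun t => ?_
    have h1 := h.flow.contDiffAt_flow h.contDiffAt le_rfl (z := (t, q)) hq
    have h2 : ContinuousAt (fun s => fderiv ℝ (fun z : ℝ × Plane => φ z.1 z.2) (s, q) ∘L
        .inr ℝ ℝ Plane) t :=
      ((h1.fderiv_right (m := 0) (by simp)).continuousAt.comp (f := fun s => (s, q))
        (by fun_prop)).clm_comp continuousAt_const
    refine h2.congr (Eventually.of_forall fun s => ?_)
    exact ((((h.flow.contDiffAt_flow h.contDiffAt le_rfl (z := (s, q)) hq).differentiableAt
      one_ne_zero).hasFDerivAt.comp q (hasFDerivAt_prodMk_right s q)).unique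
      (h.hasFDerivAt_flow hq s))
  have hne : ∀ t, planeDet (fderiv ℝ (φ t) q) ≠ 0 := fun t => by
    have h1 := (h.hasFDerivAt_flow (h.flow.mem q hq t) (-t)).comp q (h.hasFDerivAt_flow hq t)
    refine planeDet_ne_zero (h1.unique ((hasFDerivAt_id q).congr_of_eventuallyEq ?_))
    filter_upwards [h.flow.isOpen.mem_nhds hq] with x hx using h.neg_flow hx t
  have h0 : planeDet (fderiv ℝ (φ 0) q) = 1 := by
    rw [← planeDet_id]
    congr 1
    refine (h.hasFDerivAt_flow hq 0).unique ((hasFDerivAt_id q).congr_of_eventuallyEq ?_)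
    filter_upwards [h.flow.isOpen.mem_nhds hq] with x hx using h.flow.zero x hx
  by_contra! hle
  obtain ⟨s, hs⟩ := mem_range_of_exists_le_of_exists_ge (continuous_planeDet.comp hcont)
    ⟨t, hle⟩ ⟨0, zero_le_one.trans h0.ge⟩
  exact hne s hs

end IsPeriodicFlow

/-! ### Continuity and smoothness of the period away from the center -/

namespace IsPeriodicFlow

open PlanarCenter

variable {φ : ℝ → Plane → Plane} {X : Plane → Plane} {V : Set Plane} {p : Plane} {T : Plane → ℝ}

/-- Returns to a half-line transverse to a periodic orbit stay on it, and are controlled. -/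
theorem eventually_return (h : IsPeriodicFlow φ X V p T) {q : Plane} (hq : q ∈ V)
    (hqp : q ≠ p) {κ : ℝ} (hκ : κ * κ = 1) :
    ∃ M, ∃ ε > 0, ∀ s ∈ Set.Ioc 0 ε, ∀ t, |t - T q| ≤ ε →
      dotCLM (X q) (φ t (q + s • κ • rot (X q)) - q) = 0 →
      ∃ r, 0 < r ∧ r ≤ M * s ∧ φ t (q + s • κ • rot (X q)) = q + r • κ • rot (X q) := by
  have hX0 := h.field_ne_zero hq hqp
  set a := X q with ha
  set N := dotCLM a a with hN
  have hNpos : 0 < N := dotCLM_self_pos hX0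
  set B := fderiv ℝ (φ (T q)) q with hB
  set n := κ • rot a with hn
  have hBdet : 0 < planeDet B := h.planeDet_fderiv_flow_pos hq _
  have hBa : B a = a := h.fderiv_flow_field hq hqp
  -- As `B` fixes `a`, the component of `B n` across `a` is determined by `planeDet B`. Its sign is
  -- that of the side chosen by `κ = ±1`.
  have hcross : κ * crossCLM a (B n) = planeDet B * N := by
    have h1 := crossCLM_map B a n
    rw [hBa] at h1
    rw [h1, hn, map_smul, crossCLM_rot, smul_eq_mul, ← hN]
    linear_combination planeDet B * N * hκ
  set D := planeDet B * N with hD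
  have hDpos : 0 < D := mul_pos hBdet hNpos
  set C₁ := ‖dotCLM a‖ with hC₁
  set C₂ := ‖crossCLM a‖ with hC₂
  set C₀ := (2 * C₁ * (‖B‖ + 1) * ‖n‖) / N with hC₀
  have hC₀' : 0 ≤ C₀ := by positivity
  -- The bound by `N / 2` absorbs the term in `|t - T q|` when the return time is estimated; the
  -- bound by `D / 2` keeps the remainder below half of the main transverse term.
  obtain ⟨ε, hε, hε1, hε2, hε3⟩ : ∃ ε > 0, ε ≤ 1 ∧ C₁ * ε ≤ N / 2 ∧
      |κ| * C₂ * (ε * (C₀ + ‖n‖)) ≤ D / 2 := by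
    have hC₁0 : 0 ≤ C₁ := norm_nonneg _
    set K := |κ| * C₂ * (C₀ + ‖n‖) with hK
    have hK0 : 0 ≤ K := by positivity
    set m := min 1 (min (N / (2 * (C₁ + 1))) (D / (2 * (K + 1)))) with hm
    have hm0 : 0 < m := by positivity
    refine ⟨m, hm0, min_le_left _ _, ?_, ?_⟩
    · calc C₁ * m ≤ (C₁ + 1) * (N / (2 * (C₁ + 1))) := by
            gcongr
            · linarith
            · exact (min_le_right _ _).trans (min_le_left _ _)
        _ = N / 2 := by
            have : C₁ + 1 ≠ 0 := by positivity
            field_simp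
    · calc |κ| * C₂ * (m * (C₀ + ‖n‖)) = K * m := by rw [hK]; ring
        _ ≤ (K + 1) * (D / (2 * (K + 1))) := by
            gcongr
            · linarith
            · exact (min_le_right _ _).trans (min_le_right _ _)
        _ = D / 2 := by
            have : K + 1 ≠ 0 := by positivity
            field_simp
  have h1 := (h.hasFDerivAt_uncurry_flow hq (T q)).isLittleO.def hε
  rw [h.flow_period hq hqp] at h1
  obtain ⟨δ, hδ, hδ'⟩ := Metric.eventually_nhds_iff.1 h1
  set δ₁ := δ / (2 * (‖n‖ + 1)) with hδ₁
  have hδ₁' : 0 < δ₁ := by positivity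
  have hδ₁'' : δ₁ * ‖n‖ < δ := by
    calc δ₁ * ‖n‖ ≤ δ₁ * (‖n‖ + 1) := by gcongr; linarith
      _ = δ / 2 := by rw [hδ₁]; field_simp
      _ < δ := half_lt_self hδ
  refine ⟨(|κ| * C₂ * (‖B‖ * ‖n‖) + D) / N, min (δ / 2) δ₁, by positivity, fun s hs t ht h0 => ?_⟩
  have hs0 := hs.1
  have hst : dist (t, q + s • n) (T q, q) < δ := by
    rw [Prod.dist_eq, max_lt_iff]
    refine ⟨?_, ?_⟩
    · rw [Real.dist_eq]
      exact (ht.trans (min_le_left _ _)).trans_lt (half_lt_self hδ)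
    · rw [dist_self_add_left, norm_smul, Real.norm_of_nonneg hs0.le]
      refine lt_of_le_of_lt ?_ hδ₁''
      gcongr
      exact hs.2.trans (min_le_right _ _)
  have hR := hδ' hst
  set R := φ t (q + s • n) - q - ((t - T q) • a + s • B n) with hRdef
  have hR' : ‖R‖ ≤ ε * (|t - T q| + s * ‖n‖) := by
    have e1 : R = φ t (q + s • n) - q - (((ContinuousLinearMap.toSpanSingleton ℝ a).coprod B)
        ((t, q + s • n) - (T q, q))) := by
      simp [hRdef]
    rw [e1]
    refine hR.trans (mul_le_mul_of_nonneg_left ?_ hε.le)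
    rw [Prod.norm_def]
    refine max_le ?_ ?_
    · simpa using by positivity
    · simp [norm_smul, abs_of_pos hs0]
  have hφ : φ t (q + s • n) - q = (t - T q) • a + s • B n + R := by rw [hRdef]; abel
  have hdotB : |dotCLM a (B n)| ≤ C₁ * (‖B‖ * ‖n‖) :=
    ((dotCLM a).le_opNorm _).trans (by gcongr; exact B.le_opNorm n)
  have hdotR : |dotCLM a R| ≤ C₁ * (ε * (|t - T q| + s * ‖n‖)) :=
    ((dotCLM a).le_opNorm _).trans (by gcongr)
  -- The vanishing component along the field forces a return time within `O(s)` of `T q`, so the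
  -- remainder `R` is at most a small multiple of `s`.
  have ht' : |t - T q| ≤ C₀ * s := by
    have e1 : (t - T q) * N = -(s * dotCLM a (B n)) - dotCLM a R := by
      have := h0
      rw [hφ, map_add, map_add, map_smul, map_smul, smul_eq_mul, smul_eq_mul] at this
      linarith
    have e2 : |t - T q| * N ≤ s * (C₁ * (‖B‖ * ‖n‖)) + C₁ * (ε * (|t - T q| + s * ‖n‖)) := by
      rw [← abs_of_pos hNpos, ← abs_mul, e1]
      refine (abs_sub _ _).trans (add_le_add ?_ hdotR)
      rw [abs_neg, abs_mul, abs_of_pos hs0]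
      gcongr
    have e3 : |t - T q| * N ≤ s * (C₁ * (‖B‖ * ‖n‖)) + (N / 2 * |t - T q| + C₁ * 1 * (s * ‖n‖)) := by
      refine e2.trans (add_le_add le_rfl ?_)
      calc C₁ * (ε * (|t - T q| + s * ‖n‖)) = C₁ * ε * |t - T q| + C₁ * ε * (s * ‖n‖) := by ring
        _ ≤ _ := by gcongr
    rw [hC₀, div_mul_eq_mul_div, le_div_iff₀ hNpos]
    linarith
  have hR'' : ‖R‖ ≤ ε * (C₀ + ‖n‖) * s := by
    refine hR'.trans ?_
    calc ε * (|t - T q| + s * ‖n‖) ≤ ε * (C₀ * s + s * ‖n‖) := by gcongr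
      _ = _ := by ring
  have hφc : crossCLM a (φ t (q + s • n) - q) = s * crossCLM a (B n) + crossCLM a R := by
    rw [hφ, map_add, map_add, map_smul, map_smul, crossCLM_self]
    simp
  have hcR : |κ * crossCLM a R| ≤ D / 2 * s := by
    rw [abs_mul]
    calc |κ| * |crossCLM a R| ≤ |κ| * (C₂ * (ε * (C₀ + ‖n‖) * s)) := by
          gcongr
          exact ((crossCLM a).le_opNorm _).trans (by gcongr)
      _ = |κ| * C₂ * (ε * (C₀ + ‖n‖)) * s := by ring
      _ ≤ D / 2 * s := by gcongr
  have hcB : |κ * crossCLM a (B n)| ≤ |κ| * C₂ * (‖B‖ * ‖n‖) := by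
    rw [abs_mul, mul_assoc]
    gcongr
    exact ((crossCLM a).le_opNorm _).trans (by gcongr; exact B.le_opNorm n)
  have hκφ : κ * crossCLM a (φ t (q + s • n) - q) = s * D + κ * crossCLM a R := by
    rw [hφc, ← hcross]; ring
  refine ⟨κ * crossCLM a (φ t (q + s • n) - q) / N, ?_, ?_, ?_⟩
  · refine div_pos ?_ hNpos
    have := (abs_le.1 hcR).1
    have : 0 < D * s := by positivity
    rw [hκφ]
    linarith
  · rw [div_mul_eq_mul_div]
    refine div_le_div_of_nonneg_right ?_ hNpos.le
    have e1 := (abs_le.1 hcR).2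
    have e2 : s * D ≤ s * (|κ| * C₂ * (‖B‖ * ‖n‖)) := by
      rw [← hcross]
      exact mul_le_mul_of_nonneg_left ((le_abs_self _).trans hcB) hs0.le
    have : 0 < D * s := by positivity
    rw [hκφ]
    linarith
  · have e1 := eq_smul_rot_of_dotCLM_eq_zero hX0 h0
    have e2 : (κ * crossCLM a (φ t (q + s • n) - q) / N) • n =
        (crossCLM a (φ t (q + s • n) - q) / N) • rot a := by
      rw [hn, smul_smul]
      congr 1
      linear_combination (crossCLM a (φ t (q + s • κ • rot a) - q) / N) * hκ
    rw [← sub_eq_iff_eq_add', e2]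
    exact e1

end IsPeriodicFlow

namespace IsPeriodicFlow

open PlanarCenter

variable {φ : ℝ → Plane → Plane} {X : Plane → Plane} {V : Set Plane} {p : Plane} {T : Plane → ℝ}

theorem strictMonoOn_comp_flow (h : IsPeriodicFlow φ X V p T) {x b : Plane} (hx : x ∈ V)
    (u : Plane →L[ℝ] ℝ) {D : Set ℝ} (hD : Convex ℝ D) (hu : ∀ t ∈ D, 0 < u (X (φ t x))) :
    StrictMonoOn (fun t => u (φ t x - b)) D := by
  have hd : ∀ t, HasDerivAt (fun t => u (φ t x - b)) (u (X (φ t x))) t := fun t =>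
    u.hasFDerivAt.comp_hasDerivAt t ((h.flow.hasDerivAt x hx t).sub_const b)
  refine strictMonoOn_of_deriv_pos hD (fun t _ => (hd t).continuousAt.continuousWithinAt)
    fun t ht => ?_
  rw [(hd t).deriv]
  exact hu t (interior_subset ht)

/-- The minimal period does not jump up along a transverse half-line. -/
theorem eventually_period_le_of_section (h : IsPeriodicFlow φ X V p T) {q : Plane} (hq : q ∈ V)
    (hqp : q ≠ p) {κ : ℝ} (hκ : κ * κ = 1) {η : ℝ} (hη : 0 < η) :
    ∃ δ > (0 : ℝ), ∀ s ∈ Set.Ioc 0 δ, T (q + s • κ • rot (X q)) ≤ T q + η := by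
  have hX0 := h.field_ne_zero hq hqp
  obtain ⟨M, ε, hε, hret⟩ := h.eventually_return hq hqp hκ
  have hN := dotCLM_self_pos hX0
  have h1 : ∀ᶠ z : ℝ × Plane in 𝓝 (T q, q), 0 < dotCLM (X q) (X (φ z.1 z.2)) := by
    have hc : ContinuousAt (fun z : ℝ × Plane => dotCLM (X q) (X (φ z.1 z.2))) (T q, q) :=
      (dotCLM (X q)).continuous.continuousAt.comp
        ((h.contDiffAt _ (h.flow.mem q hq (T q))).continuousAt.comp
          (f := fun z : ℝ × Plane => φ z.1 z.2) (x := (T q, q)) (h.continuousAt hq))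
    exact hc.eventually (lt_mem_nhds (by simpa [h.flow_period hq hqp] using hN))
  obtain ⟨ε₁, hε₁, h1⟩ := Metric.eventually_nhds_iff.1 h1
  have hTpos := h.period_pos hq hqp
  obtain ⟨η₁, hη₁0, hη₁η, hη₁ε, hη₁ε₁, hη₁T⟩ :
      ∃ η₁ > 0, η₁ ≤ η ∧ η₁ ≤ ε ∧ η₁ < ε₁ ∧ η₁ < T q := by
    obtain ⟨y, hy0, hy⟩ := exists_between (lt_min (lt_min hη hε) (lt_min hε₁ hTpos))
    simp only [lt_min_iff] at hy
    exact ⟨y, hy0, hy.1.1.le, hy.1.2.le, hy.2.1, hy.2.2⟩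
  have hdist : ∀ t ∈ Set.Icc (T q - η₁) (T q + η₁), |t - T q| ≤ η₁ := fun t ht =>
    abs_le.2 ⟨by linarith [ht.1], by linarith [ht.2]⟩
  have hpos : ∀ x, dist x q < ε₁ → ∀ t ∈ Set.Icc (T q - η₁) (T q + η₁),
      0 < dotCLM (X q) (X (φ t x)) := fun x hx t ht => h1 (y := (t, x)) <| by
    rw [Prod.dist_eq, max_lt_iff, Real.dist_eq]
    exact ⟨(hdist t ht).trans_lt hη₁ε₁, hx⟩
  have hmonoq := h.strictMonoOn_comp_flow (b := q) hq (dotCLM (X q)) (convex_Icc _ _)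
    (hpos q (by simpa using hε₁))
  have hTq : T q ∈ Set.Icc (T q - η₁) (T q + η₁) := ⟨by linarith, by linarith⟩
  have hq0 : dotCLM (X q) (φ (T q) q - q) = 0 := by simp [h.flow_period hq hqp]
  have hsign : ∀ t, ContinuousAt (fun x => dotCLM (X q) (φ t x - q)) q := fun t =>
    (dotCLM (X q)).continuous.continuousAt.comp
      ((h.hasFDerivAt_flow hq t).continuousAt.sub continuousAt_const)
  have ha : dotCLM (X q) (φ (T q - η₁) q - q) < 0 := by
    rw [← hq0]
    exact hmonoq ⟨le_rfl, by linarith⟩ hTq (by linarith)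
  have hb : 0 < dotCLM (X q) (φ (T q + η₁) q - q) := by
    rw [← hq0]
    exact hmonoq hTq ⟨by linarith, le_rfl⟩ (by linarith)
  set c : ℝ → Plane := fun s => q + s • κ • rot (X q) with hc
  have hcc : Continuous c := by fun_prop
  have hc0 : c 0 = q := by simp [hc]
  have hev : ∀ᶠ s in 𝓝 (0 : ℝ), (c s ∈ V ∧ c s ≠ p ∧ dist (c s) q < ε₁) ∧
      dotCLM (X q) (φ (T q - η₁) (c s) - q) < 0 ∧ 0 < dotCLM (X q) (φ (T q + η₁) (c s) - q) := by
    have hct : Tendsto c (𝓝 0) (𝓝 q) := hc0 ▸ hcc.tendsto 0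
    refine hct.eventually (((h.flow.isOpen.eventually_mem hq).and
      ((isOpen_ne.eventually_mem hqp).and (Metric.ball_mem_nhds q hε₁))).and
      (((hsign _).eventually (gt_mem_nhds ha)).and ((hsign _).eventually (lt_mem_nhds hb))))
  obtain ⟨δ, hδ, hev⟩ := Metric.eventually_nhds_iff.1 hev
  set δ₁ := min ε (δ / 2) with hδ₁
  have hev' : ∀ s ∈ Set.Ioc 0 δ₁, (c s ∈ V ∧ c s ≠ p ∧ dist (c s) q < ε₁) ∧
      dotCLM (X q) (φ (T q - η₁) (c s) - q) < 0 ∧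
      0 < dotCLM (X q) (φ (T q + η₁) (c s) - q) := fun s hs => hev (y := s) (by
    rw [Real.dist_eq, sub_zero, abs_of_pos hs.1]
    exact (hs.2.trans (min_le_right _ _)).trans_lt (half_lt_self hδ))
  refine ⟨δ₁, by positivity, fun s₀ hs₀ => ?_⟩
  have hs₀V := (hev' s₀ hs₀).1.1
  have hs₀p := (hev' s₀ hs₀).1.2.1
  -- Here `u` measures the displacement along `X q`, with zero set the transverse line, and `v`
  -- recovers the parameter of a point of the half-line.
  have key := h.exists_fixed_return (c := c) (u := fun x => dotCLM (X q) (x - q))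
    (v := fun x => κ * crossCLM (X q) (x - q) / dotCLM (X q) (X q)) (M := M)
    (a := T q - η₁) (b := T q + η₁) (by linarith) hcc (fun s hs => (hev' s hs).1.1)
    (fun s hs => (hev' s hs).1.2.1) (by fun_prop) (by fun_prop) (fun r => ?_)
    (fun s hs => h.strictMonoOn_comp_flow (hev' s hs).1.1 _ (convex_Icc _ _)
      (hpos _ (hev' s hs).1.2.2))
    (fun s hs => (hev' s hs).2.1) (fun s hs => (hev' s hs).2.2)
    (fun s hs t ht => hret s ⟨hs.1, hs.2.trans (min_le_left _ _)⟩ t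
      ((hdist t ht).trans hη₁ε)) hs₀
  · rcases key with ⟨t, ht⟩ | ⟨s, hs, t, ht, hts, r, hr⟩
    · have := h.period_flow hs₀V hs₀p t
      rw [show φ t (c s₀) = q from ht.trans hc0] at this
      change T (c s₀) ≤ _
      linarith
    · have hs' : s ∈ Set.Ioc 0 δ₁ := ⟨hs.1, hs.2.trans hs₀.2⟩
      have hsV := (hev' s hs').1.1
      have hsp := (hev' s hs').1.2.1
      have h2 := h.period_flow hs₀V hs₀p r
      rw [show φ r (c s₀) = c s from hr] at h2
      change T (c s₀) ≤ _
      rw [← h2]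
      exact (h.period_le hsV hsp (by linarith [ht.1]) hts).trans (by linarith [ht.2])
  · rw [div_eq_iff hN.ne']
    simp only [hc, add_sub_cancel_left, map_smul, crossCLM_rot, smul_eq_mul]
    linear_combination r * dotCLM (X q) (X q) * hκ

/-- The minimal period is continuous away from the center. -/
theorem continuousAt_period (h : IsPeriodicFlow φ X V p T) {q : Plane} (hq : q ∈ V)
    (hqp : q ≠ p) : ContinuousAt T q := by
  have hX0 := h.field_ne_zero hq hqp
  have hN := dotCLM_self_pos hX0
  refine tendsto_order.2 ⟨fun a ha => h.eventually_lt_period hq hqp ha, fun b hb => ?_⟩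
  set η := (b - T q) / 2 with hη
  have hη0 : 0 < η := by linarith
  obtain ⟨δ₁, hδ₁, h1⟩ := h.eventually_period_le_of_section hq hqp (κ := 1) (by norm_num) hη0
  obtain ⟨δ₂, hδ₂, h2⟩ := h.eventually_period_le_of_section hq hqp (κ := -1) (by norm_num) hη0
  -- The two signs of `κ` cover both halves of a transverse segment through `q`.
  have h3 : ∀ s : ℝ, |s| ≤ min δ₁ δ₂ → T (q + s • rot (X q)) < b := by
    intro s hs
    rcases lt_trichotomy s 0 with hs0 | rfl | hs0
    · have := h2 (-s) ⟨by linarith, (neg_le_abs s).trans (hs.trans (min_le_right _ _))⟩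
      simp only [neg_smul, one_smul, smul_neg, neg_neg] at this
      linarith
    · simpa using hb
    · have := h1 s ⟨hs0, (le_abs_self s).trans (hs.trans (min_le_left _ _))⟩
      rw [one_smul] at this
      linarith
  set v : Plane → ℝ := fun x => crossCLM (X q) (x - q) / dotCLM (X q) (X q) with hv
  have hφ0 : ContinuousAt (fun z : ℝ × Plane => φ z.1 z.2) (0, q) := h.continuousAt hq
  have h4 : ∀ᶠ z : ℝ × Plane in 𝓝 (0, q), 0 < dotCLM (X q) (X (φ z.1 z.2)) ∧
      |v (φ z.1 z.2)| < min δ₁ δ₂ := by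
    have hc1 : ContinuousAt (fun z : ℝ × Plane => dotCLM (X q) (X (φ z.1 z.2))) (0, q) :=
      (dotCLM (X q)).continuous.continuousAt.comp
        ((h.contDiffAt _ (h.flow.mem q hq 0)).continuousAt.comp
          (f := fun z : ℝ × Plane => φ z.1 z.2) (x := (0, q)) hφ0)
    have hvc : Continuous fun x => |v x| := by fun_prop
    have hc2 : ContinuousAt (fun z : ℝ × Plane => |v (φ z.1 z.2)|) (0, q) :=
      hvc.continuousAt.comp hφ0
    refine (hc1.eventually (lt_mem_nhds ?_)).and (hc2.eventually (gt_mem_nhds ?_))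
    · simpa [h.flow.zero q hq] using hN
    · simpa [h.flow.zero q hq, hv] using ⟨hδ₁, hδ₂⟩
  obtain ⟨ε, hε, h4⟩ := Metric.eventually_nhds_iff.1 h4
  have hε2 := half_pos hε
  have h5 : ∀ x, dist x q < ε → ∀ t ∈ Set.Icc (-(ε / 2)) (ε / 2),
      0 < dotCLM (X q) (X (φ t x)) ∧ |v (φ t x)| < min δ₁ δ₂ := fun x hx t ht => h4 (y := (t, x)) <| by
    rw [Prod.dist_eq, max_lt_iff, Real.dist_eq, sub_zero]
    exact ⟨(abs_le.2 ht).trans_lt (half_lt_self hε), hx⟩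
  have hmono := h.strictMonoOn_comp_flow (b := q) hq (dotCLM (X q)) (convex_Icc _ _)
    fun t ht => (h5 q (by simpa using hε) t ht).1
  have hq0 : dotCLM (X q) (φ 0 q - q) = 0 := by simp [h.flow.zero q hq]
  have h0mem : (0 : ℝ) ∈ Set.Icc (-(ε / 2)) (ε / 2) := ⟨by linarith, by linarith⟩
  have hsign : ∀ t, ContinuousAt (fun x => dotCLM (X q) (φ t x - q)) q := fun t =>
    (dotCLM (X q)).continuous.continuousAt.comp
      ((h.hasFDerivAt_flow hq t).continuousAt.sub continuousAt_const)
  have ha : dotCLM (X q) (φ (-(ε / 2)) q - q) < 0 := by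
    rw [← hq0]
    exact hmono ⟨le_rfl, by linarith⟩ h0mem (by linarith)
  have hb : 0 < dotCLM (X q) (φ (ε / 2) q - q) := by
    rw [← hq0]
    exact hmono h0mem ⟨by linarith, le_rfl⟩ (by linarith)
  filter_upwards [(hsign _).eventually (gt_mem_nhds ha), (hsign _).eventually (lt_mem_nhds hb),
    Metric.ball_mem_nhds q hε, h.flow.isOpen.mem_nhds hq, isOpen_ne.mem_nhds hqp]
    with x hxa hxb hxq hxV hxp
  -- Every point near `q` flows to the segment in a short time, and the period is constant along
  -- orbits.
  obtain ⟨t, ht, hut⟩ := intermediate_value_Icc (by linarith : -(ε / 2) ≤ ε / 2)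
    (f := fun t => dotCLM (X q) (φ t x - q)) ((dotCLM (X q)).continuous.comp
      ((h.flow.continuous_orbit hxV).sub continuous_const)).continuousOn ⟨hxa.le, hxb.le⟩
  have h6 := eq_smul_rot_of_dotCLM_eq_zero hX0 hut
  rw [← h.period_flow hxV hxp t, ← add_sub_cancel q (φ t x), h6]
  exact h3 _ (h5 x hxq t ht).2.le

/-- The minimal period is as smooth as the field away from the center. -/
theorem contDiffAt_period (h : IsPeriodicFlow φ X V p T) {n : WithTop ℕ∞} (hn : 1 ≤ n)
    (hX : ∀ x ∈ V, ContDiffAt ℝ n X x) {q : Plane} (hq : q ∈ V) (hqp : q ≠ p) :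
    ContDiffAt ℝ n T q := by
  have hX0 := h.field_ne_zero hq hqp
  have hn0 : n ≠ 0 := by rintro rfl; simp at hn
  -- One scalar equation is enough: the component of the displacement along `X q`, with time
  -- derivative `|X q|²` at `T q`.
  refine contDiffAt_of_implicit hn0 (f := fun z : Plane × ℝ => dotCLM (X q) (φ z.2 z.1 - z.1))
    (c := dotCLM (X q) (X q)) ?_ ?_ (dotCLM_self_pos hX0).ne' (h.continuousAt_period hq hqp) ?_
  · have h1 : ContDiffAt ℝ n (fun z : Plane × ℝ => φ z.2 z.1) (q, T q) :=
      ContDiffAt.comp (g := fun z : ℝ × Plane => φ z.1 z.2) (f := fun z : Plane × ℝ => (z.2, z.1))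
        (q, T q) (h.flow.contDiffAt_flow hX hn hq) (contDiffAt_snd.prodMk contDiffAt_fst)
    exact (dotCLM (X q)).contDiff.contDiffAt.comp (q, T q) (h1.sub contDiffAt_fst)
  · have h1 := (h.flow.hasDerivAt q hq (T q)).sub_const q
    rw [h.flow_period hq hqp] at h1
    exact (dotCLM (X q)).hasFDerivAt.comp_hasDerivAt (T q) h1
  · filter_upwards [h.flow.isOpen.mem_nhds hq, isOpen_ne.mem_nhds hqp] with x hxV hxp
    simp [h.flow_period hxV hxp, h.flow_period hq hqp]

end IsPeriodicFlow

/-! ### Linearization at the center -/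

namespace PlanarCenter

-- Cayley–Hamilton for the characteristic polynomial `X² + ω₀²`.
open Polynomial in
theorem comp_self_eq_of_aroots {A : Plane →ₗ[ℝ] Plane} {ω₀ : ℝ}
    (h : A.charpoly.aroots ℂ = {(ω₀ : ℂ) * Complex.I, -((ω₀ : ℂ) * Complex.I)}) (v : Plane) :
    A (A v) = -(ω₀ ^ 2) • v := by
  have h1 : A.charpoly = X ^ 2 + C (ω₀ ^ 2) := by
    refine Polynomial.map_injective (algebraMap ℝ ℂ) (algebraMap ℝ ℂ).injective ?_
    rw [(IsAlgClosed.splits (A.charpoly.map (algebraMap ℝ ℂ))).eq_prod_roots_of_monic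
      (A.charpoly_monic.map _), ← aroots_def, h]
    have hI : Complex.I * Complex.I = -1 := Complex.I_mul_I
    simp only [Multiset.insert_eq_cons, Multiset.map_cons, Multiset.map_singleton,
      Multiset.prod_cons, Multiset.prod_singleton, Polynomial.map_add, Polynomial.map_pow, map_X,
      map_C, map_neg, map_mul]
    have h2 : (C Complex.I : ℂ[X]) * C Complex.I = -1 := by rw [← C_mul, hI]; simp
    have h3 : (C ((algebraMap ℝ ℂ) (ω₀ ^ 2)) : ℂ[X]) = C (ω₀ : ℂ) ^ 2 := by
      rw [← C_pow]; simp
    rw [h3]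
    linear_combination (-(C (ω₀ : ℂ)) ^ 2) * h2
  have h2 := congrArg (fun L => L v) A.aeval_self_charpoly
  rw [h1] at h2
  simp only [map_add, aeval_C, LinearMap.add_apply, pow_two, LinearMap.zero_apply,
    Module.algebraMap_end_apply] at h2
  rw [neg_smul, ← pow_two] at *
  exact eq_neg_of_add_eq_zero_left (by simpa [pow_two] using h2)

/-- A linear map of the plane with eigenvalues `± i ω₀` is multiplication by `i ω₀` in a suitable
complex coordinate. -/
theorem exists_complex_coordinate {A : Plane →L[ℝ] Plane} {ω₀ : ℝ} (hω : 0 < ω₀)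
    (h : ∀ v, A (A v) = -(ω₀ ^ 2) • v) :
    ∃ ℓ : Plane ≃L[ℝ] ℂ, ∀ v, ℓ (A v) = (ω₀ * Complex.I) * ℓ v := by
  set e : Plane := !₂[1, 0] with he
  have he0 : e ≠ 0 := fun h0 => by simpa [he] using congrArg (fun v : Plane => v 0) h0
  -- Sending `1` to `e` and `i` to `A e / ω₀` intertwines `iω₀` with `A`, because `A² = -ω₀²`.
  let f : ℂ →ₗ[ℝ] Plane :=
    { toFun := fun z => z.re • e + (z.im / ω₀) • A e
      map_add' := fun z w => by
        simp only [Complex.add_re, Complex.add_im, add_div, add_smul]; abel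
      map_smul' := fun c z => by
        simp [mul_smul, mul_div_assoc] }
  have hf : ∀ z, f z = z.re • e + (z.im / ω₀) • A e := fun _ => rfl
  have hAf : ∀ z, A (f z) = f ((ω₀ * Complex.I) * z) := fun z => by
    rw [hf, hf, map_add, map_smul, map_smul, h]
    have e1 : ((ω₀ : ℂ) * Complex.I * z).re = -ω₀ * z.im := by simp
    have e2 : ((ω₀ : ℂ) * Complex.I * z).im / ω₀ = z.re := by simp; field_simp
    rw [e1, e2, smul_smul, add_comm]
    congr 2
    field_simp
  have hinj : Function.Injective f := by
    rw [← LinearMap.ker_eq_bot, LinearMap.ker_eq_bot']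
    intro z hz
    have h1 : A (f z) = 0 := by rw [hz, map_zero]
    rw [hAf, hf] at h1
    rw [hf] at hz
    have e1 : ((ω₀ : ℂ) * Complex.I * z).re = -ω₀ * z.im := by simp
    have e2 : ((ω₀ : ℂ) * Complex.I * z).im / ω₀ = z.re := by simp; field_simp
    rw [e1, e2] at h1
    have h2 : (ω₀ * (z.re ^ 2 + z.im ^ 2)) • e = 0 := by
      have : (ω₀ * z.re) • (z.re • e + (z.im / ω₀) • A e) -
          z.im • ((-ω₀ * z.im) • e + z.re • A e) = (ω₀ * (z.re ^ 2 + z.im ^ 2)) • e := by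
        have : ω₀ * z.re * (z.im / ω₀) = z.im * z.re := by field_simp
        rw [smul_add, smul_add, smul_smul, smul_smul, smul_smul, smul_smul, this]
        module
      rw [← this, hz, h1]; simp
    have h3 : z.re ^ 2 + z.im ^ 2 = 0 :=
      (mul_eq_zero.1 ((smul_eq_zero.1 h2).resolve_right he0)).resolve_left hω.ne'
    apply Complex.ext
    · simpa using pow_eq_zero_iff two_ne_zero |>.1 (by nlinarith [sq_nonneg z.re, sq_nonneg z.im] : z.re ^ 2 = 0)
    · simpa using pow_eq_zero_iff two_ne_zero |>.1 (by nlinarith [sq_nonneg z.re, sq_nonneg z.im] : z.im ^ 2 = 0)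
  let g : ℂ ≃ₗ[ℝ] Plane := f.linearEquivOfInjective hinj (by simp)
  refine ⟨g.symm.toContinuousLinearEquiv, fun v => ?_⟩
  change g.symm (A v) = _ * g.symm v
  rw [LinearEquiv.symm_apply_eq]
  have h1 : ∀ z, g z = f z := fun z => rfl
  rw [h1, ← hAf, ← h1, LinearEquiv.apply_symm_apply]

end PlanarCenter

namespace IsPeriodicFlow

open PlanarCenter ContinuousMap unitInterval

variable {φ : ℝ → Plane → Plane} {X : Plane → Plane} {V : Set Plane} {p : Plane} {T : Plane → ℝ}

theorem orbitPath_center (h : IsPeriodicFlow φ X V p T) (τ : ℝ) (s : I) :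
    orbitPath φ (τ, p) s = p := by
  rw [h.flow.orbitPath_apply (z := (τ, p)) h.mem_center, h.fixed]

/-- The linearized flow at the center is a rotation in the complex coordinate. -/
theorem fderiv_orbitPath_center (h : IsPeriodicFlow φ X V p T) {ω₀ : ℝ} {ℓ : Plane ≃L[ℝ] ℂ}
    (hℓ : ∀ v, ℓ (fderiv ℝ X p v) = (ω₀ * Complex.I) * ℓ v) (τ : ℝ) (v : Plane) (s : I) :
    ℓ (fderiv ℝ (orbitPath φ) (τ, p) (0, v) s) =
      Complex.exp ((ω₀ * (s * τ) : ℝ) * Complex.I) * ℓ v := by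
  have h1 := h.flow.fderiv_orbitPath_eq h.contDiffAt (z := (τ, p)) h.mem_center v
  set k := fderiv ℝ (orbitPath φ) (τ, p) (0, v) with hk
  set A := fderiv ℝ X p with hA
  set w := pointwiseApply I Plane Plane (superposition I (fderiv ℝ X) (orbitPath φ (τ, p))) k
  have hw : ∀ s, w s = A (k s) := fun s => by
    have : superposition I (fderiv ℝ X) (orbitPath φ (τ, p)) s = A := by
      rw [superposition_apply, h.orbitPath_center]
      intro t
      rw [h.orbitPath_center]
      exact ((h.contDiffAt p h.mem_center).fderiv_right (m := 0) (by simp)).continuousAt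
    rw [pointwiseApply_apply, this]
  let y : ℝ → Plane := fun s => v + τ • w.primitive s
  have hy : ∀ s : I, k s = y s := fun s => by
    conv_lhs => rw [h1]
    rfl
  -- At a fixed point the variational equation has constant coefficients, and `g` is its explicit
  -- solution.
  let g : ℝ → Plane := fun s => ℓ.symm (Complex.exp ((ω₀ * (s * τ) : ℝ) * Complex.I) * ℓ v)
  have hAg : ∀ z, A (ℓ.symm z) = ℓ.symm ((ω₀ * Complex.I) * z) := fun z => by
    rw [ContinuousLinearEquiv.eq_symm_apply, hℓ, ContinuousLinearEquiv.apply_symm_apply]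
  have hg : ∀ s, HasDerivAt g (τ • A (g s)) s := fun s => by
    have e1 : HasDerivAt (fun s : ℝ => ((ω₀ * (s * τ) : ℝ) : ℂ)) ((ω₀ * τ : ℝ) : ℂ) s :=
      (by simpa using ((hasDerivAt_id s).mul_const τ).const_mul ω₀ :
        HasDerivAt (fun s : ℝ => ω₀ * (s * τ)) (ω₀ * τ) s).ofReal_comp
    have e2 := ((e1.mul_const Complex.I).cexp).mul_const (ℓ v)
    have e3 := ℓ.symm.toContinuousLinearMap.hasFDerivAt.comp_hasDerivAt s e2
    have e4 : τ • A (g s) = (ℓ.symm.toContinuousLinearMap)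
        (Complex.exp ((ω₀ * (s * τ) : ℝ) * Complex.I) * (((ω₀ * τ : ℝ) : ℂ) * Complex.I) * ℓ v) := by
      rw [hAg, ← map_smul]
      refine congrArg ℓ.symm ?_
      simp only [Complex.real_smul]
      push_cast
      ring
    exact e4 ▸ e3
  have key := eqOn_Icc_of_integralCurves (X := fun x => τ • A x) (f := y) (g := g) (b := 1)
    ((w.continuous_primitive.const_smul τ).const_add v).continuousOn
    (fun s _ => (hg s).continuousAt.continuousWithinAt) (fun s hs => ?_) (fun s _ => hg s)
    (fun s _ => by fun_prop) (fun s _ => by fun_prop) (by simp [y, g])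
  · rw [hy, key s.2]
    simp [g]
  · have e1 := (w.hasDerivAt_primitive s).const_smul τ |>.const_add v
    rwa [Set.projIcc_of_mem _ (Set.Ico_subset_Icc_self hs), hw, hy] at e1

/-- Near the center the flow is close to a rotation in the complex coordinate. -/
theorem eventually_norm_flow_sub_le (h : IsPeriodicFlow φ X V p T) {ω₀ : ℝ} {ℓ : Plane ≃L[ℝ] ℂ}
    (hℓ : ∀ v, ℓ (fderiv ℝ X p v) = (ω₀ * Complex.I) * ℓ v) {τ : ℝ} (hτ : 0 < τ) {ε : ℝ}
    (hε : 0 < ε) : ∀ᶠ x in 𝓝 p, ∀ t ∈ Set.Icc 0 τ,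
      ‖ℓ (φ t x - p) - Complex.exp ((ω₀ * t : ℝ) * Complex.I) * ℓ (x - p)‖ ≤ ε * ‖ℓ (x - p)‖ := by
  -- Differentiability of the whole arc in the supremum norm gives the estimate for all times in
  -- `[0, τ]` at once.
  have h1 := ((h.flow.contDiffAt_orbitPath h.contDiffAt le_rfl (z := (τ, p))
    h.mem_center).differentiableAt one_ne_zero).hasFDerivAt
  have h2 := h1.comp p (hasFDerivAt_prodMk_right τ p)
  set C := (‖(ℓ : Plane →L[ℝ] ℂ)‖ + 1) * (‖(ℓ.symm : ℂ →L[ℝ] Plane)‖ + 1) with hC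
  have hC0 : 0 < C := by positivity
  filter_upwards [h2.isLittleO.def (div_pos hε hC0), h.flow.isOpen.mem_nhds h.mem_center]
    with x hx hxV t ht
  have hs : t / τ ∈ I := ⟨div_nonneg ht.1 hτ.le, (div_le_one hτ).2 ht.2⟩
  have h3 := (ContinuousMap.norm_coe_le_norm _ (⟨t / τ, hs⟩ : I)).trans hx
  simp only [Function.comp_apply, ContinuousMap.sub_apply, ContinuousLinearMap.comp_apply,
    ContinuousLinearMap.inr_apply] at h3
  rw [h.flow.orbitPath_apply (z := (τ, x)) hxV, h.orbitPath_center] at h3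
  simp only [div_mul_cancel₀ t hτ.ne'] at h3
  have h4 : ‖x - p‖ ≤ (‖(ℓ.symm : ℂ →L[ℝ] Plane)‖ + 1) * ‖ℓ (x - p)‖ := by
    have := (ℓ.symm : ℂ →L[ℝ] Plane).le_opNorm (ℓ (x - p))
    simp only [ContinuousLinearEquiv.coe_coe, ContinuousLinearEquiv.symm_apply_apply] at this
    refine this.trans ?_
    gcongr
    linarith
  have h5 := h.fderiv_orbitPath_center hℓ τ (x - p) ⟨t / τ, hs⟩
  simp only [div_mul_cancel₀ t hτ.ne'] at h5
  rw [← h5, ← map_sub]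
  calc _ ≤ ‖(ℓ : Plane →L[ℝ] ℂ)‖ * _ := (ℓ : Plane →L[ℝ] ℂ).le_opNorm _
    _ ≤ (‖(ℓ : Plane →L[ℝ] ℂ)‖ + 1) * (ε / C *
        ((‖(ℓ.symm : ℂ →L[ℝ] Plane)‖ + 1) * ‖ℓ (x - p)‖)) := by
      gcongr
      · linarith
      · exact h3.trans (by gcongr)
    _ = ε * ‖ℓ (x - p)‖ := by
      rw [hC]; field_simp

end IsPeriodicFlow

/-! ### Continuity of the period at the center -/

namespace IsPeriodicFlow

open PlanarCenter ContinuousMap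

variable {φ : ℝ → Plane → Plane} {X : Plane → Plane} {V : Set Plane} {p : Plane} {T : Plane → ℝ}

/-- Along short orbit arcs near the center the field is close to its linear part. -/
theorem eventually_norm_field_sub_le (h : IsPeriodicFlow φ X V p T) {ω₀ : ℝ} {ℓ : Plane ≃L[ℝ] ℂ}
    (hℓ : ∀ v, ℓ (fderiv ℝ X p v) = (ω₀ * Complex.I) * ℓ v) {τ : ℝ} (hτ : 0 < τ) {ε : ℝ}
    (hε : 0 < ε) : ∀ᶠ x in 𝓝 p, ∀ t ∈ Set.Icc 0 τ,
      ‖ℓ (X (φ t x)) - (ω₀ * Complex.I) * ℓ (φ t x - p)‖ ≤ ε * ‖ℓ (φ t x - p)‖ := by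
  have h1 := ((h.contDiffAt p h.mem_center).differentiableAt one_ne_zero).hasFDerivAt
  have h2 := ((ℓ : Plane →L[ℝ] ℂ).hasFDerivAt.comp p h1).isLittleO
  have h3 : (fun y => y - p) =O[𝓝 p] fun y => ℓ (y - p) := by
    simpa using ContinuousLinearMap.isBigO_comp (ℓ.symm : ℂ →L[ℝ] Plane) (fun y => ℓ (y - p)) (𝓝 p)
  have h4 := (h2.trans_isBigO h3).def hε
  have h5 : ∀ᶠ v : C(unitInterval, Plane) in 𝓝 (orbitPath φ (τ, p)), ∀ s,
      ‖ℓ (X (v s)) - (ω₀ * Complex.I) * ℓ (v s - p)‖ ≤ ε * ‖ℓ (v s - p)‖ := by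
    refine ContinuousMap.eventually_forall_apply
      (Q := fun y => ‖ℓ (X y) - (ω₀ * Complex.I) * ℓ (y - p)‖ ≤ ε * ‖ℓ (y - p)‖) _ fun s => ?_
    rw [h.orbitPath_center]
    filter_upwards [h4] with y hy
    simpa [h.field_center, hℓ, ← map_sub] using hy
  have h6 : ContinuousAt (fun x => orbitPath φ (τ, x)) p :=
    ContinuousAt.comp (g := orbitPath φ) (f := fun x => (τ, x))
      (h.flow.contDiffAt_orbitPath h.contDiffAt le_rfl (z := (τ, p)) h.mem_center).continuousAt
      (by fun_prop)
  filter_upwards [h6.eventually h5, h.flow.isOpen.mem_nhds h.mem_center] with x hx hxV t ht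
  have hs : t / τ ∈ unitInterval := ⟨div_nonneg ht.1 hτ.le, (div_le_one hτ).2 ht.2⟩
  have := hx ⟨t / τ, hs⟩
  rw [h.flow.orbitPath_apply (z := (τ, x)) hxV] at this
  simpa only [div_mul_cancel₀ t hτ.ne'] using this

/-- The fixed return argument on the segment from `p` to `x`: a near-rotation crosses it
transversally at a time within `θ / ω₀` of `2π / ω₀`. -/
theorem period_le_of_rotation (h : IsPeriodicFlow φ X V p T) {ω₀ : ℝ} (hω : 0 < ω₀)
    {ℓ : Plane ≃L[ℝ] ℂ} {θ ε : ℝ} (hθ : 0 < θ) (hθ2 : θ ≤ 1 / 2) (hε : ε ≤ 1 / 10)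
    (hεθ : ε < Real.sin θ) {x : Plane} (hxp : x ≠ p)
    (hgood : ∀ y, 0 < ‖ℓ (y - p)‖ → ‖ℓ (y - p)‖ ≤ ‖ℓ (x - p)‖ → y ∈ V ∧
      ∀ t ∈ Set.Icc 0 (2 * (2 * Real.pi / ω₀)),
        ‖ℓ (φ t y - p) - Complex.exp ((ω₀ * t : ℝ) * Complex.I) * ℓ (y - p)‖ ≤ ε * ‖ℓ (y - p)‖ ∧
        ‖ℓ (X (φ t y)) - (ω₀ * Complex.I) * ℓ (φ t y - p)‖ ≤ ω₀ / 10 * ‖ℓ (φ t y - p)‖) :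
    T x ≤ (2 * Real.pi + θ) / ω₀ := by
  have hπ := Real.pi_gt_three
  set w := ℓ (x - p) with hw
  have hw0 : w ≠ 0 := by simpa [hw, sub_eq_zero] using hxp
  have hr0 : 0 < ‖w‖ := norm_pos_iff.2 hw0
  set e : ℂ := w / ‖w‖ with he
  have hne : (‖w‖ : ℂ) ≠ 0 := by exact_mod_cast hr0.ne'
  have hen : ‖e‖ = 1 := by simp [he, hr0.ne']
  have hee : e * (starRingEnd ℂ) e = 1 := by rw [Complex.mul_conj, Complex.normSq_eq_norm_sq, hen]; simp
  let c : ℝ → Plane := fun r => p + r • ℓ.symm e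
  have hℓc : ∀ r, ℓ (c r - p) = r * e := fun r => by simp [c]
  have hcn : ∀ r, 0 < r → ‖ℓ (c r - p)‖ = r := fun r hr => by
    rw [hℓc, norm_mul, hen, mul_one, Complex.norm_real, Real.norm_of_nonneg hr.le]
  -- The coordinate `m` turns the ray from `p` through `x` into the positive real axis, so `u = Im
  -- m` vanishes on the ray and `Re m` is its parameter.
  let m : Plane →L[ℝ] ℂ := ((ContinuousLinearMap.mul ℝ ℂ).flip ((starRingEnd ℂ) e)) ∘L (ℓ : Plane →L[ℝ] ℂ)
  have hm : ∀ y, m y = ℓ y * (starRingEnd ℂ) e := fun y => rfl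
  have hmn : ∀ z : ℂ, ‖z * (starRingEnd ℂ) e‖ = ‖z‖ := fun z => by simp [hen]
  let u : Plane →L[ℝ] ℝ := Complex.imCLM ∘L m
  have hu' : ∀ y, u y = (m y).im := fun y => rfl
  have hcx : c ‖w‖ = x := by
    simp only [c, he]
    rw [← map_smul]
    have : ‖w‖ • (w / ‖w‖) = w := by rw [Complex.real_smul]; field_simp
    rw [this, hw]
    simp
  have hg : ∀ s ∈ Set.Ioc 0 ‖w‖, c s ∈ V ∧ ∀ t ∈ Set.Icc ((2 * Real.pi - θ) / ω₀) ((2 * Real.pi + θ) / ω₀),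
      ‖m (φ t (c s) - p) - Complex.exp ((ω₀ * t : ℝ) * Complex.I) * s‖ ≤ ε * s ∧
      0 < u (X (φ t (c s))) ∧ 0 < (m (φ t (c s) - p)).re ∧
      (m (φ t (c s) - p)).re ≤ 11 / 10 * s := by
    intro s hs
    have h1 := hgood (c s) (by rw [hcn s hs.1]; exact hs.1) (by rw [hcn s hs.1]; exact hs.2)
    refine ⟨h1.1, fun t ht => ?_⟩
    have ht0 : t ∈ Set.Icc 0 (2 * (2 * Real.pi / ω₀)) := by
      refine ⟨le_trans (div_nonneg (by linarith) hω.le) ht.1, ht.2.trans ?_⟩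
      rw [← mul_div_assoc]
      gcongr
      linarith
    obtain ⟨h2, h3⟩ := h1.2 t ht0
    rw [hcn s hs.1, hℓc, ← hmn] at h2
    have h4 : (ℓ (φ t (c s) - p) - Complex.exp ((ω₀ * t : ℝ) * Complex.I) * (s * e)) *
        (starRingEnd ℂ) e = m (φ t (c s) - p) - Complex.exp ((ω₀ * t : ℝ) * Complex.I) * s := by
      rw [hm]; linear_combination (-Complex.exp ((ω₀ * t : ℝ) * Complex.I) * s) * hee
    rw [h4] at h2
    rw [← hmn, ← hmn (ℓ (φ t (c s) - p))] at h3
    have h5 : (ℓ (X (φ t (c s))) - (ω₀ * Complex.I) * ℓ (φ t (c s) - p)) * (starRingEnd ℂ) e =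
        m (X (φ t (c s))) - (ω₀ * Complex.I) * m (φ t (c s) - p) := by
      rw [hm, hm]; ring
    rw [h5, ← hm] at h3
    set z := m (φ t (c s) - p) with hz
    have hnorm : ‖z‖ ≤ 11 / 10 * s := by
      have e1 : ‖Complex.exp ((ω₀ * t : ℝ) * Complex.I) * (s : ℂ)‖ = s := by
        rw [norm_mul, Complex.norm_exp_ofReal_mul_I, one_mul, Complex.norm_real, Real.norm_of_nonneg hs.1.le]
      have e2 := norm_sub_norm_le z (Complex.exp ((ω₀ * t : ℝ) * Complex.I) * (s : ℂ))
      have e3 : ε * s ≤ 1 / 10 * s := mul_le_mul_of_nonneg_right hε hs.1.le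
      linarith
    -- In the window `|ω₀ t - 2π| ≤ θ ≤ 1/2`. With `ε ≤ 1/10` this leaves `Re z ≥ (7/10) s`, and the
    -- velocity of `u` is at least `ω₀ s (7/10 - 11/100) > 0`.
    have hcos : 7 / 8 ≤ Real.cos (ω₀ * t) := by
      rw [← Real.cos_sub_two_pi]
      refine le_trans ?_ (Real.one_sub_sq_div_two_le_cos)
      have e1 := (div_le_iff₀ hω).1 ht.1
      have e2 := (le_div_iff₀ hω).1 ht.2
      nlinarith
    have hre : 7 / 10 * s ≤ z.re := by
      have e1 := (Complex.abs_re_le_norm _).trans h2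
      have e2 : (z - Complex.exp ((ω₀ * t : ℝ) * Complex.I) * s).re = z.re - Real.cos (ω₀ * t) * s := by
        rw [Complex.sub_re, Complex.re_mul_ofReal, Complex.exp_ofReal_mul_I_re]
      rw [e2] at e1
      have e3 := (abs_le.1 e1).1
      have e4 : ε * s ≤ 1 / 10 * s := mul_le_mul_of_nonneg_right hε hs.1.le
      nlinarith [hs.1]
    refine ⟨h2, ?_, by linarith [hs.1], (Complex.re_le_norm z).trans hnorm⟩
    have e1 := (Complex.abs_im_le_norm _).trans h3
    have e2 : (m (X (φ t (c s))) - (ω₀ * Complex.I) * z).im = u (X (φ t (c s))) - ω₀ * z.re := by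
      simp [hu']
    rw [e2] at e1
    have e3 := (abs_le.1 e1).1
    have e4 : ω₀ * (7 / 10 * s) ≤ ω₀ * z.re := by gcongr
    have e5 : ω₀ / 10 * ‖z‖ ≤ ω₀ / 10 * (11 / 10 * s) := by gcongr
    have := mul_pos hω hs.1
    nlinarith
  have hend : ∀ s ∈ Set.Ioc 0 ‖w‖, ∀ t ∈ Set.Icc ((2 * Real.pi - θ) / ω₀) ((2 * Real.pi + θ) / ω₀),
      |u (φ t (c s) - p) - Real.sin (ω₀ * t) * s| ≤ ε * s := fun s hs t ht => by
    have e1 := (Complex.abs_im_le_norm _).trans ((hg s hs).2 t ht).1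
    rwa [Complex.sub_im, Complex.im_mul_ofReal, Complex.exp_ofReal_mul_I_im] at e1
  have hab : (2 * Real.pi - θ) / ω₀ ≤ (2 * Real.pi + θ) / ω₀ := by gcongr; linarith
  have key := h.exists_fixed_return (c := c) (u := fun y => u (y - p)) (v := fun y => (m (y - p)).re)
    (a := (2 * Real.pi - θ) / ω₀) (b := (2 * Real.pi + θ) / ω₀) (δ := ‖w‖) (M := 11 / 10)
    hab (by fun_prop)
    (fun s hs => (hg s hs).1) (fun s hs hsp => ?_) (by fun_prop)
    (Complex.continuous_re.comp (m.continuous.comp (by fun_prop))) (fun r => ?_)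
    (fun s hs => h.strictMonoOn_comp_flow (hg s hs).1 u (convex_Icc _ _) fun t ht => ((hg s hs).2 t ht).2.1)
    (fun s hs => ?_) (fun s hs => ?_) (fun s hs t ht h0 => ?_) (s₀ := ‖w‖) ⟨hr0, le_rfl⟩
  · rw [hcx] at key
    have hxV : x ∈ V := hcx ▸ (hg ‖w‖ ⟨hr0, le_rfl⟩).1
    rcases key with ⟨t, ht⟩ | ⟨s, hs, t, ht, h1, t', h2⟩
    -- The end of the section is `p` itself, which no other orbit reaches.
    · exact absurd (by simpa [c] using ht) (h.ne_center x hxV hxp t)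
    · refine (h.period_le hxV hxp (lt_of_lt_of_le (div_pos (by linarith) hω) ht.1) ?_).trans ht.2
      rw [← h.flow_eq_iff hxV t']
      simpa only [h2] using h1
  · have := hcn s hs.1
    rw [hsp] at this
    simp at this
    exact hs.1.ne this
  · rw [hm, hℓc, mul_assoc, hee]; simp
  · have e1 := hend s hs _ ⟨le_rfl, hab⟩
    rw [mul_div_cancel₀ _ hω.ne', Real.sin_two_pi_sub] at e1
    have := (abs_le.1 e1).2
    have e2 := mul_lt_mul_of_pos_right hεθ hs.1
    linarith
  · have e1 := hend s hs _ ⟨hab, le_rfl⟩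
    rw [mul_div_cancel₀ _ hω.ne', show Real.sin (2 * Real.pi + θ) = Real.sin θ by
      rw [add_comm, Real.sin_add_two_pi]] at e1
    have := (abs_le.1 e1).1
    have e2 := mul_lt_mul_of_pos_right hεθ hs.1
    linarith
  · obtain ⟨h1, -, h3, h4⟩ := (hg s hs).2 t ht
    refine ⟨_, h3, h4, ?_⟩
    have e1 : m (φ t (c s) - p) = ((m (φ t (c s) - p)).re : ℂ) :=
      Complex.ext (by simp) (by simpa [hu'] using h0)
    have e2 : ℓ (φ t (c s) - p) = ℓ (c (m (φ t (c s) - p)).re - p) := by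
      rw [hℓc, ← e1, hm, mul_assoc, mul_comm _ e, hee, mul_one]
    simpa using ℓ.injective e2

/-- A shorter period has a multiple in the upper half of `[0, (2π - θ) / ω₀]`, where `|1 - exp(iω₀
t)| ≥ 1 - cos θ > ε` contradicts closeness to the rotation. -/
theorem le_period_of_rotation (h : IsPeriodicFlow φ X V p T) {ω₀ : ℝ} (hω : 0 < ω₀)
    {ℓ : Plane ≃L[ℝ] ℂ} {θ ε : ℝ} (hθ : 0 < θ) (hθ2 : θ ≤ 1 / 2)
    (hεθ : ε < 1 - Real.cos θ) {x : Plane} (hxV : x ∈ V) (hxp : x ≠ p)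
    (hgood : ∀ t ∈ Set.Icc 0 (2 * (2 * Real.pi / ω₀)),
        ‖ℓ (φ t x - p) - Complex.exp ((ω₀ * t : ℝ) * Complex.I) * ℓ (x - p)‖ ≤ ε * ‖ℓ (x - p)‖) :
    (2 * Real.pi - θ) / ω₀ ≤ T x := by
  have hπ := Real.pi_gt_three
  have hw0 : ℓ (x - p) ≠ 0 := by simpa [sub_eq_zero] using hxp
  have hr0 : 0 < ‖ℓ (x - p)‖ := norm_pos_iff.2 hw0
  by_contra! hlt
  obtain ⟨t, ht, htx⟩ : ∃ t ∈ Set.Icc ((2 * Real.pi - θ) / ω₀ / 2) ((2 * Real.pi - θ) / ω₀),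
      φ t x = x := by
    by_cases h1 : T x < (2 * Real.pi - θ) / ω₀ / 2
    · obtain ⟨t, ht, htx⟩ := h.exists_flow_eq_of_period_lt hxV (h.period_pos hxV hxp)
        (h.flow_period hxV hxp) h1
      exact ⟨t, ⟨ht.1, ht.2.trans (by linarith)⟩, htx⟩
    · exact ⟨T x, ⟨not_lt.1 h1, hlt.le⟩, h.flow_period hxV hxp⟩
  have e0 : 0 < (2 * Real.pi - θ) / ω₀ := div_pos (by linarith) hω
  have h1 := hgood t ⟨by linarith [ht.1], ht.2.trans (by
    rw [← mul_div_assoc]; gcongr; linarith)⟩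
  rw [htx, ← one_sub_mul, norm_mul] at h1
  have h2 := (Complex.re_le_norm _).trans (le_of_mul_le_mul_right h1 hr0)
  rw [Complex.sub_re, Complex.exp_ofReal_mul_I_re, Complex.one_re] at h2
  have h3 : Real.cos (ω₀ * t) ≤ Real.cos θ := by
    rw [← Real.cos_two_pi_sub]
    have e1 := (le_div_iff₀ hω).1 ht.2
    have e2 := (div_le_iff₀ hω).1 (by rw [div_right_comm]; exact ht.1 : (2 * Real.pi - θ) / 2 / ω₀ ≤ t)
    rcases le_total (2 * Real.pi - ω₀ * t) Real.pi with h4 | h4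
    · exact Real.cos_le_cos_of_nonneg_of_le_pi hθ.le h4 (by linarith)
    · refine (Real.cos_nonpos_of_pi_div_two_le_of_le (by linarith) (by linarith)).trans
        (Real.cos_nonneg_of_neg_pi_div_two_le_of_le (by linarith) (by linarith))
  linarith

/-- The period function of a nondegenerate center is continuous at the center. -/
theorem tendsto_period_center (h : IsPeriodicFlow φ X V p T) {ω₀ : ℝ} (hω : 0 < ω₀)
    {ℓ : Plane ≃L[ℝ] ℂ} (hℓ : ∀ v, ℓ (fderiv ℝ X p v) = (ω₀ * Complex.I) * ℓ v) :
    Tendsto T (𝓝[≠] p) (𝓝 (2 * Real.pi / ω₀)) := by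
  have hπ := Real.pi_gt_three
  refine Metric.tendsto_nhds.2 fun η hη => ?_
  set θ := min (1 / 2) (ω₀ * η / 2) with hθd
  have hθ : 0 < θ := by positivity
  have hθ2 : θ ≤ 1 / 2 := min_le_left _ _
  have hsin : 0 < Real.sin θ := Real.sin_pos_of_pos_of_lt_pi hθ (by linarith)
  have hcos : 0 < 1 - Real.cos θ := by
    have := Real.cos_lt_cos_of_nonneg_of_le_pi le_rfl (by linarith : θ ≤ Real.pi) hθ
    rw [Real.cos_zero] at this
    linarith
  set ε := min (1 / 10) (min (Real.sin θ / 2) ((1 - Real.cos θ) / 2)) with hεd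
  have hε : 0 < ε := by positivity
  have hε1 : ε < Real.sin θ := lt_of_le_of_lt ((min_le_right _ _).trans (min_le_left _ _)) (by linarith)
  have hε2 : ε < 1 - Real.cos θ :=
    lt_of_le_of_lt ((min_le_right _ _).trans (min_le_right _ _)) (by linarith)
  have hτ : 0 < 2 * (2 * Real.pi / ω₀) := by positivity
  have h1 := ((h.eventually_norm_flow_sub_le hℓ hτ hε).and
    (h.eventually_norm_field_sub_le hℓ hτ (by positivity : 0 < ω₀ / 10))).and
    (h.flow.isOpen.mem_nhds h.mem_center)
  have h2 : Tendsto (fun z => p + ℓ.symm z) (𝓝 0) (𝓝 p) := by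
    have : Continuous fun z => p + ℓ.symm z := by fun_prop
    simpa using this.tendsto 0
  obtain ⟨ρ, hρ, h3⟩ := Metric.eventually_nhds_iff.1 (h2.eventually h1)
  have h4 : ∀ᶠ x in 𝓝 p, ‖ℓ (x - p)‖ < ρ := by
    have : Continuous fun x => ‖ℓ (x - p)‖ := by fun_prop
    exact this.continuousAt.eventually_lt_const (by simpa using hρ)
  filter_upwards [h4.filter_mono nhdsWithin_le_nhds, self_mem_nhdsWithin] with x hx hxp
  have hgood : ∀ y, 0 < ‖ℓ (y - p)‖ → ‖ℓ (y - p)‖ ≤ ‖ℓ (x - p)‖ → y ∈ V ∧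
      ∀ t ∈ Set.Icc 0 (2 * (2 * Real.pi / ω₀)),
        ‖ℓ (φ t y - p) - Complex.exp ((ω₀ * t : ℝ) * Complex.I) * ℓ (y - p)‖ ≤ ε * ‖ℓ (y - p)‖ ∧
        ‖ℓ (X (φ t y)) - (ω₀ * Complex.I) * ℓ (φ t y - p)‖ ≤ ω₀ / 10 * ‖ℓ (φ t y - p)‖ := by
    intro y _ hy
    have h5 := @h3 (ℓ (y - p)) (by simpa using hy.trans_lt hx)
    simp only [ContinuousLinearEquiv.symm_apply_apply, add_sub_cancel] at h5
    exact ⟨h5.2, fun t ht => ⟨h5.1.1 t ht, h5.1.2 t ht⟩⟩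
  have hx0 : 0 < ‖ℓ (x - p)‖ := norm_pos_iff.2 (by simpa [sub_eq_zero] using hxp)
  have h5 := hgood x hx0 le_rfl
  have h6 := h.period_le_of_rotation hω hθ hθ2 (min_le_left _ _) hε1 hxp hgood
  have h7 := h.le_period_of_rotation hω hθ hθ2 hε2 h5.1 hxp fun t ht => (h5.2 t ht).1
  rw [Real.dist_eq, abs_lt]
  have h8 : θ / ω₀ < η := by
    rw [div_lt_iff₀ hω]
    have := min_le_right (1 / 2) (ω₀ * η / 2)
    nlinarith
  rw [add_div] at h6
  rw [sub_div] at h7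
  constructor <;> linarith

end IsPeriodicFlow

/-! ### Division by the complex coordinate through disc averages -/

section CircleQuotient

open MeasureTheory ContinuousMap

/-- Integration of continuous maps on a compact space as a continuous linear map. -/
noncomputable def ContinuousMap.integralCLM {K : Type*} [TopologicalSpace K] [CompactSpace K]
    [MeasurableSpace K] [OpensMeasurableSpace K] [SecondCountableTopology K] (μ : Measure K)
    [IsFiniteMeasure μ] : C(K, ℂ) →L[ℝ] ℂ :=
  LinearMap.mkContinuous
    { toFun := fun v => ∫ x, v x ∂μ
      map_add' := fun v w => integral_add
        (v.continuous.integrable_of_hasCompactSupport (HasCompactSupport.of_compactSpace _))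
        (w.continuous.integrable_of_hasCompactSupport (HasCompactSupport.of_compactSpace _))
      map_smul' := fun c v => by simp [integral_const_mul] } (μ.real Set.univ) fun v => by
    rw [mul_comm]
    exact norm_integral_le_of_norm_le_const (ae_of_all _ v.norm_coe_le_norm)

/-- The unit circle, parametrized by the unit interval. -/
noncomputable def circleExp (α : ℝ) : ℂ := Complex.exp ((2 * Real.pi * α : ℝ) * Complex.I)

theorem hasDerivAt_circleExp (α : ℝ) :
    HasDerivAt circleExp (circleExp α * (2 * Real.pi * Complex.I)) α := by
  have h1 : HasDerivAt (fun α : ℝ => ((2 * Real.pi * α : ℝ) : ℂ) * Complex.I)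
      (2 * Real.pi * Complex.I) α := by
    have := ((hasDerivAt_id α).const_mul (2 * Real.pi)).ofReal_comp.mul_const Complex.I
    simpa using this
  exact h1.cexp

theorem differentiable_circleExp : Differentiable ℝ circleExp := fun α =>
  (hasDerivAt_circleExp α).differentiableAt

@[fun_prop]
theorem continuous_circleExp : Continuous circleExp := differentiable_circleExp.continuous

@[simp] theorem circleExp_zero : circleExp 0 = 1 := by simp [circleExp]

@[simp] theorem circleExp_one : circleExp 1 = 1 := by simp [circleExp, Complex.exp_two_pi_mul_I]

@[simp] theorem norm_circleExp (α : ℝ) : ‖circleExp α‖ = 1 := Complex.norm_exp_ofReal_mul_I _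

theorem circleExp_add (α β : ℝ) : circleExp (α + β) = circleExp α * circleExp β := by
  rw [circleExp, circleExp, circleExp, ← Complex.exp_add]
  congr 1
  push_cast
  ring

@[simp] theorem circleExp_neg_mul (α : ℝ) : circleExp (-α) * circleExp α = 1 := by
  rw [← circleExp_add, neg_add_cancel, circleExp_zero]

/-- The Wirtinger operator `B ↦ B 1 - i B i` in the second variable. -/
noncomputable def wirtinger : (ℝ × ℂ →L[ℝ] ℂ) →L[ℝ] ℂ :=
  ContinuousLinearMap.apply ℝ ℂ (0, 1) -
    (ContinuousLinearMap.mul ℝ ℂ Complex.I) ∘L ContinuousLinearMap.apply ℝ ℂ (0, Complex.I)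

theorem wirtinger_apply (B : ℝ × ℂ →L[ℝ] ℂ) :
    wirtinger B = B (0, 1) - Complex.I * B (0, Complex.I) := rfl

/-- The combination cancels the antilinear part of `B` in the second variable and doubles the
complex linear part. -/
theorem apply_sub_I_mul_apply (B : ℝ × ℂ →L[ℝ] ℂ) (z : ℂ) :
    B (0, z) - Complex.I * B (0, Complex.I * z) = z * wirtinger B := by
  have h1 : ∀ a b : ℝ, B (0, a + b * Complex.I) = a * B (0, 1) + b * B (0, Complex.I) := fun a b => by
    have e : ((0 : ℝ), (a : ℂ) + b * Complex.I) = a • ((0 : ℝ), (1 : ℂ)) + b • ((0 : ℝ), Complex.I) := by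
      simp
    rw [e, map_add, map_smul, map_smul, Complex.real_smul, Complex.real_smul]
  obtain ⟨a, b, rfl⟩ : ∃ a b : ℝ, z = a + b * Complex.I :=
    ⟨z.re, z.im, (Complex.re_add_im z).symm⟩
  have h2 : Complex.I * (a + b * Complex.I) = ((-b : ℝ) : ℂ) + a * Complex.I := by
    push_cast
    linear_combination (b : ℂ) * Complex.I_sq
  rw [h2, h1, h1, wirtinger_apply]
  push_cast
  linear_combination ((b : ℂ) * B (0, Complex.I)) * Complex.I_sq

/-- The divergence theorem in polar coordinates: the integral of `∂K/∂w` over the disc is a boundary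
integral of `K`, which vanishes on the circle. -/
theorem mul_integral_wirtinger_eq_zero {K : ℝ × ℂ → ℂ} {z : ℝ × ℂ}
    (hK : ∀ x : ℝ × ℝ, x ∈ Set.Icc ((0, 0) : ℝ × ℝ) (1, 1) →
      ContDiffAt ℝ 1 K (z.1, circleExp x.2 * x.1 * z.2))
    (h0 : ∀ w, ‖w‖ = ‖z.2‖ → K (z.1, w) = 0) :
    z.2 * ∫ x in Set.Icc ((0, 0) : ℝ × ℝ) (1, 1),
      (x.1 : ℂ) * wirtinger (fderiv ℝ K (z.1, circleExp x.2 * x.1 * z.2)) = 0 := by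
  obtain ⟨τ, w⟩ := z
  let P : ℝ × ℝ → ℝ × ℂ := fun x => (τ, circleExp x.2 * x.1 * w)
  let k : ℝ × ℝ → ℂ := fun x => circleExp (-x.2) * K (P x)
  have hPd : Differentiable ℝ P := by
    have := differentiable_circleExp
    have h2 : Differentiable ℝ fun x : ℝ × ℝ => circleExp x.2 := this.comp differentiable_snd
    have h3 : Differentiable ℝ fun x : ℝ × ℝ => (x.1 : ℂ) :=
      Complex.ofRealCLM.differentiable.comp differentiable_fst
    exact (differentiable_const τ).prodMk ((h2.mul h3).mul_const w)
  have hPc := hPd.continuous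
  have hkd : ∀ x ∈ Set.Icc ((0, 0) : ℝ × ℝ) (1, 1), DifferentiableAt ℝ k x := fun x hx => by
    have h1 : DifferentiableAt ℝ (fun x => K (P x)) x :=
      ((hK x hx).differentiableAt one_ne_zero).comp x (hPd x)
    have h2 : DifferentiableAt ℝ (fun x : ℝ × ℝ => circleExp (-x.2)) x :=
      DifferentiableAt.comp (g := circleExp) (f := fun x : ℝ × ℝ => -x.2) x
        (differentiable_circleExp (-x.2)) (by fun_prop)
    exact h2.mul h1
  have hk1 : ∀ x ∈ Set.Icc ((0, 0) : ℝ × ℝ) (1, 1), fderiv ℝ k x (1, 0) =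
      circleExp (-x.2) * fderiv ℝ K (P x) (0, circleExp x.2 * w) := fun x hx => by
    have h1 := (hkd x hx).hasFDerivAt.comp_hasDerivAt x.1
      ((hasDerivAt_id x.1).prodMk (hasDerivAt_const x.1 x.2))
    have h2 : HasDerivAt (fun s : ℝ => P (s, x.2)) (0, circleExp x.2 * w) x.1 := by
      refine (hasDerivAt_const _ _).prodMk ?_
      simpa using ((hasDerivAt_id x.1).ofReal_comp.const_mul (circleExp x.2)).mul_const w
    have h3 := (((hK x hx).differentiableAt one_ne_zero).hasFDerivAt.comp_hasDerivAt x.1 h2).const_mul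
      (circleExp (-x.2))
    exact h1.unique h3
  have hk2 : ∀ x ∈ Set.Icc ((0, 0) : ℝ × ℝ) (1, 1), fderiv ℝ k x (0, 1) =
      2 * Real.pi * Complex.I * (-k x) + circleExp (-x.2) * ((2 * Real.pi * x.1 : ℝ) *
        fderiv ℝ K (P x) (0, Complex.I * (circleExp x.2 * w))) := fun x hx => by
    have h1 := (hkd x hx).hasFDerivAt.comp_hasDerivAt x.2
      ((hasDerivAt_const x.2 x.1).prodMk (hasDerivAt_id' x.2))
    have h2 : HasDerivAt (fun s : ℝ => P (x.1, s))
        ((2 * Real.pi * x.1 : ℝ) • (0, Complex.I * (circleExp x.2 * w))) x.2 := by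
      have := (hasDerivAt_const x.2 τ).prodMk
        (((hasDerivAt_circleExp x.2).mul_const (x.1 : ℂ)).mul_const w)
      refine this.congr_deriv ?_
      ext1
      · simp
      · simp only [Prod.smul_mk, Complex.real_smul]
        push_cast
        ring
    have h3 : HasDerivAt (fun s => K (P (x.1, s))) (fderiv ℝ K (P x) _) x.2 :=
      ((hK x hx).differentiableAt one_ne_zero).hasFDerivAt.comp_hasDerivAt x.2 h2
    have h4 : HasDerivAt (fun s : ℝ => circleExp (-s))
        (-(circleExp (-x.2) * (2 * Real.pi * Complex.I))) x.2 :=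
      ((hasDerivAt_circleExp (-x.2)).scomp x.2 (hasDerivAt_neg x.2)).congr_deriv (by simp)
    rw [h1.unique (h4.mul h3), map_smul, Complex.real_smul]
    simp only [k]
    ring
  have hc : (2 * Real.pi * Complex.I : ℂ) ≠ 0 := by
    simp [Real.pi_ne_zero]
  have hdiv : ∀ x ∈ Set.Icc ((0, 0) : ℝ × ℝ) (1, 1),
      (x.1 • fderiv ℝ k x + (ContinuousLinearMap.fst ℝ ℝ ℝ).smulRight (k x)) (1, 0) +
        ((2 * Real.pi * Complex.I : ℂ)⁻¹ • fderiv ℝ k x) (0, 1) =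
      w * ((x.1 : ℂ) * wirtinger (fderiv ℝ K (P x))) := fun x hx => by
    have h1 := apply_sub_I_mul_apply (fderiv ℝ K (P x)) (circleExp x.2 * w)
    have h2 := circleExp_neg_mul x.2
    simp only [_root_.add_apply, _root_.smul_apply,
      ContinuousLinearMap.smulRight_apply, ContinuousLinearMap.coe_fst', one_smul]
    rw [hk1 x hx, hk2 x hx, Complex.real_smul, smul_eq_mul]
    have h3 : (2 * Real.pi * Complex.I : ℂ)⁻¹ * (2 * Real.pi * Complex.I) = 1 := inv_mul_cancel₀ hc
    have h4 : (2 * Real.pi * Complex.I : ℂ)⁻¹ * (2 * Real.pi * x.1 : ℝ) = -Complex.I * x.1 := by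
      push_cast
      field_simp
      simp
    linear_combination (-k x) * h3 + (circleExp (-x.2) *
      fderiv ℝ K (P x) (0, Complex.I * (circleExp x.2 * w))) * h4 +
      (x.1 * circleExp (-x.2)) * h1 + (x.1 * w * wirtinger (fderiv ℝ K (P x))) * h2
  have hcont : ContinuousOn (fun x : ℝ × ℝ => w * ((x.1 : ℂ) * wirtinger (fderiv ℝ K (P x))))
      (Set.Icc ((0, 0) : ℝ × ℝ) (1, 1)) := fun x hx => by
    have h1 : ContinuousAt (fderiv ℝ K) (P x) :=
      ((hK x hx).fderiv_right (m := 0) (by simp)).continuousAt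
    have h2 : ContinuousAt (fun x => wirtinger (fderiv ℝ K (P x))) x :=
      wirtinger.continuous.continuousAt.comp (h1.comp hPc.continuousAt)
    have h3 : ContinuousAt (fun x : ℝ × ℝ => (x.1 : ℂ)) x := by fun_prop
    exact (continuousAt_const.mul (h3.mul h2)).continuousWithinAt
  have hint := hcont.integrableOn_compact isCompact_Icc (μ := volume)
  have hsub : Set.Ioo (0 : ℝ) 1 ×ˢ Set.Ioo (0 : ℝ) 1 ⊆ Set.Icc ((0, 0) : ℝ × ℝ) (1, 1) :=
    fun x hx => ⟨⟨hx.1.1.le, hx.2.1.le⟩, ⟨hx.1.2.le, hx.2.2.le⟩⟩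
  -- With radius `r = x.1` and angle `α = x.2`, the field is `(r k, k / (2πi))`. Its flux is zero at
  -- `r = 0` by the factor `r` and at `r = 1` since `K` vanishes there; the sides `α = 0` and `α =
  -- 1` cancel by periodicity.
  have key := integral_divergence_prod_Icc_of_hasFDerivAt_of_le (fun x : ℝ × ℝ => x.1 • k x)
    (fun x => (2 * Real.pi * Complex.I : ℂ)⁻¹ • k x)
    (fun x => x.1 • fderiv ℝ k x + (ContinuousLinearMap.fst ℝ ℝ ℝ).smulRight (k x))
    (fun x => (2 * Real.pi * Complex.I : ℂ)⁻¹ • fderiv ℝ k x) (0, 0) (1, 1) (by simp)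
    (fun x hx => (continuousAt_fst.smul (hkd x hx).continuousAt).continuousWithinAt)
    (fun x hx => ((hkd x hx).hasFDerivAt.fun_const_smul _).continuousAt.continuousWithinAt)
    (fun x hx => hasFDerivAt_fst.smul (hkd x (hsub hx)).hasFDerivAt)
    (fun x hx => (hkd x (hsub hx)).hasFDerivAt.fun_const_smul _)
    (hint.congr_fun (fun x hx => (hdiv x hx).symm) measurableSet_Icc)
  rw [setIntegral_congr_fun measurableSet_Icc hdiv, integral_const_mul] at key
  rw [key]
  have e1 : ∀ s : ℝ, k (s, 1) = k (s, 0) := fun s => by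
    have : circleExp (-1) = 1 := by simpa using circleExp_neg_mul 1
    simp [k, P, this]
  have e2 : ∀ α : ℝ, k (1, α) = 0 := fun α => by simp [k, P, h0]
  simp [e1, e2]

/-- Averaging the Wirtinger derivative over discs divides a function which vanishes on a circle
around `0` by the coordinate, without further loss of differentiability. -/
theorem exists_circle_quotient {K : ℝ × ℂ → ℂ} {τ₀ : ℝ} {n m : WithTop ℕ∞} (hmn : m + 1 ≤ n)
    (hK : ContDiffAt ℝ n K (τ₀, 0)) :
    ∃ g : ℝ × ℂ → ℂ, ContDiffAt ℝ m g (τ₀, 0) ∧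
      (∀ᶠ z in 𝓝 (τ₀, (0 : ℂ)), z.2 ≠ 0 → (∀ w, ‖w‖ = ‖z.2‖ → K (z.1, w) = 0) → g z = 0) ∧
      ∀ᶠ τ in 𝓝 τ₀, ∀ c : ℂ, (∀ v, fderiv ℝ K (τ, 0) (0, v) = c * v) → g (τ, 0) = c := by
  let Q : Set (ℝ × ℝ) := Set.Icc (0, 0) (1, 1)
  have : CompactSpace Q := isCompact_iff_compactSpace.1 isCompact_Icc
  let μ : Measure Q := Measure.comap Subtype.val volume
  have : IsFiniteMeasure μ := ⟨by
    rw [comap_subtype_coe_apply measurableSet_Icc]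
    rw [Set.image_univ, Subtype.range_coe]
    exact isCompact_Icc.measure_lt_top⟩
  let P : ℝ × ℂ →ₗ[ℝ] C(Q, ℝ × ℂ) :=
    { toFun := fun z => ⟨fun x => (z.1, circleExp x.1.2 * x.1.1 * z.2), by fun_prop⟩
      map_add' := fun z w => by ext x <;> simp [mul_add]
      map_smul' := fun c z => by ext x <;> simp [mul_left_comm] }
  let wt : C(Q, ℂ) := ⟨fun x => (x.1.1 : ℂ), by fun_prop⟩
  let f : ℝ × ℂ → ℂ := fun z => wirtinger (fderiv ℝ K z)
  have hf : ContDiffAt ℝ m f (τ₀, 0) :=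
    wirtinger.contDiff.contDiffAt.comp _ (hK.fderiv_right hmn)
  -- The average of `∂K/∂w` over the disc of radius `|z.2|`. One derivative is spent on `K`;
  -- superposition and integration cost none, in the analytic case as well.
  let g : ℝ × ℂ → ℂ := fun z => integralCLM μ
    (wt * superposition Q f (P z))
  have hP0 : ∀ x : Q, P (τ₀, 0) x = (τ₀, 0) := fun x => by simp [P]
  have hg : ContDiffAt ℝ m g (τ₀, 0) := by
    have h1 : ContDiffAt ℝ m (fun z => superposition Q f (P z)) (τ₀, 0) :=
      (contDiffAt_superposition (f := f) (v := P (τ₀, 0)) fun t => by rw [hP0]; exact hf).comp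
        (τ₀, (0 : ℂ)) (LinearMap.toContinuousLinearMap P).contDiff.contDiffAt
    exact ((integralCLM μ) ∘L
      (ContinuousLinearMap.mul ℝ C(Q, ℂ) wt)).contDiff.contDiffAt.comp _ h1
  have hn : (1 : WithTop ℕ∞) ≤ n := le_trans (by simp) hmn
  have hK1 : ∀ᶠ z in 𝓝 (τ₀, (0 : ℂ)), ContDiffAt ℝ 1 K z := (hK.of_le hn).eventually (by simp)
  have hev : ∀ᶠ z in 𝓝 (τ₀, (0 : ℂ)), ∀ x ∈ Q,
      ContDiffAt ℝ 1 K (z.1, circleExp x.2 * x.1 * z.2) := by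
    have h1 := ((LinearMap.toContinuousLinearMap P).continuous.tendsto (τ₀, 0)).eventually
      (eventually_forall_apply (P (τ₀, 0)) (Q := ContDiffAt ℝ 1 K) fun t => by rw [hP0]; exact hK1)
    filter_upwards [h1] with z hz x hx
    exact hz ⟨x, hx⟩
  have hgz : ∀ z : ℝ × ℂ, (∀ x ∈ Q, ContDiffAt ℝ 1 K (z.1, circleExp x.2 * x.1 * z.2)) →
      g z = ∫ x in Q, (x.1 : ℂ) * wirtinger (fderiv ℝ K (z.1, circleExp x.2 * x.1 * z.2)) := by
    intro z hz
    have h1 : ∀ x : Q, superposition Q f (P z) x = f (P z x) := superposition_apply fun x => by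
      have h2 : ContinuousAt (fderiv ℝ K) (P z x) :=
        ((hz x x.2).fderiv_right (m := 0) (by simp)).continuousAt
      exact wirtinger.continuous.continuousAt.comp h2
    change ∫ x, wt x * superposition Q f (P z) x ∂μ = _
    simp only [h1]
    exact integral_subtype_comap measurableSet_Icc
      fun x : ℝ × ℝ => (x.1 : ℂ) * wirtinger (fderiv ℝ K (z.1, circleExp x.2 * x.1 * z.2))
  refine ⟨g, hg, ?_, ?_⟩
  · filter_upwards [hev] with z hz hz0 h0
    rw [hgz z hz]
    exact (mul_eq_zero.1 (mul_integral_wirtinger_eq_zero hz h0)).resolve_left hz0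
  · have h1 : Tendsto (fun τ : ℝ => (τ, (0 : ℂ))) (𝓝 τ₀) (𝓝 (τ₀, 0)) :=
      (Continuous.prodMk_left (0 : ℂ)).tendsto τ₀
    filter_upwards [h1.eventually hev] with τ hτ c hc
    rw [hgz _ hτ]
    simp only [mul_zero, wirtinger_apply, hc]
    -- The factor `2` is compensated by the mean `1/2` of the weight `r`.
    have e1 : c * 1 - Complex.I * (c * Complex.I) = 2 * c := by
      linear_combination (-c) * Complex.I_sq
    rw [e1, integral_mul_const]
    have e2 : ∫ x in Q, (x.1 : ℂ) = 1 / 2 := by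
      have h2 := setIntegral_prod_mul (μ := (volume : Measure ℝ)) (ν := (volume : Measure ℝ))
        (fun s : ℝ => (s : ℂ)) (fun _ => (1 : ℂ)) (Set.Icc 0 1) (Set.Icc 0 1)
      rw [Set.Icc_prod_Icc] at h2
      simp only [mul_one] at h2
      refine h2.trans ?_
      rw [integral_complex_ofReal, integral_Icc_eq_integral_Ioc, ← intervalIntegral.integral_of_le zero_le_one,
        integral_id]
      simp
    rw [e2]
    ring

end CircleQuotient

/-! ### The first Fourier coefficient -/

section FourierMean

open MeasureTheory ContinuousMap PlanarCenter

/-- The first Fourier coefficient of an arc parametrized by the unit interval, in the complex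
coordinate `ℓ`. -/
noncomputable def fourierMean (ℓ : Plane →L[ℝ] ℂ) : C(unitInterval, Plane) →L[ℝ] ℂ :=
  haveI : IsFiniteMeasure (Measure.comap ((↑) : unitInterval → ℝ) volume) := ⟨by
    rw [comap_subtype_coe_apply measurableSet_Icc, Set.image_univ, Subtype.range_coe]
    exact isCompact_Icc.measure_lt_top⟩
  integralCLM (Measure.comap ((↑) : unitInterval → ℝ) volume) ∘L
    ContinuousLinearMap.mul ℝ C(unitInterval, ℂ) ⟨fun s => circleExp (-s), by fun_prop⟩ ∘L
      ContinuousLinearMap.compLeftContinuous ℝ unitInterval ℓ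

theorem fourierMean_apply {ℓ : Plane →L[ℝ] ℂ} {u : C(unitInterval, Plane)} {f : ℝ → Plane}
    (h : ∀ s : unitInterval, u s = f s) :
    fourierMean ℓ u = ∫ s in (0 : ℝ)..1, circleExp (-s) * ℓ (f s) := by
  rw [intervalIntegral.integral_of_le zero_le_one, ← integral_Icc_eq_integral_Ioc]
  have := integral_subtype_comap (μ := (volume : Measure ℝ)) (measurableSet_Icc (a := (0 : ℝ)) (b := 1))
    fun s => circleExp (-s) * ℓ (f s)
  refine Eq.trans ?_ this
  change ∫ s : unitInterval, circleExp (-(s : ℝ)) * ℓ (u s) ∂_ = _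
  simp only [h]

theorem circleExp_neg_mul_exp (a s : ℝ) :
    circleExp (-s) * Complex.exp ((a * s : ℝ) * Complex.I) =
      Complex.exp (((a - 2 * Real.pi : ℝ) * Complex.I) * s) := by
  rw [circleExp, ← Complex.exp_add]
  congr 1
  push_cast
  ring

/-- The product form includes the resonant value `a = 2π`, where both sides vanish; this is the
point around which it is used. -/
theorem mul_integral_exp (a : ℝ) :
    (∫ s in (0 : ℝ)..1, circleExp (-s) * Complex.exp ((a * s : ℝ) * Complex.I)) *
      ((a - 2 * Real.pi : ℝ) * Complex.I) = Complex.exp (a * Complex.I) - 1 := by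
  simp only [circleExp_neg_mul_exp]
  have h1 : Complex.exp ((a - 2 * Real.pi : ℝ) * Complex.I) = Complex.exp (a * Complex.I) := by
    push_cast
    rw [sub_mul, Complex.exp_sub, Complex.exp_two_pi_mul_I, div_one]
  rw [← h1]
  by_cases hc : ((a - 2 * Real.pi : ℝ) : ℂ) * Complex.I = 0
  · rw [hc]; simp
  · rw [integral_exp_mul_complex hc, div_mul_cancel₀ _ hc]
    simp

theorem exists_circleExp_eq {u : ℂ} (hu : ‖u‖ = 1) : ∃ α ∈ Set.Icc (0 : ℝ) 1, circleExp α = u := by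
  have hπ := Real.pi_pos
  have h1 : circleExp (u.arg / (2 * Real.pi)) = u := by
    rw [circleExp, mul_div_cancel₀ _ (by positivity)]
    simpa [hu] using Complex.norm_mul_exp_arg_mul_I u
  have h2 := Complex.arg_le_pi u
  have h3 := Complex.neg_pi_lt_arg u
  rcases le_total 0 u.arg with h0 | h0
  · refine ⟨_, ⟨by positivity, ?_⟩, h1⟩
    rw [div_le_one (by positivity)]
    linarith
  · refine ⟨u.arg / (2 * Real.pi) + 1, ⟨?_, ?_⟩, by rw [circleExp_add, h1, circleExp_one, mul_one]⟩
    · have : -1 ≤ u.arg / (2 * Real.pi) := by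
        rw [le_div_iff₀ (by positivity)]
        linarith
      linarith
    · have : u.arg / (2 * Real.pi) ≤ 0 := div_nonpos_of_nonpos_of_nonneg h0 (by positivity)
      linarith

theorem integral_circleExp_two_pi :
    ∫ s in (0 : ℝ)..1, circleExp (-s) * Complex.exp ((2 * Real.pi * s : ℝ) * Complex.I) = 1 := by
  simp only [circleExp_neg_mul_exp]
  simp

theorem integral_circleExp_neg : ∫ s in (0 : ℝ)..1, circleExp (-s) = 0 := by
  have h := mul_integral_exp 0
  simpa [Real.pi_ne_zero] using h

end FourierMean

/-! ### The period is of class `C^(k-1)` at the center -/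

namespace IsPeriodicFlow

open PlanarCenter ContinuousMap unitInterval

variable {φ : ℝ → Plane → Plane} {X : Plane → Plane} {V : Set Plane} {p : Plane} {T : Plane → ℝ}

theorem fourierMean_center (h : IsPeriodicFlow φ X V p T) (ℓ : Plane →L[ℝ] ℂ) (τ : ℝ) :
    fourierMean ℓ (orbitPath φ (τ, p)) = 0 := by
  rw [fourierMean_apply (f := fun _ => p) (h.orbitPath_center τ),
    intervalIntegral.integral_mul_const, integral_circleExp_neg, zero_mul]

theorem contDiffAt_fourierMean (h : IsPeriodicFlow φ X V p T) (ℓ : Plane →L[ℝ] ℂ) {n : WithTop ℕ∞}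
    (hn : 1 ≤ n) (hX : ∀ x ∈ V, ContDiffAt ℝ n X x) (τ : ℝ) :
    ContDiffAt ℝ n (fun z => fourierMean ℓ (orbitPath φ z)) (τ, p) :=
  (fourierMean ℓ).contDiff.contDiffAt.comp _
    (h.flow.contDiffAt_orbitPath hX hn (z := (τ, p)) h.mem_center)

theorem fderiv_fourierMean_center (h : IsPeriodicFlow φ X V p T) {ω₀ : ℝ} {ℓ : Plane ≃L[ℝ] ℂ}
    (hℓ : ∀ v, ℓ (fderiv ℝ X p v) = (ω₀ * Complex.I) * ℓ v) (τ : ℝ) (v : Plane) :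
    fderiv ℝ (fun z => fourierMean (ℓ : Plane →L[ℝ] ℂ) (orbitPath φ z)) (τ, p) (0, v) =
      (∫ s in (0 : ℝ)..1, circleExp (-s) * Complex.exp ((ω₀ * τ * s : ℝ) * Complex.I)) * ℓ v := by
  have h1 := ((h.flow.contDiffAt_orbitPath h.contDiffAt le_rfl (z := (τ, p))
    h.mem_center).differentiableAt one_ne_zero).hasFDerivAt
  have h2 : HasFDerivAt (fun z => fourierMean (ℓ : Plane →L[ℝ] ℂ) (orbitPath φ z)) _ (τ, p) :=
    (fourierMean (ℓ : Plane →L[ℝ] ℂ)).hasFDerivAt.comp _ h1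
  rw [h2.fderiv, ContinuousLinearMap.comp_apply,
    fourierMean_apply (f := fun s => ℓ.symm (Complex.exp ((ω₀ * (s * τ) : ℝ) * Complex.I) * ℓ v))
      fun s => by rw [← h.fderiv_orbitPath_center hℓ, ContinuousLinearEquiv.symm_apply_apply],
    ← intervalIntegral.integral_mul_const]
  simp only [ContinuousLinearEquiv.coe_coe, ContinuousLinearEquiv.apply_symm_apply, mul_assoc,
    mul_comm τ]

/-- At `τ = 2π/ω₀` the linearized arc is one full turn, with first Fourier coefficient exactly `ℓ
v`. Hence `(τ, W)` are local coordinates near `(2π/ω₀, p)`. -/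
theorem hasFDerivAt_fourierMean_center (h : IsPeriodicFlow φ X V p T) {ω₀ : ℝ} (hω : 0 < ω₀)
    {ℓ : Plane ≃L[ℝ] ℂ} (hℓ : ∀ v, ℓ (fderiv ℝ X p v) = (ω₀ * Complex.I) * ℓ v) :
    HasFDerivAt (fun z => (z.1, fourierMean (ℓ : Plane →L[ℝ] ℂ) (orbitPath φ z)))
      (((ContinuousLinearEquiv.refl ℝ ℝ).prodCongr ℓ : (ℝ × Plane) ≃L[ℝ] (ℝ × ℂ)) :
        (ℝ × Plane) →L[ℝ] (ℝ × ℂ)) (2 * Real.pi / ω₀, p) := by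
  have h1 := ((h.contDiffAt_fourierMean (ℓ : Plane →L[ℝ] ℂ) le_rfl h.contDiffAt
    (2 * Real.pi / ω₀)).differentiableAt one_ne_zero).hasFDerivAt
  refine (hasFDerivAt_fst.prodMk h1).congr_fderiv ?_
  have h2 : ∀ r, fderiv ℝ (fun z => fourierMean (ℓ : Plane →L[ℝ] ℂ) (orbitPath φ z))
      (2 * Real.pi / ω₀, p) (r, 0) = 0 := fun r => by
    have h3 := h1.comp (2 * Real.pi / ω₀) (hasFDerivAt_prodMk_left (𝕜 := ℝ) (2 * Real.pi / ω₀) p)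
    have h4 : ((fun z => fourierMean (ℓ : Plane →L[ℝ] ℂ) (orbitPath φ z)) ∘ fun τ : ℝ => (τ, p)) =
      fun _ => 0 := funext fun τ => h.fourierMean_center _ τ
    rw [h4] at h3
    simpa using congrArg (fun L => L r) (h3.unique (hasFDerivAt_const 0 _))
  refine ContinuousLinearMap.ext fun z => ?_
  have h3 : z = (z.1, 0) + (0, z.2) := by simp
  refine Prod.ext rfl ?_
  change fderiv ℝ (fun z => fourierMean (ℓ : Plane →L[ℝ] ℂ) (orbitPath φ z))
    (2 * Real.pi / ω₀, p) z = ℓ z.2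
  conv_lhs => rw [h3]
  rw [map_add, h2, zero_add, h.fderiv_fourierMean_center hℓ, mul_div_cancel₀ _ hω.ne']
  rw [integral_circleExp_two_pi, one_mul]

/-- The first Fourier coefficient turns the time shift along a periodic orbit into a rotation. -/
theorem fourierMean_flow (h : IsPeriodicFlow φ X V p T) (ℓ : Plane →L[ℝ] ℂ) {x : Plane}
    (hx : x ∈ V) (hxp : x ≠ p) (α : ℝ) :
    fourierMean ℓ (orbitPath φ (T x, φ (α * T x) x)) =
      circleExp α * fourierMean ℓ (orbitPath φ (T x, x)) := by
  rw [fourierMean_apply (f := fun s => φ ((s + α) * T x) x),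
    fourierMean_apply (f := fun s => φ (s * T x) x)
      (h.flow.orbitPath_apply (z := (T x, x)) hx)]
  -- The integrand has period `1`, so shifting it leaves its integral over a period unchanged.
  · let q : ℝ → ℂ := fun s => circleExp (-s) * ℓ (φ (s * T x) x)
    have hq : Function.Periodic q 1 := fun s => by
      have h1 : circleExp (-(s + 1)) = circleExp (-s) := by
        rw [← mul_one (circleExp (-(s + 1))), ← circleExp_one, ← circleExp_add]
        congr 1
        ring
      have h2 : φ ((s + 1) * T x) x = φ (s * T x) x := by
        rw [add_mul, one_mul, h.add hx, h.flow_period hx hxp]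
      simp only [q, h1, h2]
    have h3 : ∀ s, circleExp (-s) * ℓ (φ ((s + α) * T x) x) = circleExp α * q (s + α) := fun s => by
      simp only [q]
      rw [← mul_assoc, ← circleExp_add]
      congr 2
      ring
    simp only [h3]
    rw [intervalIntegral.integral_const_mul, intervalIntegral.integral_comp_add_right q α, zero_add,
      add_comm 1 α, hq.intervalIntegral_add_eq α 0, zero_add]
  · intro s
    rw [h.flow.orbitPath_apply (z := (T x, φ (α * T x) x)) (h.flow.mem x hx _), ← h.add hx]
    congr 1
    ring

theorem fderiv_flow_sub_center (h : IsPeriodicFlow φ X V p T) {ω₀ : ℝ} {ℓ : Plane ≃L[ℝ] ℂ}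
    (hℓ : ∀ v, ℓ (fderiv ℝ X p v) = (ω₀ * Complex.I) * ℓ v) (τ : ℝ) (v : Plane) :
    fderiv ℝ (fun z : ℝ × Plane => ℓ (φ z.1 z.2 - z.2)) (τ, p) (0, v) =
      (Complex.exp ((ω₀ * τ : ℝ) * Complex.I) - 1) * ℓ v := by
  have h1 := ((h.flow.contDiffAt_orbitPath h.contDiffAt le_rfl (z := (τ, p))
    h.mem_center).differentiableAt one_ne_zero).hasFDerivAt
  have h2 := (ℓ : Plane →L[ℝ] ℂ).hasFDerivAt.comp (τ, p)
    (((evalCLM ℝ (1 : I)).hasFDerivAt.comp (τ, p) h1).sub hasFDerivAt_snd)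
  have h3 : (fun z : ℝ × Plane => ℓ (φ z.1 z.2 - z.2)) =ᶠ[𝓝 (τ, p)]
      fun z => ℓ (orbitPath φ z 1 - z.2) := by
    filter_upwards [continuousAt_snd.eventually (h.flow.isOpen.mem_nhds h.mem_center)] with z hz
    rw [h.flow.orbitPath_apply hz]
    simp
  rw [(h2.congr_of_eventuallyEq h3).fderiv]
  change ℓ (fderiv ℝ (orbitPath φ) (τ, p) (0, v) 1 - v) = _
  rw [map_sub, h.fderiv_orbitPath_center hℓ]
  simp [sub_mul]

theorem contDiffAt_period_center_of_ne_zero (h : IsPeriodicFlow φ X V p T) {ω₀ : ℝ} (hω : 0 < ω₀)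
    {ℓ : Plane ≃L[ℝ] ℂ} (hℓ : ∀ v, ℓ (fderiv ℝ X p v) = (ω₀ * Complex.I) * ℓ v)
    (hTp : T p = 2 * Real.pi / ω₀) {n m : WithTop ℕ∞} (hmn : m + 1 ≤ n) (hm : m ≠ 0)
    (hX : ∀ x ∈ V, ContDiffAt ℝ n X x) : ContDiffAt ℝ m T p := by
  have hn : 1 ≤ n := le_trans (by simp) hmn
  have hn0 : n ≠ 0 := by rintro rfl; simp at hn
  have hTc : ContinuousAt T p := by
    rw [continuousAt_iff_punctured_nhds, hTp]
    exact h.tendsto_period_center hω hℓ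
  set T₀ := 2 * Real.pi / ω₀ with hT₀
  set W : ℝ × Plane → ℂ := fun z => fourierMean (ℓ : Plane →L[ℝ] ℂ) (orbitPath φ z) with hW
  have hWp : ∀ τ, W (τ, p) = 0 := h.fourierMean_center (ℓ : Plane →L[ℝ] ℂ)
  have hWn : ContDiffAt ℝ n W (T₀, p) := h.contDiffAt_fourierMean (ℓ : Plane →L[ℝ] ℂ) hn hX T₀
  set F : ℝ × Plane → ℝ × ℂ := fun z => (z.1, W z) with hF
  have hFp : ∀ τ, F (τ, p) = (τ, 0) := fun τ => by simp [hF, hWp]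
  have hFn : ContDiffAt ℝ n F (T₀, p) := contDiffAt_fst.prodMk hWn
  have hF' := h.hasFDerivAt_fourierMean_center hω hℓ
  set Ψ := hFn.localInverse hF' hn0
  have hΨn : ContDiffAt ℝ n Ψ (T₀, 0) := hFp T₀ ▸ hFn.to_localInverse hF' hn0
  have hΨF : ∀ᶠ z in 𝓝 (T₀, p), Ψ (F z) = z :=
    (hFn.hasStrictFDerivAt' hF' hn0).eventually_left_inverse
  have hΨ0 : Ψ (T₀, 0) = (T₀, p) := hFp T₀ ▸ hΨF.self_of_nhds
  set D : ℝ × Plane → ℂ := fun z => ℓ (φ z.1 z.2 - z.2) with hD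
  have hDn : ContDiffAt ℝ n D (T₀, p) := (ℓ : Plane →L[ℝ] ℂ).contDiff.contDiffAt.comp _
    ((h.flow.contDiffAt_flow hX hn (z := (T₀, p)) h.mem_center).sub contDiffAt_snd)
  -- `D ∘ Ψ` is the displacement expressed in the coordinates `(τ, w)`.
  have hKn : ContDiffAt ℝ n (D ∘ Ψ) (T₀, 0) := ContDiffAt.comp _ (hΨ0 ▸ hDn) hΨn
  have hKF : ∀ᶠ z in 𝓝 (T₀, p), (D ∘ Ψ) (F z) = D z := hΨF.mono fun z hz => by
    rw [Function.comp_apply, hz]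
  obtain ⟨g, hgm, hgz, hgc⟩ := exists_circle_quotient hmn hKn
  have hτ : Tendsto (fun τ : ℝ => (τ, p)) (𝓝 T₀) (𝓝 (T₀, p)) :=
    (Continuous.prodMk_left p).tendsto T₀
  -- At the center `D` has derivative `exp(iω₀ τ) - 1` and `W` has derivative `c`, the Fourier
  -- integral of the rotation; by `mul_integral_exp` their quotient is `i(ω₀ τ - 2π)`.
  have hg0 : ∀ᶠ τ in 𝓝 T₀, g (τ, 0) = (ω₀ * τ - 2 * Real.pi : ℝ) * Complex.I := by
    have hc : ∀ᶠ τ in 𝓝 T₀, (∫ s in (0 : ℝ)..1, circleExp (-s) *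
        Complex.exp ((ω₀ * τ * s : ℝ) * Complex.I)) ≠ 0 := by
      refine ContinuousAt.eventually_ne (Continuous.continuousAt ?_) ?_
      · refine intervalIntegral.continuous_parametric_intervalIntegral_of_continuous' ?_ 0 1
        fun_prop
      · rw [hT₀, mul_div_cancel₀ _ hω.ne']
        rw [integral_circleExp_two_pi]
        exact one_ne_zero
    have hK1 : ∀ᶠ z in 𝓝 (T₀, (0 : ℂ)), ContDiffAt ℝ 1 (D ∘ Ψ) z :=
      (hKn.of_le hn).eventually (by simp)
    have hW1 : ∀ᶠ z in 𝓝 (T₀, p), ContDiffAt ℝ 1 W z := (hWn.of_le hn).eventually (by simp)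
    have hτ0 : Tendsto (fun τ : ℝ => (τ, (0 : ℂ))) (𝓝 T₀) (𝓝 (T₀, 0)) :=
      (Continuous.prodMk_left (0 : ℂ)).tendsto T₀
    filter_upwards [hgc, hc, hτ0.eventually hK1, hτ.eventually hW1,
      hτ.eventually hKF.eventually_nhds] with τ h1 h2 h3 h4 h5
    refine h1 _ fun v => ?_
    have h6 := hasFDerivAt_fst.prodMk (h4.differentiableAt one_ne_zero).hasFDerivAt
    have h7 : HasFDerivAt (D ∘ Ψ) (fderiv ℝ (D ∘ Ψ) (τ, 0)) (F (τ, p)) := by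
      rw [hFp]; exact (h3.differentiableAt one_ne_zero).hasFDerivAt
    have h8 := ((h7.comp (τ, p) h6).congr_of_eventuallyEq
      (h5.mono fun z hz => hz.symm)).fderiv
    set c := ∫ s in (0 : ℝ)..1, circleExp (-s) * Complex.exp ((ω₀ * τ * s : ℝ) * Complex.I)
    have h9 := congrArg (fun L => L (0, ℓ.symm (v / c))) h8
    rw [h.fderiv_flow_sub_center hℓ] at h9
    change _ = fderiv ℝ (D ∘ Ψ) (τ, 0) (0, fderiv ℝ W (τ, p) (0, ℓ.symm (v / c))) at h9
    rw [h.fderiv_fourierMean_center hℓ, ContinuousLinearEquiv.apply_symm_apply,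
      mul_div_cancel₀ _ h2, ← mul_integral_exp (ω₀ * τ)] at h9
    change c * _ * (v / c) = _ at h9
    rw [← h9]
    generalize c = c at h2
    field_simp
  -- The imaginary part suffices, as `g (τ, 0)` is purely imaginary with `τ`-derivative `iω₀`.
  refine contDiffAt_of_implicit hm (c := ω₀)
    (f := fun z : Plane × ℝ => (g (z.2, W (z.2, z.1))).im) ?_ ?_ hω.ne' hTc ?_
  · have h1 : ContDiffAt ℝ m (fun z : Plane × ℝ => F (z.2, z.1)) (p, T₀) :=
      ContDiffAt.comp (g := F) (f := fun z : Plane × ℝ => (z.2, z.1)) (p, T₀)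
        (hFn.of_le (le_self_add.trans hmn)) (contDiffAt_snd.prodMk contDiffAt_fst)
    rw [hTp]
    refine Complex.imCLM.contDiff.contDiffAt.comp (p, T₀)
      (ContDiffAt.comp (g := g) (f := fun z : Plane × ℝ => F (z.2, z.1)) (p, T₀) ?_ h1)
    simpa only [hFp] using hgm
  · have h1 : HasDerivAt (fun t => ω₀ * t - 2 * Real.pi) ω₀ (T p) := by
      simpa using ((hasDerivAt_id (T p)).const_mul ω₀).sub_const (2 * Real.pi)
    rw [hTp] at h1 ⊢
    refine h1.congr_of_eventuallyEq ?_
    filter_upwards [hg0] with t ht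
    simp [hWp, ht]
  · have hz : Tendsto (fun x => (T x, x)) (𝓝 p) (𝓝 (T₀, p)) := by
      have : ContinuousAt (fun x => (T x, x)) p := hTc.prodMk continuousAt_id
      rwa [ContinuousAt, hTp] at this
    have hzp : Tendsto (fun x => (T x, p)) (𝓝 p) (𝓝 (T₀, p)) := by
      have : ContinuousAt (fun x => (T x, p)) p := hTc.prodMk continuousAt_const
      rwa [ContinuousAt, hTp] at this
    have hFz : Tendsto (fun x => F (T x, x)) (𝓝 p) (𝓝 (T₀, 0)) := by
      have := hFn.continuousAt.tendsto.comp hz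
      rwa [hFp] at this
    -- A product neighborhood is needed so that `Ψ` inverts the coordinates along the entire orbit
    -- of `x` with the one time `T x`, not only at `x`.
    have hΨF2 := hΨF
    rw [nhds_prod_eq] at hΨF2
    obtain ⟨P₁, hP₁, P₂, hP₂, hP⟩ := eventually_prod_iff.1 hΨF2
    have hpath := ((h.flow.contDiffAt_orbitPath hX hn (z := (T₀, p)) h.mem_center).continuousAt.tendsto.comp
      hz).eventually (eventually_forall_apply (orbitPath φ (T₀, p)) (Q := P₂) fun t => by
        rw [h.orbitPath_center]; exact hP₂)
    have hTt : Tendsto T (𝓝 p) (𝓝 T₀) := by rw [ContinuousAt, hTp] at hTc; exact hTc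
    filter_upwards [hFz.eventually hgz, hz.eventually hΨF, hzp.eventually hΨF, hpath,
      hTt.eventually hP₁, h.flow.isOpen.mem_nhds h.mem_center] with x h1 h2 h3 h4 h5 hxV
    by_cases hxp : x = p
    · rw [hxp]
    have hW0 : W (T x, x) ≠ 0 := fun h0 => hxp <| by
      have h7 : F (T x, x) = F (T x, p) := by rw [hFp]; exact Prod.ext rfl h0
      rw [h7, h3] at h2
      exact (congrArg Prod.snd h2).symm
    have h6 : g (F (T x, x)) = 0 := by
      refine h1 hW0 fun w hw => ?_
      -- Each `w` on the circle through `W (T x, x)` is the coefficient at the shifted point `φ (α *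
      -- T x) x`, which also has period `T x`; so the displacement vanishes there.
      · obtain ⟨α, hα, hαw⟩ := exists_circleExp_eq (u := w / W (T x, x)) (by
          rw [norm_div, hw, div_self (norm_ne_zero_iff.2 hW0)])
        have h8 : F (T x, φ (α * T x) x) = ((F (T x, x)).1, w) := by
          refine Prod.ext rfl ?_
          change W (T x, φ (α * T x) x) = w
          have h10 : W (T x, φ (α * T x) x) = circleExp α * W (T x, x) :=
            h.fourierMean_flow _ hxV hxp α
          rw [h10, hαw, div_mul_cancel₀ w hW0]
        have h9 := h4 ⟨α, hα⟩
        rw [Function.comp_apply, h.flow.orbitPath_apply (z := (T x, x)) hxV] at h9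
        rw [Function.comp_apply, ← h8, hP h5 h9]
        change ℓ (φ (T x) (φ (α * T x) x) - φ (α * T x) x) = 0
        rw [(h.flow_eq_iff hxV _ _).2 (h.flow_period hxV hxp), sub_self, map_zero]
    have h7 := hg0.self_of_nhds
    change (g (F (T x, x))).im = (g (T p, W (T p, p))).im
    rw [h6, hTp, hWp, h7, hT₀, mul_div_cancel₀ _ hω.ne']
    simp

end IsPeriodicFlow

/-! ### Assembly of the regularity statement -/

theorem WithTop.sub_one_add_one_le {k : WithTop ℕ∞} (hk : 1 ≤ k) : k - 1 + 1 ≤ k := by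
  match k with
  | ω => exact le_top
  | ∞ => exact le_rfl
  | (k : ℕ) =>
    have h1 : 1 ≤ k := by exact_mod_cast hk
    have h2 : ((k : WithTop ℕ∞) - 1) = ((k - 1 : ℕ) : WithTop ℕ∞) := by
      norm_cast
    rw [h2]
    exact_mod_cast (Nat.sub_add_cancel h1).le

namespace PlanarCenter

theorem contDiff_periodFunction {k : WithTop ℕ∞} {U : Set Plane} {X : Plane → Plane} {p : Plane}
    {ω₀ : ℝ} (hk : 1 ≤ k) (hU : IsOpen U) (hX : ContDiffOn ℝ k X U)
    (h : IsNondegenerateCenter U X p ω₀) :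
    ContDiffOn ℝ k (periodFunction U X p ω₀) (periodAnnulus U X p \ {p}) ∧
      ContDiffAt ℝ (k - 1) (periodFunction U X p ω₀) p := by
  obtain ⟨hc, hω, hA⟩ := h
  obtain ⟨φ, hφ⟩ := exists_isPeriodicFlow ω₀ hU (hX.of_le hk) hc
  obtain ⟨⟨-, -, -, hVU, -⟩, -⟩ := isGreatest_periodAnnulus hc
  obtain ⟨ℓ, hℓ⟩ := exists_complex_coordinate hω (comp_self_eq_of_aroots hA)
  have hXV : ∀ x ∈ periodAnnulus U X p, ContDiffAt ℝ k X x := fun x hx =>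
    hX.contDiffAt (hU.mem_nhds (hVU hx))
  have hTp : periodFunction U X p ω₀ p = 2 * Real.pi / ω₀ := by simp [periodFunction]
  have h1 : ∀ q ∈ periodAnnulus U X p \ {p}, ContDiffAt ℝ k (periodFunction U X p ω₀) q :=
    fun q hq => hφ.contDiffAt_period hk hXV hq.1 hq.2
  refine ⟨fun q hq => (h1 q hq).contDiffWithinAt, ?_⟩
  -- The implicit function argument at `p` requires at least one derivative; class `C^0` is plain
  -- continuity.
  by_cases hm : k - 1 = 0
  · rw [hm, contDiffAt_zero]
    refine ⟨_, hφ.flow.isOpen.mem_nhds hφ.mem_center, fun q hq => ?_⟩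
    by_cases hqp : q = p
    · rw [hqp]
      refine ContinuousAt.continuousWithinAt ?_
      rw [continuousAt_iff_punctured_nhds, hTp]
      exact hφ.tendsto_period_center hω hℓ
    · exact (h1 q ⟨hq, hqp⟩).continuousAt.continuousWithinAt
  · exact hφ.contDiffAt_period_center_of_ne_zero hω hℓ hTp (WithTop.sub_one_add_one_le hk) hm hXV

end PlanarCenter

/-! ### Rotation fields -/

namespace PlanarCenter

theorem rot_add (a b : Plane) : rot (a + b) = rot a + rot b := by
  ext i; fin_cases i <;> simp [rot, add_comm]

theorem rot_smul (c : ℝ) (a : Plane) : rot (c • a) = c • rot a := by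
  ext i; fin_cases i <;> simp [rot]

theorem rot_rot (a : Plane) : rot (rot a) = -a := by
  ext i; fin_cases i <;> simp [rot]

/-- Rotation by a right angle as a continuous linear map. -/
noncomputable def rotCLM : Plane →L[ℝ] Plane :=
  LinearMap.toContinuousLinearMap { toFun := rot, map_add' := rot_add, map_smul' := rot_smul }

theorem rotCLM_apply (a : Plane) : rotCLM a = rot a := rfl

/-- The squared Euclidean norm. -/
def sqNorm (q : Plane) : ℝ := q 0 ^ 2 + q 1 ^ 2

theorem sqNorm_nonneg (q : Plane) : 0 ≤ sqNorm q := by unfold sqNorm; positivity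

theorem sqNorm_pos {q : Plane} (hq : q ≠ 0) : 0 < sqNorm q := by
  have := dotCLM_self_pos hq
  rw [dotCLM_apply] at this
  simpa [sqNorm, pow_two] using this

theorem contDiff_sqNorm {n : WithTop ℕ∞} : ContDiff ℝ n sqNorm := by
  unfold sqNorm
  fun_prop

@[simp] theorem sqNorm_zero : sqNorm 0 = 0 := by simp [sqNorm]

/-- The vector field rotating the circle of radius `r` with angular velocity `1 + h (r²)`. -/
def rotationField (h : ℝ → ℝ) (q : Plane) : Plane := (1 + h (sqNorm q)) • rot q

theorem exampleField_eq (a : ℝ) : exampleField a = rotationField fun s => s ^ a := by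
  funext q
  ext i
  fin_cases i <;> simp [exampleField, rotationField, sqNorm, mul_comm]

/-- The integral curves of a rotation field. -/
noncomputable def rotationCurve (w : ℝ) (q : Plane) (t : ℝ) : Plane :=
  Real.cos (w * t) • q + Real.sin (w * t) • rot q

theorem sqNorm_rotationCurve (w : ℝ) (q : Plane) (t : ℝ) :
    sqNorm (rotationCurve w q t) = sqNorm q := by
  simp only [sqNorm, rotationCurve, PiLp.add_apply, PiLp.smul_apply, smul_eq_mul, rot_zero, rot_one]
  linear_combination (q 0 ^ 2 + q 1 ^ 2) * Real.sin_sq_add_cos_sq (w * t)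

theorem rotationCurve_zero (w : ℝ) (q : Plane) : rotationCurve w q 0 = q := by
  simp [rotationCurve]

theorem hasDerivAt_rotationCurve (w : ℝ) (q : Plane) (t : ℝ) :
    HasDerivAt (rotationCurve w q) (w • rot (rotationCurve w q t)) t := by
  have h1 : HasDerivAt (fun t => w * t) w t := by simpa using (hasDerivAt_id t).const_mul w
  have h2 := (h1.cos.smul_const q).add (h1.sin.smul_const (rot q))
  refine h2.congr_deriv ?_
  rw [rotationCurve, rot_add, rot_smul, rot_smul, rot_rot]
  module

theorem isPeriodicOrbit_rotationCurve {h : ℝ → ℝ} {q : Plane} (hq : q ≠ 0)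
    (hw : 0 < 1 + h (sqNorm q)) :
    IsPeriodicOrbit Set.univ (rotationField h) (rotationCurve (1 + h (sqNorm q)) q)
      (2 * Real.pi / (1 + h (sqNorm q))) := by
  refine ⟨fun _ => trivial, fun t => ?_, ⟨by positivity, fun t => ?_⟩, ?_⟩
  · have := hasDerivAt_rotationCurve (1 + h (sqNorm q)) q t
    rw [← sqNorm_rotationCurve (1 + h (sqNorm q)) q t] at this
    simpa only [rotationField, sqNorm_rotationCurve] using this
  · simp only [rotationCurve]
    rw [mul_add, mul_div_cancel₀ _ hw.ne', Real.cos_add_two_pi, Real.sin_add_two_pi]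
  · rintro τ ⟨hτ, hper⟩
    set w := 1 + h (sqNorm q)
    have h1 := hper 0
    rw [zero_add, rotationCurve_zero, rotationCurve] at h1
    have h2 := congrArg (dotCLM q) h1
    rw [map_add, map_smul, map_smul, dotCLM_rot, smul_zero, add_zero, smul_eq_mul] at h2
    have h3 : Real.cos (w * τ) = 1 := by
      have := dotCLM_self_pos hq
      exact mul_right_cancel₀ this.ne' (by rw [h2, one_mul])
    obtain ⟨n, hn⟩ := (Real.cos_eq_one_iff _).1 h3
    have h4 : 0 < w * τ := mul_pos hw hτ
    rw [← hn] at h4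
    have h5 : 0 < n := by
      have := (mul_pos_iff_of_pos_right Real.two_pi_pos).1 h4
      exact_mod_cast this
    have h6 : (1 : ℝ) ≤ n := by exact_mod_cast h5
    rw [div_le_iff₀ hw, mul_comm τ, ← hn]
    nlinarith [Real.two_pi_pos]

theorem isFoliatedNhd_rotationField {h : ℝ → ℝ} (hpos : ∀ s, 0 ≤ s → 0 < 1 + h s) :
    IsFoliatedNhd Set.univ (rotationField h) 0 Set.univ := by
  refine ⟨isOpen_univ, isConnected_univ, trivial, le_rfl, fun q hq => ?_⟩
  have hq0 : q ≠ 0 := hq.2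
  refine ⟨_, _, rotationCurve_zero _ q,
    isPeriodicOrbit_rotationCurve hq0 (hpos _ (sqNorm_nonneg q)), fun t => ⟨trivial, fun h0 => ?_⟩⟩
  have h1 := sqNorm_rotationCurve (1 + h (sqNorm q)) q t
  rw [Set.mem_singleton_iff.1 h0, sqNorm_zero] at h1
  exact (sqNorm_pos hq0).ne h1

theorem isCenter_rotationField {h : ℝ → ℝ} (hpos : ∀ s, 0 ≤ s → 0 < 1 + h s) :
    IsCenter Set.univ (rotationField h) 0 :=
  ⟨by simp [rotationField, ← rotCLM_apply], _, isFoliatedNhd_rotationField hpos⟩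

theorem periodAnnulus_rotationField {h : ℝ → ℝ} (hpos : ∀ s, 0 ≤ s → 0 < 1 + h s) :
    periodAnnulus Set.univ (rotationField h) 0 = Set.univ :=
  Set.univ_subset_iff.1 (Set.subset_sUnion_of_mem (isFoliatedNhd_rotationField hpos))

theorem periodFunction_rotationField {h : ℝ → ℝ} (hpos : ∀ s, 0 ≤ s → 0 < 1 + h s) (h0 : h 0 = 0)
    (hX : ContDiff ℝ 1 (rotationField h)) (q : Plane) :
    periodFunction Set.univ (rotationField h) 0 1 q = 2 * Real.pi / (1 + h (sqNorm q)) := by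
  by_cases hq : q = 0
  · simp [periodFunction, hq, h0]
  have h1 := isPeriodicOrbit_rotationCurve hq (hpos _ (sqNorm_nonneg q))
  have h2 : {T : ℝ | ∃ γ, γ 0 = q ∧ IsPeriodicOrbit Set.univ (rotationField h) γ T} =
      {2 * Real.pi / (1 + h (sqNorm q))} := by
    ext T
    simp only [Set.mem_ofPred_eq, Set.mem_singleton_iff]
    constructor
    · rintro ⟨γ, hγ0, hγ⟩
      have := eq_of_integralCurves (X := rotationField h) hγ.2.1 h1.2.1 (fun t => hX.contDiffAt)
        (fun t => hX.contDiffAt) (t₀ := 0) (by rw [hγ0, rotationCurve_zero])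
      subst this
      exact hγ.2.2.unique h1.2.2
    · rintro rfl
      exact ⟨_, rotationCurve_zero _ q, h1⟩
  rw [periodFunction, if_neg hq, h2, csInf_singleton]

/-- Continuity of `h` suffices, since `h(|q|²) rot q` is `o(|q|)`; this matters for `s ^ a` with `a
< 1`. -/
theorem hasFDerivAt_rotationField {h : ℝ → ℝ} (h0 : h 0 = 0) (hc : ContinuousAt h 0) :
    HasFDerivAt (rotationField h) rotCLM 0 := by
  have h1 : Tendsto (fun q => h (sqNorm q)) (𝓝 0) (𝓝 0) := by
    have h2 : ContinuousAt (fun q => h (sqNorm q)) 0 :=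
      ContinuousAt.comp (g := h) (f := sqNorm) (by simpa using hc)
        (contDiff_sqNorm (n := 0)).continuous.continuousAt
    simpa [ContinuousAt, h0] using h2
  refine HasFDerivAt.of_isLittleO ?_
  have h3 : (fun q : Plane => rotationField h q - rotationField h 0 - rotCLM (q - 0)) =
      fun q => h (sqNorm q) • rotCLM q := funext fun q => by
    have : rotationField h 0 = 0 := by rw [rotationField, ← rotCLM_apply, map_zero, smul_zero]
    rw [this, rotationField, sub_zero, sub_zero, rotCLM_apply]
    module
  rw [h3]
  have h4 := ((Asymptotics.isLittleO_one_iff ℝ).2 h1).smul_isBigO (rotCLM.isBigO_id (𝓝 0))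
  simpa using h4

open Polynomial in
theorem aroots_charpoly_rotCLM :
    (LinearMap.charpoly (rotCLM : Plane →ₗ[ℝ] Plane)).aroots ℂ =
      {((1 : ℝ) : ℂ) * Complex.I, -(((1 : ℝ) : ℂ) * Complex.I)} := by
  have h1 : LinearMap.charpoly (rotCLM : Plane →ₗ[ℝ] Plane) = X ^ 2 + 1 := by
    have h2 : LinearMap.toMatrix (EuclideanSpace.basisFun (Fin 2) ℝ).toBasis
        (EuclideanSpace.basisFun (Fin 2) ℝ).toBasis (rotCLM : Plane →ₗ[ℝ] Plane) = !![0, -1; 1, 0] := by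
      ext i j
      rw [LinearMap.toMatrix_apply]
      fin_cases i <;> fin_cases j <;> simp [rotCLM_apply, rot]
    rw [← LinearMap.charpoly_toMatrix _ (EuclideanSpace.basisFun (Fin 2) ℝ).toBasis, h2,
      Matrix.charpoly_fin_two]
    simp [Matrix.trace_fin_two, Matrix.det_fin_two]
  rw [h1, aroots_def]
  have h3 : (X ^ 2 + 1 : ℝ[X]).map (algebraMap ℝ ℂ) =
      (({Complex.I, -Complex.I} : Multiset ℂ).map fun a => X - C a).prod := by
    have hI : (C Complex.I : ℂ[X]) * C Complex.I = -1 := by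
      rw [← C_mul, Complex.I_mul_I]; simp
    simp only [Polynomial.map_add, Polynomial.map_pow, map_X, Polynomial.map_one,
      Multiset.insert_eq_cons, Multiset.map_cons, Multiset.map_singleton, Multiset.prod_cons,
      Multiset.prod_singleton, C_neg]
    linear_combination hI
  rw [h3, roots_multiset_prod_X_sub_C]
  simp

theorem isNondegenerateCenter_rotationField {h : ℝ → ℝ} (hpos : ∀ s, 0 ≤ s → 0 < 1 + h s)
    (h0 : h 0 = 0) (hc : ContinuousAt h 0) :
    IsNondegenerateCenter Set.univ (rotationField h) 0 1 := by
  refine ⟨isCenter_rotationField hpos, one_pos, ?_⟩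
  rw [(hasFDerivAt_rotationField h0 hc).fderiv]
  exact aroots_charpoly_rotCLM

end PlanarCenter

/-! ### Homogeneous functions -/

section Homogeneous

universe u

variable {E : Type u} [NormedAddCommGroup E] [NormedSpace ℝ E] [ProperSpace E]

theorem exists_norm_le_of_homogeneous {F : Type*} [NormedAddCommGroup F] [NormedSpace ℝ F] {c : ℝ}
    (hc : 0 < c) {f : E → F} (hf : ∀ x ≠ 0, ContinuousAt f x)
    (hom : ∀ r : ℝ, 0 < r → ∀ x, f (r • x) = r ^ c • f x) :
    f 0 = 0 ∧ ∃ M, ∀ x, ‖f x‖ ≤ M * ‖x‖ ^ c := by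
  have h0 : f 0 = 0 := by
    have h1 := hom 2 two_pos 0
    rw [smul_zero] at h1
    have h2 : (1 - (2 : ℝ) ^ c) • f 0 = 0 := by rw [sub_smul, one_smul, ← h1, sub_self]
    refine (smul_eq_zero.1 h2).resolve_left ?_
    have := Real.one_lt_rpow (one_lt_two) hc
    linarith
  obtain ⟨M, hM⟩ := (isCompact_sphere (0 : E) 1).exists_bound_of_continuousOn (f := f)
    fun x hx => (hf x (ne_zero_of_mem_unit_sphere ⟨x, hx⟩)).continuousWithinAt
  refine ⟨h0, M, fun x => ?_⟩
  by_cases hx : x = 0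
  · simp [hx, h0, Real.zero_rpow hc.ne']
  have hn := norm_pos_iff.2 hx
  have h1 := hom ‖x‖ hn (‖x‖⁻¹ • x)
  rw [smul_smul, mul_inv_cancel₀ hn.ne', one_smul] at h1
  rw [h1, norm_smul, Real.norm_of_nonneg (by positivity), mul_comm]
  gcongr
  exact hM _ (by simp [norm_smul, hn.ne'])

/-- Induction on `n`: the derivative is homogeneous of degree `c - 1`. Compactness of the sphere
gives `|f x| ≤ M |x|^c`, hence continuity at `0` for `c > 0` and zero derivative there for `c > 1`.
-/
theorem contDiff_of_homogeneous (n : ℕ) :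
    ∀ {F : Type u} [NormedAddCommGroup F] [NormedSpace ℝ F] {c : ℝ} {f : E → F}, n < c →
      (∀ x ≠ 0, ContDiffAt ℝ ∞ f x) → (∀ r : ℝ, 0 < r → ∀ x, f (r • x) = r ^ c • f x) →
      ContDiff ℝ n f := by
  have cont : ∀ {F : Type u} [NormedAddCommGroup F] [NormedSpace ℝ F] {c : ℝ} {f : E → F}, 0 < c →
      (∀ x ≠ 0, ContDiffAt ℝ ∞ f x) → (∀ r : ℝ, 0 < r → ∀ x, f (r • x) = r ^ c • f x) →
      Continuous f := by
    intro F _ _ c f hc hf hom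
    obtain ⟨h0, M, hM⟩ := exists_norm_le_of_homogeneous hc (fun x hx => (hf x hx).continuousAt) hom
    refine continuous_iff_continuousAt.2 fun x => ?_
    by_cases hx : x = 0
    · rw [hx, ContinuousAt, h0]
      refine squeeze_zero_norm hM ?_
      have h1 : ContinuousAt (fun x : E => M * ‖x‖ ^ c) 0 :=
        continuousAt_const.mul (continuousAt_id.norm.rpow_const (Or.inr hc.le))
      simpa [ContinuousAt, Real.zero_rpow hc.ne'] using h1
    · exact (hf x hx).continuousAt
  induction n with
  | zero =>
    intro F _ _ c f hc hf hom
    exact contDiff_zero.2 (cont (by simpa using hc) hf hom)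
  | succ n ih =>
    intro F _ _ c f hc hf hom
    push_cast at hc
    have hc1 : 1 < c := by
      have : (0 : ℝ) ≤ n := n.cast_nonneg
      linarith
    have hdiff : Differentiable ℝ f := fun x => by
      by_cases hx : x = 0
      · obtain ⟨h0, M, hM⟩ := exists_norm_le_of_homogeneous (one_pos.trans hc1)
          (fun x hx => (hf x hx).continuousAt) hom
        rw [hx]
        refine HasFDerivAt.differentiableAt (f' := 0) (HasFDerivAt.of_isLittleO ?_)
        simp only [h0, sub_zero, _root_.zero_apply]
        have h1 : (fun x : E => f x) =O[𝓝 0] fun x => ‖x‖ * ‖x‖ ^ (c - 1) := by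
          refine Asymptotics.IsBigO.of_bound M (Eventually.of_forall fun x => ?_)
          refine (hM x).trans (le_of_eq ?_)
          by_cases hx : x = 0
          · simp [hx, Real.zero_rpow (one_pos.trans hc1).ne']
          · rw [Real.norm_of_nonneg (by positivity), Real.rpow_sub_one (norm_ne_zero_iff.2 hx),
              mul_div_cancel₀ _ (norm_ne_zero_iff.2 hx)]
        refine h1.trans_isLittleO ?_
        have h2 : ContinuousAt (fun x : E => ‖x‖ ^ (c - 1)) 0 :=
          continuousAt_id.norm.rpow_const (Or.inr (by linarith))
        have h3 : Tendsto (fun x : E => ‖x‖ ^ (c - 1)) (𝓝 0) (𝓝 0) := by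
          simpa [ContinuousAt, Real.zero_rpow (by linarith : c - 1 ≠ 0)] using h2
        have h4 := (Asymptotics.isBigO_refl (fun x : E => ‖x‖) (𝓝 0)).mul_isLittleO
          ((Asymptotics.isLittleO_one_iff ℝ).2 h3)
        exact Asymptotics.IsLittleO.of_norm_right (by simpa using h4)
      · exact (hf x hx).differentiableAt (by simp)
    push_cast
    refine contDiff_succ_iff_fderiv.2 ⟨hdiff, by simp, ih (c := c - 1) (by linarith)
      (fun x hx => (hf x hx).fderiv_right (by simp)) fun r hr x => ?_⟩
    have h1 : HasFDerivAt (fun x => f (r • x)) (fderiv ℝ f (r • x) ∘L (r • ContinuousLinearMap.id ℝ E)) x :=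
      HasFDerivAt.comp (g := f) x (hdiff (r • x)).hasFDerivAt ((hasFDerivAt_id x).const_smul r)
    have h2 : HasFDerivAt (fun x => f (r • x)) (r ^ c • fderiv ℝ f x) x := by
      simp only [hom r hr]
      exact (hdiff x).hasFDerivAt.const_smul (r ^ c)
    have h3 := h1.unique h2
    ext v
    have h4 := congrArg (fun L => L v) h3
    simp only [ContinuousLinearMap.comp_apply, _root_.smul_apply, ContinuousLinearMap.id_apply,
      map_smul] at h4
    rw [_root_.smul_apply, Real.rpow_sub_one hr.ne', div_eq_inv_mul, mul_smul, ← h4, smul_smul,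
      inv_mul_cancel₀ hr.ne', one_smul]

end Homogeneous

/-! ### Model functions which are not smooth or not analytic -/

/-- For `s > 0` the `k`-th derivative is a nonzero constant times `s ^ (2a - k)`. It blows up at `0`
if `2a < k`; if `2a = k` it has a nonzero one-sided limit, incompatible with oddness. -/
theorem not_contDiffAt_sq_rpow {k : ℕ} {a : ℝ} (h1 : (k : ℝ) - 1 < 2 * a) (h2 : 2 * a ≤ k)
    (ha : ∀ n : ℕ, a ≠ n) : ¬ ContDiffAt ℝ k (fun s : ℝ => (s ^ 2) ^ a) 0 := by
  intro hf
  set f : ℝ → ℝ := fun s => (s ^ 2) ^ a with hfd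
  have hc : ContinuousAt (iteratedDeriv k f) 0 := by
    have := hf.continuousAt_iteratedFDeriv le_rfl
    exact ((ContinuousMultilinearMap.apply ℝ (fun _ : Fin k => ℝ) ℝ fun _ => 1).continuous.continuousAt.comp
      this)
  have hder : ∀ s : ℝ, 0 < s → iteratedDeriv k f s = (descPochhammer ℝ k).eval (2 * a) * s ^ (2 * a - k) := by
    intro s hs
    have : f =ᶠ[𝓝 s] fun s => s ^ (2 * a) := by
      filter_upwards [lt_mem_nhds hs] with r hr
      simp only [hfd]
      rw [← Real.rpow_natCast, ← Real.rpow_mul hr.le, Nat.cast_ofNat]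
    rw [this.iteratedDeriv_eq, iteratedDeriv_eq_iterate, Real.iter_deriv_rpow_const]
  have hne : (descPochhammer ℝ k).eval (2 * a) ≠ 0 := (descPochhammer_pos h1).ne'
  have hlim : Tendsto (iteratedDeriv k f) (𝓝[>] 0) (𝓝 (iteratedDeriv k f 0)) :=
    hc.tendsto.mono_left nhdsWithin_le_nhds
  have hlim0 : Tendsto (fun s : ℝ => s ^ (k - 2 * a) * iteratedDeriv k f s) (𝓝[>] 0)
      (𝓝 ((descPochhammer ℝ k).eval (2 * a))) := by
    refine tendsto_const_nhds.congr' ?_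
    filter_upwards [self_mem_nhdsWithin] with s hs
    have hs : 0 < s := hs
    rw [hder s hs, mul_left_comm, ← Real.rpow_add hs]
    simp
  rcases h2.lt_or_eq with h3 | h3
  · have h4 : Tendsto (fun s : ℝ => s ^ (k - 2 * a)) (𝓝[>] 0) (𝓝 0) := by
      have : ContinuousAt (fun s : ℝ => s ^ (k - 2 * a)) 0 :=
        continuousAt_id.rpow_const (Or.inr (by linarith))
      have h5 := this.tendsto
      simp only [Real.zero_rpow (by linarith : (k : ℝ) - 2 * a ≠ 0)] at h5
      exact h5.mono_left nhdsWithin_le_nhds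
    have h5 := h4.mul hlim
    rw [zero_mul] at h5
    exact hne (tendsto_nhds_unique hlim0 h5)
  -- An even `k` would make `a = k/2` a natural number. For odd `k` the `k`-th derivative of an even
  -- function is odd, so it vanishes at `0`.
  · have hk : Odd k := by
      rw [← Nat.not_even_iff_odd]
      rintro ⟨j, hj⟩
      refine ha j ?_
      rw [hj] at h3
      push_cast at h3
      linarith
    have h4 : iteratedDeriv k f 0 = 0 := by
      have h5 := iteratedDeriv_comp_neg k f 0
      have h6 : (fun x => f (-x)) = f := funext fun x => by simp [hfd]
      rw [h6, hk.neg_one_pow, neg_zero, neg_smul, one_smul] at h5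
      linarith
    simp only [h3, sub_self, Real.rpow_zero, one_mul] at hlim0
    rw [h4] at hlim
    exact hne (by rw [h3]; exact tendsto_nhds_unique hlim0 hlim)

/-- An analytic function that is not locally zero has a finite order `n`, while this one is flat:
divided by `s ^ n` it still tends to `0`. -/
theorem not_analyticAt_expNegInvGlue_sq : ¬ AnalyticAt ℝ (fun s : ℝ => expNegInvGlue (s ^ 2)) 0 := by
  intro hf
  have h1 : ¬ ∀ᶠ s : ℝ in 𝓝 0, expNegInvGlue (s ^ 2) = 0 := fun h => by
    have h2 := h.filter_mono (nhdsWithin_le_nhds (s := {0}ᶜ))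
    obtain ⟨s, hs, hs0⟩ := (h2.and self_mem_nhdsWithin).exists
    have hs0 : s ≠ 0 := hs0
    exact (expNegInvGlue.pos_of_pos (by positivity)).ne' hs
  obtain ⟨n, g, hg, hg0, h⟩ := hf.exists_eventuallyEq_pow_smul_nonzero_iff.2 h1
  have h2 : Tendsto (fun s : ℝ => s ^ n * ((s ^ 2)⁻¹ ^ n * expNegInvGlue (s ^ 2))) (𝓝[≠] 0) (𝓝 0) := by
    have h3 := expNegInvGlue.tendsto_polynomial_inv_mul_zero (Polynomial.X ^ n)
    have h4 : Tendsto (fun s : ℝ => s ^ 2) (𝓝 0) (𝓝 0) := by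
      simpa using (continuous_pow 2).tendsto (0 : ℝ)
    have h5 := h3.comp h4
    have h6 : ContinuousAt (fun s : ℝ => s ^ n) 0 := by fun_prop
    have h7 := (h6.tendsto.mul h5).mono_left (nhdsWithin_le_nhds (s := {0}ᶜ))
    simpa using h7
  have h3 : Tendsto g (𝓝[≠] 0) (𝓝 0) := by
    refine h2.congr' ?_
    filter_upwards [h.filter_mono nhdsWithin_le_nhds, self_mem_nhdsWithin] with s hs hs0
    have hs0 : s ≠ 0 := hs0
    have h4 : (s ^ 2) ^ n = s ^ n * s ^ n := by ring
    rw [hs, sub_zero, smul_eq_mul, inv_pow, h4]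
    field_simp
  exact hg0 (tendsto_nhds_unique (hg.continuousAt.tendsto.mono_left nhdsWithin_le_nhds) h3)

/-! ### Sharpness -/

namespace PlanarCenter

theorem contDiff_rotationField {h : ℝ → ℝ} {n : WithTop ℕ∞} (hh : ContDiff ℝ n h) :
    ContDiff ℝ n (rotationField h) :=
  (contDiff_const.add (hh.comp contDiff_sqNorm)).smul rotCLM.contDiff

/-- The nonlinear part is homogeneous of degree `2a + 1 > k` and smooth off the origin. -/
theorem contDiff_rotationField_rpow {k : ℕ} {a : ℝ} (ha : (k : ℝ) - 1 < 2 * a) :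
    ContDiff ℝ k (rotationField fun s => s ^ a) := by
  have h1 : (rotationField fun s => s ^ a) = fun q => rotCLM q + sqNorm q ^ a • rotCLM q := by
    funext q
    rw [rotationField, add_smul, one_smul, rotCLM_apply]
  rw [h1]
  refine rotCLM.contDiff.add (contDiff_of_homogeneous k (c := 2 * a + 1) (by linarith)
    (fun x hx => ?_) fun r hr x => ?_)
  · exact (contDiff_sqNorm.contDiffAt.rpow_const_of_ne (sqNorm_pos hx).ne').smul
      rotCLM.contDiff.contDiffAt
  · have h2 : sqNorm (r • x) = r ^ 2 * sqNorm x := by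
      simp only [sqNorm, PiLp.smul_apply, smul_eq_mul]
      ring
    rw [h2, Real.mul_rpow (by positivity) (sqNorm_nonneg x), map_smul, smul_smul, smul_smul,
      Real.rpow_add hr, Real.rpow_mul hr.le, Real.rpow_one]
    norm_num
    ring_nf

/-- The regularity of the period function of a rotation field at the center is inherited by the
angular velocity on a line through the center. -/
theorem contDiffAt_of_contDiffAt_periodFunction {h : ℝ → ℝ} (hpos : ∀ s, 0 ≤ s → 0 < 1 + h s)
    (h0 : h 0 = 0) (hX : ContDiff ℝ 1 (rotationField h)) {m : WithTop ℕ∞}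
    (hT : ContDiffAt ℝ m (periodFunction Set.univ (rotationField h) 0 1) 0) :
    ContDiffAt ℝ m (fun s : ℝ => h (s ^ 2)) 0 := by
  rw [show periodFunction Set.univ (rotationField h) 0 1 = _ from
    funext (periodFunction_rotationField hpos h0 hX)] at hT
  let e : ℝ →L[ℝ] Plane := ContinuousLinearMap.toSpanSingleton ℝ !₂[1, 0]
  have he : ∀ s, sqNorm (e s) = s ^ 2 := fun s => by
    simp [e, sqNorm, ContinuousLinearMap.toSpanSingleton_apply]
  have h1 : ContDiffAt ℝ m (fun s => 2 * Real.pi / (1 + h (s ^ 2))) 0 := by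
    have h2 : ContDiffAt ℝ m (fun q => 2 * Real.pi / (1 + h (sqNorm q))) (e 0) := by
      rw [map_zero]; exact hT
    simpa only [Function.comp_def, he] using h2.comp (0 : ℝ) e.contDiff.contDiffAt
  have h3 : (fun s : ℝ => h (s ^ 2)) = fun s => 2 * Real.pi * (2 * Real.pi / (1 + h (s ^ 2)))⁻¹ - 1 := by
    funext s
    have := (hpos (s ^ 2) (by positivity)).ne'
    field_simp
    ring
  rw [h3]
  refine (contDiffAt_const.mul (h1.inv ?_)).sub contDiffAt_const
  simp [h0, Real.pi_ne_zero]

theorem one_add_rpow_pos (a : ℝ) : ∀ s : ℝ, 0 ≤ s → 0 < 1 + s ^ a := fun s hs => by positivity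

theorem pos_of_sub_one_lt_two_mul {k : ℕ} {a : ℝ} (hk : 1 ≤ k) (h1 : (k : ℝ) - 1 < 2 * a) : 0 < a := by
  have : (1 : ℝ) ≤ k := by exact_mod_cast hk
  linarith

theorem exampleField_properties {k : ℕ} {a : ℝ} (hk : 1 ≤ k) (h1 : (k : ℝ) - 1 < 2 * a)
    (h2 : 2 * a ≤ k) (ha : ∀ n : ℕ, a ≠ n) :
    ContDiff ℝ k (exampleField a) ∧ IsNondegenerateCenter Set.univ (exampleField a) 0 1 ∧
      periodAnnulus Set.univ (exampleField a) 0 = Set.univ ∧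
      (∀ q : Plane, periodFunction Set.univ (exampleField a) 0 1 q =
        2 * Real.pi / (1 + ((q 0) ^ 2 + (q 1) ^ 2) ^ a)) ∧
      ¬ ContDiffAt ℝ k (periodFunction Set.univ (exampleField a) 0 1) 0 := by
  have ha0 := pos_of_sub_one_lt_two_mul hk h1
  have h0 : (0 : ℝ) ^ a = 0 := Real.zero_rpow ha0.ne'
  have hX := contDiff_rotationField_rpow h1
  have hX1 : ContDiff ℝ 1 (rotationField fun s => s ^ a) := hX.of_le (by exact_mod_cast hk)
  rw [exampleField_eq]
  exact ⟨hX, isNondegenerateCenter_rotationField (one_add_rpow_pos a) h0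
    (continuousAt_id.rpow_const (Or.inr ha0.le)), periodAnnulus_rotationField (one_add_rpow_pos a),
    periodFunction_rotationField (one_add_rpow_pos a) h0 hX1,
    fun hT => not_contDiffAt_sq_rpow h1 h2 ha
      (contDiffAt_of_contDiffAt_periodFunction (one_add_rpow_pos a) h0 hX1 hT)⟩

theorem exists_exponent (k : ℕ) : ∃ a : ℝ, (k : ℝ) - 1 < 2 * a ∧ 2 * a ≤ k ∧ ∀ n : ℕ, a ≠ n := by
  rcases Nat.even_or_odd' k with ⟨j, rfl | rfl⟩
  · refine ⟨j - 1 / 4, by push_cast; linarith, by push_cast; linarith, fun n hn => ?_⟩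
    have h1 : (4 * j : ℝ) = 4 * n + 1 := by linarith
    have h2 : 4 * j = 4 * n + 1 := by exact_mod_cast h1
    omega
  · refine ⟨j + 1 / 2, by push_cast; linarith, by push_cast; linarith, fun n hn => ?_⟩
    have h1 : (2 * j + 1 : ℝ) = 2 * n := by linarith
    have h2 : 2 * j + 1 = 2 * n := by exact_mod_cast h1
    omega

theorem _root_.WithTop.natCast_le_of_sub_one_lt {k : ℕ} {m : WithTop ℕ∞}
    (h : (k : WithTop ℕ∞) - 1 < m) : (k : WithTop ℕ∞) ≤ m := by
  match m with
  | ω => exact le_top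
  | ∞ => exact_mod_cast le_top
  | (m : ℕ) =>
    have h2 : ((k : WithTop ℕ∞) - 1) = ((k - 1 : ℕ) : WithTop ℕ∞) := by norm_cast
    rw [h2] at h
    have h3 : k - 1 < m := by exact_mod_cast h
    have h4 : k ≤ m := by omega
    exact_mod_cast h4

theorem exists_center_not_contDiffAt_periodFunction {k : WithTop ℕ∞} (hk : 1 ≤ k) :
    ∃ (U : Set Plane) (X : Plane → Plane) (p : Plane) (ω₀ : ℝ), IsOpen U ∧ p ∈ U ∧
      ContDiffOn ℝ k X U ∧ IsNondegenerateCenter U X p ω₀ ∧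
      ∀ m : WithTop ℕ∞, k - 1 < m → ¬ ContDiffAt ℝ m (periodFunction U X p ω₀) p := by
  match k with
  | ω =>
    -- No `m` exceeds `ω`, so any analytic center will do; the linear rotation is taken.
    have hX : ContDiff ℝ ω (rotationField fun _ => 0) := contDiff_rotationField contDiff_const
    exact ⟨Set.univ, _, 0, 1, isOpen_univ, trivial, hX.contDiffOn,
      isNondegenerateCenter_rotationField (by simp) rfl continuousAt_const,
      fun m hm => absurd hm not_top_lt⟩
  | ∞ =>
    have hX : ContDiff ℝ ∞ (rotationField expNegInvGlue) :=
      contDiff_rotationField expNegInvGlue.contDiff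
    have hpos : ∀ s, 0 ≤ s → 0 < 1 + expNegInvGlue s := fun s _ => by
      linarith [expNegInvGlue.nonneg s]
    refine ⟨Set.univ, _, 0, 1, isOpen_univ, trivial, hX.contDiffOn,
      isNondegenerateCenter_rotationField hpos expNegInvGlue.zero
        (expNegInvGlue.contDiff (n := 0)).continuous.continuousAt, fun m hm hT => ?_⟩
    have hm' : m = ω := by
      match m with
      | ω => rfl
      | (m : ℕ∞) =>
        have h1 : (∞ : WithTop ℕ∞) < m := hm
        exact absurd (by exact_mod_cast h1) (not_top_lt (a := m))
    rw [hm'] at hT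
    exact not_analyticAt_expNegInvGlue_sq (contDiffAt_of_contDiffAt_periodFunction hpos
      expNegInvGlue.zero (hX.of_le hk) hT).analyticAt
  | (k : ℕ) =>
    have hk1 : 1 ≤ k := by exact_mod_cast hk
    obtain ⟨a, h1, h2, h3⟩ := exists_exponent k
    obtain ⟨hX, hc, -, -, hT⟩ := exampleField_properties hk1 h1 h2 h3
    exact ⟨Set.univ, _, 0, 1, isOpen_univ, trivial, hX.contDiffOn, hc,
      fun m hm h => hT (h.of_le (WithTop.natCast_le_of_sub_one_lt hm))⟩

end PlanarCenter

theorem mainTheorem2 :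
    -- Regularity; `k` is a natural number, `∞` or `ω`, and `∞ - 1 = ∞`, `ω - 1 = ω`.
    (∀ (k : WithTop ℕ∞) (U : Set PlanarCenter.Plane)
        (X : PlanarCenter.Plane → PlanarCenter.Plane) (p : PlanarCenter.Plane) (ω₀ : ℝ),
      1 ≤ k → IsOpen U → p ∈ U → ContDiffOn ℝ k X U →
      PlanarCenter.IsNondegenerateCenter U X p ω₀ →
        ContDiffOn ℝ k (PlanarCenter.periodFunction U X p ω₀)
          (PlanarCenter.periodAnnulus U X p \ {p}) ∧
        ContDiffAt ℝ (k - 1) (PlanarCenter.periodFunction U X p ω₀) p) ∧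
    -- For each `k` the regularity at `p` can not be improved in general.
    (∀ k : WithTop ℕ∞, 1 ≤ k →
      ∃ (U : Set PlanarCenter.Plane) (X : PlanarCenter.Plane → PlanarCenter.Plane)
        (p : PlanarCenter.Plane) (ω₀ : ℝ),
        IsOpen U ∧ p ∈ U ∧ ContDiffOn ℝ k X U ∧
        PlanarCenter.IsNondegenerateCenter U X p ω₀ ∧
        ∀ m : WithTop ℕ∞, k - 1 < m →
          ¬ ContDiffAt ℝ m (PlanarCenter.periodFunction U X p ω₀) p) ∧
    -- Explicit examples for finite `k`.
    (∀ (k : ℕ) (a : ℝ), 1 ≤ k → (k : ℝ) - 1 < 2 * a → 2 * a ≤ k → (∀ n : ℕ, a ≠ n) →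
      ContDiff ℝ k (PlanarCenter.exampleField a) ∧
      PlanarCenter.IsNondegenerateCenter Set.univ (PlanarCenter.exampleField a) 0 1 ∧
      PlanarCenter.periodAnnulus Set.univ (PlanarCenter.exampleField a) 0 = Set.univ ∧
      (∀ q : PlanarCenter.Plane,
        PlanarCenter.periodFunction Set.univ (PlanarCenter.exampleField a) 0 1 q =
          2 * Real.pi / (1 + ((q 0) ^ 2 + (q 1) ^ 2) ^ a)) ∧
      ¬ ContDiffAt ℝ k
        (PlanarCenter.periodFunction Set.univ (PlanarCenter.exampleField a) 0 1) 0) := by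
  exact ⟨fun k U X p ω₀ hk hU _ hX h => PlanarCenter.contDiff_periodFunction hk hU hX h,
    fun k hk => PlanarCenter.exists_center_not_contDiffAt_periodFunction hk,
    fun k a hk h1 h2 ha => PlanarCenter.exampleField_properties hk h1 h2 ha⟩
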